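/- Let $1<\gamma<2$ and let $A:(0,\infty)\to(0,\infty)$ be continuously differentiable with $A'(S)>0$ for all $S>0$ and unbounded ($\sup_{S>0}A(S)=\infty$). For states $(\rho,v,S)$ in the region $\rho>0$, $-1<v<1$, $S>0$, let the particle density $n>0$ be determined by $\rho=n\,\epsilon(n,S)$ with $\epsilon(n,S)=A(S)n^{\gamma-1}$ (the ultra-relativistic limit), and let $p=n^2\,\partial\epsilon/\partial n=(\gamma-1)\rho$. Consider the relativistic Euler equations $U_t+F(U)_x=0$ with $$U=\Big(\tfrac{n}{\sqrt{1-v^2}},\ (\rho+p)\tfrac{v}{1-v^2},\ (\rho+p)\tfrac{v^2}{1-v^2}+\rho\Big),\qquad F=\Big(\tfrac{nv}{\sqrt{1-v^2}},\ (\rho+p)\tfrac{v^2}{1-v^2}+p,\ (\rho+p)\tfrac{v}{1-v^2}\Big),$$ whose characteristic speeds are $\lambda_1=\frac{v-a}{1-av}<\lambda_2=v<\lambda_3=\frac{v+a}{1+av}$, $a=\sqrt{\gamma-1}$. An $i$-shock ($i=1,3$) of speed $s$ from a left state $U_1$ to a right state $U_2$ is a jump satisfying the Rankine--Hugoniot conditions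 $s(U_2-U_1)=F(U_2)-F(U_1)$ and the Lax condition $\lambda_i(U_2)<s<\lambda_i(U_1)$; a contact wave is a jump satisfying the Rankine--Hugoniot conditions with $s=\lambda_2(U_1)=\lambda_2(U_2)$; a centered $i$-rarefaction ($i=1,3$) is a continuous solution $w(x/t)$ with $\lambda_i(w(\xi))=\xi$. Contacts and rarefactions may have strength zero. Then for any two states $U_L=(\rho_L,v_L,S_L)$, $U_R=(\rho_R,v_R,S_R)$ in this region the Riemann problem with data $U_L$ for $x<0$ and $U_R$ for $x>0$ has a weak solution of the form $w(x/t)$, with values in the region, which consists of constant states $U_L,U_M,U_M',U_R$ separated, from left to right, by a 1-wave (a centered 1-rarefaction or a 1-shock), a contact wave across which only $S$ changes, and a 3-wave (a centered 3-rarefaction or a 3-shock). It is unique in the class of functions of $x/t$ that consist of finitely many constant states of the region, starting with $U_L$ and ending with $U_R$, separated by centered rarefaction, shock and contact waves in any number and order: any member of this class equals $w(x/t)$ for all but finitely many values of $x/t$. -/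

import Mathlib

open MeasureTheory Set

noncomputable section

/-- A state of the gas: proper energy density `ρ`, velocity `v` (speed of light `1`),
specific entropy `S`. -/
@[ext]
structure GasState where
  ρ : ℝ
  v : ℝ
  S : ℝ

/-- The region `ρ > 0`, `-1 < v < 1`, `S > 0`. -/
def GasState.IsPhysical (W : GasState) : Prop :=
  0 < W.ρ ∧ (-1 < W.v ∧ W.v < 1) ∧ 0 < W.S

/-- The specific internal energy `ε(n, S) = A(S) n ^ (γ - 1)`. -/
def internalEnergy (γ : ℝ) (A : ℝ → ℝ) (n S : ℝ) : ℝ := A S * n ^ (γ - 1)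

/-- The particle number density: in the ultra-relativistic limit it is the positive solution `n` of
`ρ = n ε(n, S)` (see `numberDensity_spec`). -/
def numberDensity (γ : ℝ) (A : ℝ → ℝ) (W : GasState) : ℝ := (W.ρ / A W.S) ^ (1 / γ)

/-- The pressure `p = n² ∂ε/∂n = (γ - 1) ρ` (see `pressure_spec`). -/
def pressure (γ : ℝ) (W : GasState) : ℝ := (γ - 1) * W.ρ

/-- `n` is the one and only positive number with `n ε(n, S) = ρ`. -/
theorem numberDensity_spec {γ : ℝ} (hγ : 1 < γ) {A : ℝ → ℝ} (hA : ∀ S, 0 < S → 0 < A S)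
    {W : GasState} (hW : W.IsPhysical) (n : ℝ) :
    (0 < n ∧ n * internalEnergy γ A n W.S = W.ρ) ↔ n = numberDensity γ A W := by
  obtain ⟨hρ, -, hS⟩ := hW
  have hAS := hA _ hS
  have hγ0 : γ ≠ 0 := by linarith
  have key : ∀ m : ℝ, 0 < m → m * internalEnergy γ A m W.S = A W.S * m ^ γ := by
    intro m hm
    have : m ^ γ = m * m ^ (γ - 1) := by
      rw [Real.rpow_sub_one hm.ne']; field_simp
    rw [internalEnergy, this]; ring
  constructor
  · rintro ⟨hn, h⟩
    rw [key n hn] at h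
    rw [numberDensity, ← h, mul_div_cancel_left₀ _ hAS.ne', ← Real.rpow_mul hn.le,
      mul_one_div_cancel hγ0, Real.rpow_one]
  · rintro rfl
    have hpos : 0 < numberDensity γ A W := Real.rpow_pos_of_pos (div_pos hρ hAS) _
    refine ⟨hpos, ?_⟩
    rw [key _ hpos, numberDensity, ← Real.rpow_mul (div_pos hρ hAS).le,
      one_div_mul_cancel hγ0, Real.rpow_one]
    field_simp

/-- The second law of thermodynamics `p = n² ∂ε/∂n`. -/
theorem pressure_spec {γ : ℝ} (hγ : 1 < γ) {A : ℝ → ℝ} (hA : ∀ S, 0 < S → 0 < A S)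
    {W : GasState} (hW : W.IsPhysical) :
    HasDerivAt (fun n => internalEnergy γ A n W.S)
      (pressure γ W / numberDensity γ A W ^ 2) (numberDensity γ A W) := by
  obtain ⟨hn, h⟩ := (numberDensity_spec hγ hA hW _).2 rfl
  have hd := (Real.hasDerivAt_rpow_const (x := numberDensity γ A W) (p := γ - 1)
    (Or.inl hn.ne')).const_mul (A W.S)
  have e : pressure γ W / numberDensity γ A W ^ 2
      = A W.S * ((γ - 1) * numberDensity γ A W ^ (γ - 1 - 1)) := by
    rw [pressure, ← h, internalEnergy, Real.rpow_sub_one hn.ne' (γ - 1)]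
    field_simp
  rw [e]
  exact hd

/-- The conserved quantities of the relativistic Euler equations: particle number, momentum and
energy. -/
def conserved (γ : ℝ) (A : ℝ → ℝ) (W : GasState) : Fin 3 → ℝ :=
  ![numberDensity γ A W / √(1 - W.v ^ 2),
    (W.ρ + pressure γ W) * (W.v / (1 - W.v ^ 2)),
    (W.ρ + pressure γ W) * (W.v ^ 2 / (1 - W.v ^ 2)) + W.ρ]

/-- The fluxes of the conserved quantities. -/
def flux (γ : ℝ) (A : ℝ → ℝ) (W : GasState) : Fin 3 → ℝ :=
  ![numberDensity γ A W * W.v / √(1 - W.v ^ 2),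
    (W.ρ + pressure γ W) * (W.v ^ 2 / (1 - W.v ^ 2)) + pressure γ W,
    (W.ρ + pressure γ W) * (W.v / (1 - W.v ^ 2))]

/-- The characteristic speeds `λ₁ < λ₂ < λ₃` (index `0, 1, 2`), where `a = √(γ - 1)` is the speed of
sound. -/
def charSpeed (γ : ℝ) (i : Fin 3) (W : GasState) : ℝ :=
  ![(W.v - √(γ - 1)) / (1 - W.v * √(γ - 1)),
    W.v,
    (W.v + √(γ - 1)) / (1 + W.v * √(γ - 1))] i

/-- `W` (a function of `(x, t)`; only its values for `t > 0` matter) is a weak solution, with values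
in the physical region, of `U_t + F(U)_x = 0` on `t > 0` with initial data `W₀`. The test functions
are the `C¹` functions of compact support on the closed half plane, that is, the restrictions to
`t ≥ 0` of such functions on the plane. -/
def IsWeakSolution (γ : ℝ) (A : ℝ → ℝ) (W₀ : ℝ → GasState) (W : ℝ × ℝ → GasState) : Prop :=
  (∀ x t : ℝ, 0 < t → (W (x, t)).IsPhysical) ∧
  ∀ k : Fin 3,
    LocallyIntegrableOn (fun q => conserved γ A (W q) k) {q : ℝ × ℝ | 0 ≤ q.2} ∧
    LocallyIntegrableOn (fun q => flux γ A (W q) k) {q : ℝ × ℝ | 0 ≤ q.2} ∧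
    LocallyIntegrable (fun x => conserved γ A (W₀ x) k) ∧
    ∀ φ : ℝ × ℝ → ℝ, ContDiff ℝ 1 φ → HasCompactSupport φ →
      (∫ q in {q : ℝ × ℝ | 0 < q.2},
          (conserved γ A (W q) k * fderiv ℝ φ q (0, 1) + flux γ A (W q) k * fderiv ℝ φ q (1, 0)))
        + ∫ x : ℝ, conserved γ A (W₀ x) k * φ (x, 0) = 0

/-- Riemann initial data (the value at `x = 0` is immaterial). -/
def riemannData (UL UR : GasState) (x : ℝ) : GasState := if x < 0 then UL else UR

/-- The Rankine–Hugoniot conditions `s [[U]] = [[F(U)]]` for a jump from `U₁` (left) to `U₂`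
(right) of speed `s`. -/
def RankineHugoniot (γ : ℝ) (A : ℝ → ℝ) (U₁ U₂ : GasState) (s : ℝ) : Prop :=
  ∀ k : Fin 3, s * (conserved γ A U₂ k - conserved γ A U₁ k) = flux γ A U₂ k - flux γ A U₁ k

/-- On `α ≤ x/t ≤ β` the profile `w` (a function of `ξ = x/t`) is a centered rarefaction wave of
family `i` from `U₁` (left) to `U₂` (right): it is continuous, `λᵢ(w(ξ)) = ξ`, and `w(x/t)` solves
the conservation laws, which for a function of `ξ = x/t` read `F(w)' = ξ U(w)'`. Thus `w` runs along
an integral curve of the `i`-th characteristic field. The case `α = β` is the wave of strength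
zero. -/
def IsRarefactionWave (γ : ℝ) (A : ℝ → ℝ) (i : Fin 3) (w : ℝ → GasState) (U₁ U₂ : GasState)
    (α β : ℝ) : Prop :=
  α ≤ β ∧ w α = U₁ ∧ w β = U₂ ∧
  (∀ ξ ∈ Icc α β, (w ξ).IsPhysical ∧ charSpeed γ i (w ξ) = ξ) ∧
  ContinuousOn (fun ξ => (w ξ).ρ) (Icc α β) ∧
  ContinuousOn (fun ξ => (w ξ).v) (Icc α β) ∧
  ContinuousOn (fun ξ => (w ξ).S) (Icc α β) ∧
  ∀ ξ ∈ Ioo α β, ∀ k : Fin 3, ∃ d : ℝ,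
    HasDerivAt (fun η => conserved γ A (w η) k) d ξ ∧
    HasDerivAt (fun η => flux γ A (w η) k) (ξ * d) ξ

/-- A shock wave of family `i` and speed `s`: Rankine–Hugoniot conditions and Lax entropy
condition. -/
def IsShockWave (γ : ℝ) (A : ℝ → ℝ) (i : Fin 3) (U₁ U₂ : GasState) (s : ℝ) : Prop :=
  RankineHugoniot γ A U₁ U₂ s ∧ charSpeed γ i U₂ < s ∧ s < charSpeed γ i U₁

/-- A contact wave of speed `s`: a jump in the linearly degenerate second family, which travels with
the characteristic speed `λ₂ = v` of both sides (possibly of strength zero). -/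
def IsContactWave (γ : ℝ) (A : ℝ → ℝ) (U₁ U₂ : GasState) (s : ℝ) : Prop :=
  RankineHugoniot γ A U₁ U₂ s ∧ s = charSpeed γ 1 U₁ ∧ s = charSpeed γ 1 U₂

/-- In the sector `α ≤ x/t ≤ β` the profile `w` is a wave of family `i` from `U₁` to `U₂`: a contact
wave for the second family (index `1`), a centered rarefaction or a shock wave for the first and
third (index `0` and `2`). The value of `w` on the line of a jump is immaterial. -/
def IsElementaryWave (γ : ℝ) (A : ℝ → ℝ) (i : Fin 3) (w : ℝ → GasState) (U₁ U₂ : GasState)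
    (α β : ℝ) : Prop :=
  (i ≠ 1 ∧ IsRarefactionWave γ A i w U₁ U₂ α β) ∨
  (i ≠ 1 ∧ α = β ∧ IsShockWave γ A i U₁ U₂ α) ∨
  (i = 1 ∧ α = β ∧ IsContactWave γ A U₁ U₂ α)

/-- The profile `w` (a function of `ξ = x/t`) consists of the constant states
`UL = V 0, V 1, …, V N = UR`, where `V j` and `V (j + 1)` are separated by a wave of family `fam j`
that occupies the sector `α j ≤ x/t ≤ β j`, and these sectors are ordered from left to right. -/
def IsWaveFan (γ : ℝ) (A : ℝ → ℝ) (UL UR : GasState) (w : ℝ → GasState) (N : ℕ)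
    (fam : Fin N → Fin 3) (V : Fin (N + 1) → GasState) (α β : Fin N → ℝ) : Prop :=
  V 0 = UL ∧ V (Fin.last N) = UR ∧ (∀ j, (V j).IsPhysical) ∧
  (∀ j : Fin N, IsElementaryWave γ A (fam j) w (V j.castSucc) (V j.succ) (α j) (β j)) ∧
  (∀ j k : Fin N, j < k → β j ≤ α k) ∧
  ∀ (j : Fin (N + 1)) (ξ : ℝ), (∀ k : Fin N, k.castSucc < j → β k < ξ) →
    (∀ k : Fin N, j ≤ k.castSucc → ξ < α k) → w ξ = V j

/-- The class of solutions `w(x/t)` of the Riemann problem that are made of finitely many constant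
states separated by centered rarefaction, shock and contact waves, in whatever number and order. -/
def IsCenteredSolution (γ : ℝ) (A : ℝ → ℝ) (UL UR : GasState) (w : ℝ → GasState) : Prop :=
  ∃ (N : ℕ) (fam : Fin N → Fin 3) (V : Fin (N + 1) → GasState) (α β : Fin N → ℝ),
    IsWaveFan γ A UL UR w N fam V α β

end

noncomputable section

/-! Since `p = (γ - 1) ρ`, momentum and energy balance involve only `ρ` and `v`, and the sound speed
`a = √(γ - 1)` is constant. By Lorentz invariance the natural velocity variable is the Doppler
factor `(1 + v)/(1 - v)`, which is multiplicative under composition of velocities. Across a 1-wave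
its ratio depends only on the density ratio `z`, through `waveFactor`. For `z ≤ 1` the wave is a
rarefaction, the Riemann invariant `log ρ + γ/(2a) log doppler v` is constant, and the factor is `z
^ (-2a/γ)`. For `z > 1` it is a shock; in its rest frame the velocities on the two sides satisfy `u₁
u₂ = a²` and `u₁` is an explicit increasing function of `z`. The 3-waves are mirror images, and a
contact preserves `ρ` and `v`.

The density `ρ` between the outer waves therefore satisfies the single equation `waveFactor (ρ/ρ_L)
* waveFactor (ρ/ρ_R) = doppler v_R / doppler v_L`. As `waveFactor` decreases continuously and
strictly from `∞` to `0`, it has exactly one solution (`exists_middle_density`,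
`middle_density_unique`). The entropy is recovered from the particle number: it is constant in a
rarefaction, and behind a shock `A(S)` must exceed its value ahead (`shock_entropy_nonneg`), so a
suitable `S` exists because `A` is continuous and unbounded.

Uniqueness among all fans (`WaveChain.structure`) comes from the ordering of the speeds. Adjacent
rarefactions of one family merge, the strict Lax inequalities forbid any other adjacent nontrivial
waves of that family, and so every fan reduces to a 1-wave, a contact and a 3-wave. An outer wave is
determined by its outer state and the middle density (`IsSimpleWave.unique`).

A self-similar profile is a weak solution as soon as `F(w) - ξ U(w)` is continuous with derivative
`-U(w)` off a finite set (`IsSelfSimilarSolution.isWeakSolution`); continuity at a jump is the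
Rankine–Hugoniot condition. -/

/-- The hypotheses on the equation of state that are used in the construction of waves. -/
structure IsGasLaw (γ : ℝ) (A : ℝ → ℝ) : Prop where
  one_lt : 1 < γ
  lt_two : γ < 2
  pos : ∀ S, 0 < S → 0 < A S
  cont : ContinuousOn A (Ioi 0)
  mono : StrictMonoOn A (Ioi 0)
  unbounded : ∀ M : ℝ, ∃ S, 0 < S ∧ M < A S

/-- The speed of sound `√(γ - 1)`. -/
def soundSpeed (γ : ℝ) : ℝ := √(γ - 1)

/-- The Doppler factor `(1 + v) / (1 - v)`, the exponential of twice the rapidity. -/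
def doppler (v : ℝ) : ℝ := (1 + v) / (1 - v)

/-- Reflection in space. -/
def GasState.refl (W : GasState) : GasState := ⟨W.ρ, -W.v, W.S⟩

/-! ### Velocity composition, reflection symmetry and Doppler factors. -/

section Basic

variable {γ : ℝ} {A : ℝ → ℝ}

theorem IsGasLaw.soundSpeed_sq (h : IsGasLaw γ A) : soundSpeed γ ^ 2 = γ - 1 :=
  Real.sq_sqrt (by linarith [h.one_lt])

theorem IsGasLaw.soundSpeed_pos (h : IsGasLaw γ A) : 0 < soundSpeed γ :=
  Real.sqrt_pos.2 (by linarith [h.one_lt])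

theorem IsGasLaw.soundSpeed_lt_one (h : IsGasLaw γ A) : soundSpeed γ < 1 := by
  nlinarith [h.soundSpeed_sq, h.soundSpeed_pos, h.lt_two]

theorem IsGasLaw.gamma_eq (h : IsGasLaw γ A) : γ = 1 + soundSpeed γ ^ 2 := by
  rw [h.soundSpeed_sq]; ring

theorem IsGasLaw.gamma_pos (h : IsGasLaw γ A) : 0 < γ := by linarith [h.one_lt]

theorem charSpeed_zero (W : GasState) :
    charSpeed γ 0 W = (W.v - soundSpeed γ) / (1 - W.v * soundSpeed γ) := rfl

theorem charSpeed_one (W : GasState) : charSpeed γ 1 W = W.v := rfl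

theorem charSpeed_two (W : GasState) :
    charSpeed γ 2 W = (W.v + soundSpeed γ) / (1 + W.v * soundSpeed γ) := rfl

theorem one_sub_mul_pos {a v : ℝ} (ha : -1 < a ∧ a < 1) (hv : -1 < v ∧ v < 1) :
    0 < 1 - v * a := by
  nlinarith [mul_pos (sub_pos.2 ha.2) (neg_lt_iff_pos_add.1 hv.1),
    mul_pos (sub_pos.2 hv.2) (neg_lt_iff_pos_add.1 ha.1)]

theorem IsGasLaw.soundSpeed_mem (h : IsGasLaw γ A) :
    -1 < soundSpeed γ ∧ soundSpeed γ < 1 :=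
  ⟨by linarith [h.soundSpeed_pos], h.soundSpeed_lt_one⟩

theorem one_sub_sq_pos {v : ℝ} (hv : -1 < v ∧ v < 1) : 0 < 1 - v ^ 2 := by
  nlinarith [mul_pos (sub_pos.2 hv.2) (neg_lt_iff_pos_add.1 hv.1)]

/-- The relativistic difference of two velocities is a velocity. -/
theorem velocity_sub_mem {a v : ℝ} (ha : -1 < a ∧ a < 1) (hv : -1 < v ∧ v < 1) :
    -1 < (v - a) / (1 - v * a) ∧ (v - a) / (1 - v * a) < 1 := by
  have h := one_sub_mul_pos ha hv
  rw [lt_div_iff₀ h, div_lt_iff₀ h]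
  constructor
  · nlinarith [mul_pos (sub_pos.2 ha.2) (neg_lt_iff_pos_add.1 hv.1)]
  · nlinarith [mul_pos (sub_pos.2 hv.2) (neg_lt_iff_pos_add.1 ha.1)]

theorem velocity_add_mem {a v : ℝ} (ha : -1 < a ∧ a < 1) (hv : -1 < v ∧ v < 1) :
    -1 < (v + a) / (1 + v * a) ∧ (v + a) / (1 + v * a) < 1 := by
  have := velocity_sub_mem (a := -a) ⟨by linarith [ha.2], by linarith [ha.1]⟩ hv
  simpa using this

theorem charSpeed_zero_mem (h : IsGasLaw γ A) {W : GasState} (hW : W.IsPhysical) :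
    -1 < charSpeed γ 0 W ∧ charSpeed γ 0 W < 1 :=
  velocity_sub_mem h.soundSpeed_mem hW.2.1

theorem charSpeed_zero_lt (h : IsGasLaw γ A) {W : GasState} (hW : W.IsPhysical) :
    charSpeed γ 0 W < W.v := by
  have h1 := one_sub_mul_pos h.soundSpeed_mem hW.2.1
  rw [charSpeed_zero, div_lt_iff₀ h1]
  nlinarith [mul_pos h.soundSpeed_pos (one_sub_sq_pos hW.2.1)]

/-! ### Reflection -/

@[simp] theorem GasState.refl_refl (W : GasState) : W.refl.refl = W := by
  simp [GasState.refl]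

@[simp] theorem GasState.refl_ρ (W : GasState) : W.refl.ρ = W.ρ := rfl
@[simp] theorem GasState.refl_v (W : GasState) : W.refl.v = -W.v := rfl
@[simp] theorem GasState.refl_S (W : GasState) : W.refl.S = W.S := rfl

theorem GasState.IsPhysical.refl {W : GasState} (hW : W.IsPhysical) : W.refl.IsPhysical :=
  ⟨hW.1, ⟨neg_lt_neg hW.2.1.2, by simpa using neg_lt_neg hW.2.1.1⟩, hW.2.2⟩

theorem charSpeed_zero_refl (W : GasState) : charSpeed γ 0 W.refl = -charSpeed γ 2 W := by
  rw [charSpeed_zero, charSpeed_two, ← neg_div]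
  congr 1
  · simp only [GasState.refl]; ring
  · simp [GasState.refl]

theorem charSpeed_two_refl (W : GasState) : charSpeed γ 2 W.refl = -charSpeed γ 0 W := by
  rw [← neg_eq_iff_eq_neg, ← charSpeed_zero_refl, GasState.refl_refl]

/-- The sign by which a reflection multiplies a conserved quantity. -/
def reflSign (k : Fin 3) : ℝ := ![1, -1, 1] k

theorem conserved_refl (W : GasState) (k : Fin 3) :
    conserved γ A W.refl k = reflSign k * conserved γ A W k := by
  fin_cases k <;> simp [conserved, reflSign, numberDensity, pressure, neg_div]

theorem flux_refl (W : GasState) (k : Fin 3) :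
    flux γ A W.refl k = -reflSign k * flux γ A W k := by
  fin_cases k <;> simp [flux, reflSign, numberDensity, pressure, neg_div]

theorem RankineHugoniot.refl {U₁ U₂ : GasState} {s : ℝ} (h : RankineHugoniot γ A U₁ U₂ s) :
    RankineHugoniot γ A U₂.refl U₁.refl (-s) := by
  intro k
  simp only [conserved_refl, flux_refl]
  linear_combination reflSign k * h k

theorem lt_charSpeed_two (h : IsGasLaw γ A) {W : GasState} (hW : W.IsPhysical) :
    W.v < charSpeed γ 2 W := by
  have := charSpeed_zero_lt h hW.refl
  rw [charSpeed_zero_refl] at this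
  simpa using this

/-- Stated for any two families exchanged by the reflection, so that one proof carries 1-waves to
3-waves and back. -/
theorem IsRarefactionWave.refl {i j : Fin 3} {w : ℝ → GasState} {U₁ U₂ : GasState} {α β : ℝ}
    (hij : ∀ W : GasState, charSpeed γ j W.refl = -charSpeed γ i W)
    (h : IsRarefactionWave γ A i w U₁ U₂ α β) :
    IsRarefactionWave γ A j (fun ξ => (w (-ξ)).refl) U₂.refl U₁.refl (-β) (-α) := by
  obtain ⟨hle, hα, hβ, hp, hρ, hv, hS, hd⟩ := h
  have hm : MapsTo (fun ξ : ℝ => -ξ) (Icc (-β) (-α)) (Icc α β) := fun ξ hξ =>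
    ⟨by linarith [hξ.2], by linarith [hξ.1]⟩
  refine ⟨by linarith, by simp [hβ], by simp [hα], ?_, hρ.comp (by fun_prop) hm,
    (hv.comp (by fun_prop) hm).neg, hS.comp (by fun_prop) hm, ?_⟩
  · intro ξ hξ
    obtain ⟨h1, h2⟩ := hp _ (hm hξ)
    exact ⟨h1.refl, by rw [hij, h2]; ring⟩
  · intro ξ hξ k
    obtain ⟨d, h1, h2⟩ := hd (-ξ) ⟨by linarith [hξ.2], by linarith [hξ.1]⟩ k
    refine ⟨reflSign k * (d * -1), ?_, ?_⟩
    · simp only [conserved_refl]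
      exact (HasDerivAt.comp ξ h1 (hasDerivAt_neg ξ)).const_mul _
    · simp only [flux_refl]
      exact ((HasDerivAt.comp ξ h2 (hasDerivAt_neg ξ)).const_mul (-reflSign k)).congr_deriv
        (by ring)

theorem IsRarefactionWave.refl_two {w : ℝ → GasState} {U₁ U₂ : GasState} {α β : ℝ}
    (h : IsRarefactionWave γ A 2 w U₁ U₂ α β) :
    IsRarefactionWave γ A 0 (fun ξ => (w (-ξ)).refl) U₂.refl U₁.refl (-β) (-α) :=
  IsRarefactionWave.refl charSpeed_zero_refl h

theorem IsRarefactionWave.refl_zero {w : ℝ → GasState} {U₁ U₂ : GasState} {α β : ℝ}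
    (h : IsRarefactionWave γ A 0 w U₁ U₂ α β) :
    IsRarefactionWave γ A 2 (fun ξ => (w (-ξ)).refl) U₂.refl U₁.refl (-β) (-α) :=
  IsRarefactionWave.refl charSpeed_two_refl h

theorem IsRarefactionWave.congr {i : Fin 3} {w w' : ℝ → GasState} {U₁ U₂ : GasState} {α β : ℝ}
    (h : IsRarefactionWave γ A i w U₁ U₂ α β) (hw : ∀ ξ ∈ Icc α β, w' ξ = w ξ) :
    IsRarefactionWave γ A i w' U₁ U₂ α β := by
  obtain ⟨hle, hα, hβ, hp, hρ, hv, hS, hd⟩ := h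
  refine ⟨hle, by rw [hw _ (left_mem_Icc.2 hle), hα], by rw [hw _ (right_mem_Icc.2 hle), hβ],
    fun ξ hξ => by rw [hw ξ hξ]; exact hp ξ hξ, hρ.congr fun ξ hξ => by simp only [hw ξ hξ],
    hv.congr fun ξ hξ => by simp only [hw ξ hξ], hS.congr fun ξ hξ => by simp only [hw ξ hξ], ?_⟩
  intro ξ hξ k
  obtain ⟨d, h1, h2⟩ := hd ξ hξ k
  have he : ∀ᶠ η in nhds ξ, w' η = w η :=
    (Icc_mem_nhds hξ.1 hξ.2 |> Filter.mem_of_superset) fun η hη => hw η hη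
  exact ⟨d, h1.congr_of_eventuallyEq (he.mono fun η hη => by simp only [hη]),
    h2.congr_of_eventuallyEq (he.mono fun η hη => by simp only [hη])⟩

/-! ### Doppler factors -/

theorem doppler_pos {v : ℝ} (hv : -1 < v ∧ v < 1) : 0 < doppler v :=
  div_pos (by linarith [hv.1]) (by linarith [hv.2])

theorem doppler_lt_doppler {v w : ℝ} (hw : w < 1) (h : v < w) : doppler v < doppler w := by
  unfold doppler
  rw [div_lt_div_iff₀ (by linarith) (by linarith)]
  nlinarith

theorem doppler_le_doppler {v w : ℝ} (hw : w < 1) (h : v ≤ w) : doppler v ≤ doppler w := by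
  rcases h.eq_or_lt with rfl | h
  · exact le_rfl
  · exact (doppler_lt_doppler hw h).le

theorem doppler_injOn {v w : ℝ} (hv : v < 1) (hw : w < 1) (h : doppler v = doppler w) : v = w := by
  rcases lt_trichotomy v w with h' | h' | h'
  · exact absurd h (doppler_lt_doppler hw h').ne
  · exact h'
  · exact absurd h (doppler_lt_doppler hv h').ne'

theorem doppler_neg (v : ℝ) : doppler (-v) = (doppler v)⁻¹ := by
  simp [doppler, sub_eq_add_neg]

/-- Rapidities subtract under relativistic composition; this makes the wave relations independent of
the frame. -/
theorem doppler_velocity_sub {a v : ℝ} (ha : -1 < a ∧ a < 1) (hv : -1 < v ∧ v < 1) :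
    doppler ((v - a) / (1 - v * a)) = doppler v / doppler a := by
  have h := one_sub_mul_pos ha hv
  have h1 : 1 - (v - a) / (1 - v * a) = (1 - v) * (1 + a) / (1 - v * a) := by
    field_simp; ring
  have h2 : 1 + (v - a) / (1 - v * a) = (1 + v) * (1 - a) / (1 - v * a) := by
    field_simp; ring
  have := sub_pos.2 ha.2
  have := neg_lt_iff_pos_add.1 ha.1
  have := sub_pos.2 hv.2
  unfold doppler
  rw [h1, h2]
  field_simp

end Basic

/-! ### The differential equations of a centered 1-rarefaction and its invariants. -/

section Rarefaction

variable {γ : ℝ} {A : ℝ → ℝ}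

/-! ### Formulas for the conserved quantities -/

theorem numberDensity_pos (h : IsGasLaw γ A) {W : GasState} (hW : W.IsPhysical) :
    0 < numberDensity γ A W :=
  Real.rpow_pos_of_pos (div_pos hW.1 (h.pos _ hW.2.2)) _

theorem log_numberDensity (h : IsGasLaw γ A) {W : GasState} (hW : W.IsPhysical) :
    γ * Real.log (numberDensity γ A W) = Real.log W.ρ - Real.log (A W.S) := by
  rw [numberDensity, Real.log_rpow (div_pos hW.1 (h.pos _ hW.2.2)),
    Real.log_div hW.1.ne' (h.pos _ hW.2.2).ne', ← mul_assoc, mul_one_div_cancel h.gamma_pos.ne',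
    one_mul]

theorem conserved_zero (W : GasState) :
    conserved γ A W 0 = numberDensity γ A W / √(1 - W.v ^ 2) := rfl

theorem flux_zero (W : GasState) : flux γ A W 0 = conserved γ A W 0 * W.v := by
  simp only [conserved_zero, flux, Matrix.cons_val_zero]
  ring

theorem conserved_zero_pos (h : IsGasLaw γ A) {W : GasState} (hW : W.IsPhysical) :
    0 < conserved γ A W 0 :=
  div_pos (numberDensity_pos h hW) (Real.sqrt_pos.2 (one_sub_sq_pos hW.2.1))

/-- Logarithmic form of `ρ = A(S) n ^ γ` with `n` expressed by the conserved particle density. All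
information on entropy is extracted from this identity. -/
theorem log_conserved_zero (h : IsGasLaw γ A) {W : GasState} (hW : W.IsPhysical) :
    Real.log (A W.S) =
      Real.log W.ρ - γ * Real.log (conserved γ A W 0) - γ / 2 * Real.log (1 - W.v ^ 2) := by
  have h1 := one_sub_sq_pos hW.2.1
  rw [conserved_zero, Real.log_div (numberDensity_pos h hW).ne' (Real.sqrt_pos.2 h1).ne',
    Real.log_sqrt h1.le, mul_sub, log_numberDensity h hW]
  ring

theorem conserved_one (W : GasState) :
    conserved γ A W 1 = W.ρ * (γ * W.v / (1 - W.v ^ 2)) := by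
  simp only [conserved, pressure, Matrix.cons_val_one, Matrix.cons_val_zero]
  ring

theorem flux_two (W : GasState) : flux γ A W 2 = conserved γ A W 1 := rfl

theorem conserved_two (h : IsGasLaw γ A) {W : GasState} (hW : W.IsPhysical) :
    conserved γ A W 2 = W.ρ * ((1 + soundSpeed γ ^ 2 * W.v ^ 2) / (1 - W.v ^ 2)) := by
  have h1 := (one_sub_sq_pos hW.2.1).ne'
  change (W.ρ + (γ - 1) * W.ρ) * (W.v ^ 2 / (1 - W.v ^ 2)) + W.ρ = _
  rw [h.soundSpeed_sq]
  field_simp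
  ring

theorem flux_one (h : IsGasLaw γ A) {W : GasState} (hW : W.IsPhysical) :
    flux γ A W 1 = W.ρ * ((W.v ^ 2 + soundSpeed γ ^ 2) / (1 - W.v ^ 2)) := by
  have h1 := (one_sub_sq_pos hW.2.1).ne'
  change (W.ρ + (γ - 1) * W.ρ) * (W.v ^ 2 / (1 - W.v ^ 2)) + (γ - 1) * W.ρ = _
  rw [h.soundSpeed_sq]
  field_simp
  ring

/-- A state is determined by its energy density, its velocity and its particle number. -/
theorem GasState.ext_of_conserved_zero (h : IsGasLaw γ A) {W W' : GasState} (hW : W.IsPhysical)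
    (hW' : W'.IsPhysical) (hρ : W.ρ = W'.ρ) (hv : W.v = W'.v)
    (hn : conserved γ A W 0 = conserved γ A W' 0) : W = W' := by
  have hA : Real.log (A W.S) = Real.log (A W'.S) := by
    rw [log_conserved_zero h hW, log_conserved_zero h hW', hρ, hv, hn]
  have := Real.log_injOn_pos (h.pos _ hW.2.2) (h.pos _ hW'.2.2) hA
  exact GasState.ext hρ hv (h.mono.injOn hW.2.2 hW'.2.2 this)

/-! ### Centered rarefaction waves of the first family -/

/-- The velocity in a centered 1-rarefaction. -/
def rareVel (γ ξ : ℝ) : ℝ := (ξ + soundSpeed γ) / (1 + ξ * soundSpeed γ)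

/-- The centered 1-rarefaction through the state `U`. -/
def rareProfile (γ : ℝ) (U : GasState) (ξ : ℝ) : GasState :=
  -- The exponent expresses constancy of `log ρ + γ/(2a) log doppler v`.
  ⟨U.ρ * Real.exp (-(γ / (2 * soundSpeed γ)) *
    (Real.log (doppler (rareVel γ ξ)) - Real.log (doppler U.v))), rareVel γ ξ, U.S⟩

theorem rareVel_mem (h : IsGasLaw γ A) {ξ : ℝ} (hξ : -1 < ξ ∧ ξ < 1) :
    -1 < rareVel γ ξ ∧ rareVel γ ξ < 1 :=
  velocity_add_mem h.soundSpeed_mem hξ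

theorem rareVel_charSpeed (h : IsGasLaw γ A) {W : GasState} (hW : W.IsPhysical) :
    rareVel γ (charSpeed γ 0 W) = W.v := by
  have h1 := one_sub_mul_pos h.soundSpeed_mem hW.2.1
  have h2 := one_sub_sq_pos h.soundSpeed_mem
  have h3 : 1 + charSpeed γ 0 W * soundSpeed γ
      = (1 - soundSpeed γ ^ 2) / (1 - W.v * soundSpeed γ) := by
    rw [charSpeed_zero]; field_simp; ring
  have h4 : charSpeed γ 0 W + soundSpeed γ
      = W.v * (1 - soundSpeed γ ^ 2) / (1 - W.v * soundSpeed γ) := by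
    rw [charSpeed_zero]; field_simp; ring
  rw [rareVel, h3, h4]
  field_simp

theorem one_add_mul_pos (h : IsGasLaw γ A) {ξ : ℝ} (hξ : -1 < ξ ∧ ξ < 1) :
    0 < 1 + ξ * soundSpeed γ := by
  have := one_sub_mul_pos (a := -soundSpeed γ) (v := ξ)
    ⟨by linarith [h.soundSpeed_lt_one], by linarith [h.soundSpeed_pos]⟩ hξ
  linarith

theorem charSpeed_of_v_eq_rareVel (h : IsGasLaw γ A) {W : GasState} {ξ : ℝ} (hξ : -1 < ξ ∧ ξ < 1)
    (hv : W.v = rareVel γ ξ) : charSpeed γ 0 W = ξ := by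
  have h1 := one_add_mul_pos h hξ
  have h2 := one_sub_sq_pos h.soundSpeed_mem
  have h3 : 1 - W.v * soundSpeed γ
      = (1 - soundSpeed γ ^ 2) / (1 + ξ * soundSpeed γ) := by
    rw [hv, rareVel]; field_simp; ring
  have h4 : W.v - soundSpeed γ
      = ξ * (1 - soundSpeed γ ^ 2) / (1 + ξ * soundSpeed γ) := by
    rw [hv, rareVel]; field_simp; ring
  rw [charSpeed_zero, h3, h4]
  field_simp

theorem hasDerivAt_rareVel (h : IsGasLaw γ A) {ξ : ℝ} (hξ : -1 < ξ ∧ ξ < 1) :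
    HasDerivAt (rareVel γ) ((1 - rareVel γ ξ * soundSpeed γ) ^ 2 / (1 - soundSpeed γ ^ 2)) ξ := by
  have h1 := one_add_mul_pos h hξ
  have h2 := one_sub_sq_pos h.soundSpeed_mem
  refine (((hasDerivAt_id ξ).add_const (soundSpeed γ)).div
    (((hasDerivAt_id ξ).mul_const (soundSpeed γ)).const_add 1) h1.ne').congr_deriv ?_
  have h3 : 1 - rareVel γ ξ * soundSpeed γ
      = (1 - soundSpeed γ ^ 2) / (1 + ξ * soundSpeed γ) := by
    rw [rareVel]; field_simp; ring
  rw [h3]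
  simp only [id]
  field_simp
  ring

theorem hasDerivAt_log_doppler {v : ℝ} (hv : -1 < v ∧ v < 1) :
    HasDerivAt (fun v => Real.log (doppler v)) (2 / (1 - v ^ 2)) v := by
  have h1 : 0 < 1 - v := by linarith [hv.2]
  have h2 : 0 < 1 + v := by linarith [hv.1]
  have h3 := one_sub_sq_pos hv
  have h4 := (((hasDerivAt_id v).const_add 1).div ((hasDerivAt_id v).const_sub 1) h1.ne').log
    (div_pos h2 h1).ne'
  refine h4.congr_deriv ?_
  simp only [id, Pi.div_apply]
  rw [show 1 - v ^ 2 = (1 - v) * (1 + v) by ring]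
  field_simp
  ring

theorem eq_left_of_hasDerivAt_zero {f : ℝ → ℝ} {α β : ℝ} (hf : ContinuousOn f (Icc α β))
    (hd : ∀ ξ ∈ Ioo α β, HasDerivAt f 0 ξ) {ξ : ℝ} (hξ : ξ ∈ Icc α β) : f ξ = f α := by
  rcases hξ.1.eq_or_lt with rfl | hlt
  · rfl
  obtain ⟨c, -, hc⟩ := exists_hasDerivAt_eq_slope f (fun _ => 0) hlt
    (hf.mono (Icc_subset_Icc_right hξ.2)) fun x hx => hd x ⟨hx.1, hx.2.trans_le hξ.2⟩
  rw [eq_div_iff (sub_pos.2 hlt).ne', zero_mul] at hc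
  linarith

theorem sub_charSpeed_zero (h : IsGasLaw γ A) {W : GasState} (hW : W.IsPhysical) :
    W.v - charSpeed γ 0 W = soundSpeed γ * (1 - W.v ^ 2) / (1 - W.v * soundSpeed γ) := by
  have h1 := one_sub_mul_pos h.soundSpeed_mem hW.2.1
  rw [charSpeed_zero]
  field_simp
  ring

theorem hasDerivAt_energy_factor (a : ℝ) {v : ℝ} (hv : -1 < v ∧ v < 1) :
    HasDerivAt (fun v : ℝ => (1 + a ^ 2 * v ^ 2) / (1 - v ^ 2))
      (2 * (1 + a ^ 2) * v / (1 - v ^ 2) ^ 2) v := by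
  have h1 := one_sub_sq_pos hv
  refine ((((hasDerivAt_pow 2 v).const_mul (a ^ 2)).const_add 1).div
    ((hasDerivAt_pow 2 v).const_sub 1) h1.ne').congr_deriv ?_
  field_simp
  push_cast
  ring

theorem hasDerivAt_momentum_factor (γ : ℝ) {v : ℝ} (hv : -1 < v ∧ v < 1) :
    HasDerivAt (fun v : ℝ => γ * v / (1 - v ^ 2))
      (γ * (1 + v ^ 2) / (1 - v ^ 2) ^ 2) v := by
  have h1 := one_sub_sq_pos hv
  refine (((hasDerivAt_id v).const_mul γ).div
    ((hasDerivAt_pow 2 v).const_sub 1) h1.ne').congr_deriv ?_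
  simp only [id]
  field_simp
  push_cast
  ring

theorem hasDerivAt_pressure_factor (a : ℝ) {v : ℝ} (hv : -1 < v ∧ v < 1) :
    HasDerivAt (fun v : ℝ => (v ^ 2 + a ^ 2) / (1 - v ^ 2))
      (2 * (1 + a ^ 2) * v / (1 - v ^ 2) ^ 2) v := by
  have h1 := one_sub_sq_pos hv
  refine (((hasDerivAt_pow 2 v).add_const (a ^ 2)).div
    ((hasDerivAt_pow 2 v).const_sub 1) h1.ne').congr_deriv ?_
  field_simp
  push_cast
  ring

/-- The hypothesis is the energy equation `F' = ξ U'` with `r` and `V` the derivatives of density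
and velocity. It is linear in `r`; for `ξ = λ₁` the numerator of the coefficient of `r` factors as
`a (1 - v²)(1 + v a)`, whose factor `1 + v a` also divides the rest. -/
theorem density_derivative_aux {a v r R V : ℝ} (ha : 0 < a) (hv : 0 < 1 - v ^ 2)
    (hva : 0 < 1 - v * a) (hva' : 0 < 1 + v * a)
    (h : (v - a) / (1 - v * a) * (r * ((1 + a ^ 2 * v ^ 2) / (1 - v ^ 2)) +
        R * (2 * (1 + a ^ 2) * v / (1 - v ^ 2) ^ 2 * V)) =
      r * ((1 + a ^ 2) * v / (1 - v ^ 2)) +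
        R * ((1 + a ^ 2) * (1 + v ^ 2) / (1 - v ^ 2) ^ 2 * V)) :
    r = -((1 + a ^ 2) / a) * R * V / (1 - v ^ 2) := by
  have key : (r * a * (1 - v ^ 2)) * ((1 - v ^ 2) * (1 + v * a))
      = (-(1 + a ^ 2) * R * V) * ((1 - v ^ 2) * (1 + v * a)) := by
    field_simp at h
    linear_combination -h
  have := mul_right_cancel₀ (mul_pos hv hva').ne' key
  field_simp
  linear_combination this

/-- Particle conservation `ξ N' = (N v)'` reads `N' (v - ξ) = -N V`, and `v - ξ` is known. -/
theorem particle_derivative_aux {a v d N V ξ : ℝ} (ha : 0 < a) (hv : 0 < 1 - v ^ 2)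
    (hva : 0 < 1 - v * a) (hN : 0 < N) (hs : v - ξ = a * (1 - v ^ 2) / (1 - v * a))
    (h : ξ * d = d * v + N * V) : d / N = -V * (1 - v * a) / (a * (1 - v ^ 2)) := by
  have : d * (v - ξ) = -(N * V) := by linear_combination -h
  rw [hs, ← mul_div_assoc, div_eq_iff hva.ne'] at this
  field_simp
  linear_combination this

/-- The derivatives of density and particle number along a centered 1-rarefaction. -/
theorem IsRarefactionWave.hasDerivAt (h : IsGasLaw γ A) {w : ℝ → GasState} {U M : GasState}
    {α β : ℝ} (hw : IsRarefactionWave γ A 0 w U M α β) {ξ : ℝ} (hξ : ξ ∈ Ioo α β) :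
    HasDerivAt (fun η => Real.log (w η).ρ + γ / (2 * soundSpeed γ) *
      Real.log (doppler (rareVel γ η))) 0 ξ ∧
    HasDerivAt (fun η => Real.log (A (w η).S)) 0 ξ := by
  obtain ⟨-, -, -, hp, -, -, -, hd⟩ := hw
  have hmem : Icc α β ∈ nhds ξ := Icc_mem_nhds hξ.1 hξ.2
  have hvel : ∀ η ∈ Icc α β, (w η).v = rareVel γ η := fun η hη => by
    obtain ⟨h1, h2⟩ := hp η hη
    rw [← rareVel_charSpeed h h1, h2]
  obtain ⟨hph, hch⟩ := hp ξ ⟨hξ.1.le, hξ.2.le⟩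
  have hξ1 : -1 < ξ ∧ ξ < 1 := hch ▸ charSpeed_zero_mem h hph
  have hv1 := rareVel_mem h hξ1
  have hvξ := hvel ξ ⟨hξ.1.le, hξ.2.le⟩
  have hs := sub_charSpeed_zero h hph
  have hg := h.gamma_eq
  have hV := hasDerivAt_rareVel h hξ1
  rw [hch, hvξ] at hs
  set a := soundSpeed γ with ha
  set v := rareVel γ ξ with hv
  have ha0 : 0 < a := h.soundSpeed_pos
  have ha1 := one_sub_sq_pos h.soundSpeed_mem
  have hva : 0 < 1 - v * a := one_sub_mul_pos h.soundSpeed_mem hv1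
  have hva' : 0 < 1 + v * a := one_add_mul_pos h hv1
  have hv2 := one_sub_sq_pos hv1
  set V' := (1 - v * a) ^ 2 / (1 - a ^ 2) with hV'
  obtain ⟨d₂, hc2, hf2⟩ := hd ξ hξ 2
  obtain ⟨d₀, hc0, hf0⟩ := hd ξ hξ 0
  have hρ : (w ξ).ρ ≠ 0 := hph.1.ne'
  have hE : HasDerivAt (fun η => (1 + a ^ 2 * rareVel γ η ^ 2) / (1 - rareVel γ η ^ 2))
      (2 * (1 + a ^ 2) * v / (1 - v ^ 2) ^ 2 * V') ξ :=
    HasDerivAt.comp ξ (hasDerivAt_energy_factor a hv1) hV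
  have hM : HasDerivAt (fun η => γ * rareVel γ η / (1 - rareVel γ η ^ 2))
      (γ * (1 + v ^ 2) / (1 - v ^ 2) ^ 2 * V') ξ :=
    HasDerivAt.comp ξ (hasDerivAt_momentum_factor γ hv1) hV
  have hE0 : (1 + a ^ 2 * v ^ 2) / (1 - v ^ 2) ≠ 0 := by positivity
  -- Differentiability of `ρ` is not assumed: `ρ` is the conserved energy divided by a positive
  -- smooth function of the velocity, and the velocity is the explicit function `rareVel` of `ξ`.
  obtain ⟨ρ', hρ'⟩ : ∃ ρ', HasDerivAt (fun η => (w η).ρ) ρ' ξ := by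
    refine ⟨_, (hc2.div hE hE0).congr_of_eventuallyEq ?_⟩
    filter_upwards [hmem] with η hη
    obtain ⟨h1, h2⟩ := hp η hη
    have h3 : 0 < 1 - (w η).v ^ 2 := one_sub_sq_pos h1.2.1
    simp only [Pi.div_apply]
    rw [conserved_two h h1, ← hvel η hη, mul_div_cancel_right₀]
    positivity
  have e1 : d₂ = ρ' * ((1 + a ^ 2 * v ^ 2) / (1 - v ^ 2)) +
      (w ξ).ρ * (2 * (1 + a ^ 2) * v / (1 - v ^ 2) ^ 2 * V') := by
    refine hc2.unique ((hρ'.mul hE).congr_of_eventuallyEq ?_)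
    filter_upwards [hmem] with η hη
    simp only [Pi.mul_apply]
    rw [conserved_two h (hp η hη).1, hvel η hη]
  have e2 : ξ * d₂ = ρ' * (γ * v / (1 - v ^ 2)) +
      (w ξ).ρ * (γ * (1 + v ^ 2) / (1 - v ^ 2) ^ 2 * V') := by
    refine hf2.unique ((hρ'.mul hM).congr_of_eventuallyEq ?_)
    filter_upwards [hmem] with η hη
    simp only [Pi.mul_apply]
    rw [flux_two, conserved_one, hvel η hη]
  have hξv : ξ = (v - a) / (1 - v * a) := by
    rw [← hch, charSpeed_zero, hvξ]
  have e3 : ρ' = -(γ / a) * (w ξ).ρ * V' / (1 - v ^ 2) := by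
    rw [e1, hg] at e2
    rw [hg]
    exact density_derivative_aux ha0 hv2 hva hva' (by rw [← hξv]; exact e2)
  have e4 : ξ * d₀ = d₀ * v + conserved γ A (w ξ) 0 * V' := by
    refine hf0.unique ((hc0.mul hV).congr_of_eventuallyEq ?_)
    filter_upwards [hmem] with η hη
    simp only [Pi.mul_apply]
    rw [flux_zero, hvel η hη]
  have hN := conserved_zero_pos h hph
  have hN' : d₀ / conserved γ A (w ξ) 0 = -V' * (1 - v * a) / (a * (1 - v ^ 2)) :=
    particle_derivative_aux ha0 hv2 hva hN hs e4
  constructor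
  · refine ((hρ'.log hρ).add (((hasDerivAt_log_doppler hv1).comp ξ hV).const_mul _)).congr_deriv ?_
    rw [e3]
    field_simp
    ring
  -- The entropy is treated through `log A(S)`, which needs no derivative of `A` or `S`:
  -- `log_conserved_zero` writes it in quantities already differentiated.
  · have hL := ((hρ'.log hρ).sub ((hc0.log hN.ne').const_mul γ)).sub
      ((((hV.pow 2).const_sub 1).log hv2.ne').const_mul (γ / 2))
    refine (hL.congr_of_eventuallyEq ?_).congr_deriv ?_
    · filter_upwards [hmem] with η hη
      rw [log_conserved_zero h (hp η hη).1, hvel η hη]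
      rfl
    · rw [hN', e3, Pi.pow_apply, ← hv]
      field_simp
      push_cast
      ring

end Rarefaction

/-! ### The explicit 1-rarefaction curve: uniqueness, existence, concatenation. -/

section RarefactionProfile

variable {γ : ℝ} {A : ℝ → ℝ}

theorem IsRarefactionWave.left_eq {i : Fin 3} {w : ℝ → GasState} {U M : GasState} {α β : ℝ}
    (hw : IsRarefactionWave γ A i w U M α β) : U.IsPhysical ∧ charSpeed γ i U = α := by
  have := hw.2.2.2.1 α (left_mem_Icc.2 hw.1)
  rwa [hw.2.1] at this

theorem IsRarefactionWave.right_eq {i : Fin 3} {w : ℝ → GasState} {U M : GasState} {α β : ℝ}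
    (hw : IsRarefactionWave γ A i w U M α β) : M.IsPhysical ∧ charSpeed γ i M = β := by
  have := hw.2.2.2.1 β (right_mem_Icc.2 hw.1)
  rwa [hw.2.2.1] at this

/-- A centered 1-rarefaction is determined by its left state. -/
theorem IsRarefactionWave.eq_rareProfile (h : IsGasLaw γ A) {w : ℝ → GasState} {U M : GasState}
    {α β : ℝ} (hw : IsRarefactionWave γ A 0 w U M α β) {ξ : ℝ} (hξ : ξ ∈ Icc α β) :
    w ξ = rareProfile γ U ξ := by
  have hder := fun ξ (hξ : ξ ∈ Ioo α β) => IsRarefactionWave.hasDerivAt h hw hξ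
  have hU := hw.left_eq
  obtain ⟨hle, hα, hβ, hp, hρ, hv, hS, -⟩ := hw
  have hvel : ∀ η ∈ Icc α β, (w η).v = rareVel γ η := fun η hη => by
    obtain ⟨h1, h2⟩ := hp η hη
    rw [← rareVel_charSpeed h h1, h2]
  have hUv : U.v = rareVel γ α := by rw [← hvel α (left_mem_Icc.2 hle), hα]
  -- The conservation laws hold only inside the sector; continuity carries both invariants to its
  -- edges.
  have c1 : ContinuousOn (fun η => Real.log (w η).ρ + γ / (2 * soundSpeed γ) *
      Real.log (doppler (rareVel γ η))) (Icc α β) := by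
    refine (hρ.log fun η hη => (hp η hη).1.1.ne').add (continuousOn_const.mul fun η hη => ?_)
    have hη1 : -1 < η ∧ η < 1 := (hp η hη).2 ▸ charSpeed_zero_mem h (hp η hη).1
    exact ((hasDerivAt_log_doppler (rareVel_mem h hη1)).comp η
      (hasDerivAt_rareVel h hη1)).continuousAt.continuousWithinAt
  have c2 : ContinuousOn (fun η => Real.log (A (w η).S)) (Icc α β) :=
    (h.cont.comp hS fun η hη => (hp η hη).1.2.2).log fun η hη =>
      (h.pos _ (hp η hη).1.2.2).ne'
  have e1 := eq_left_of_hasDerivAt_zero c1 (fun η hη => (hder η hη).1) hξ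
  have e2 := eq_left_of_hasDerivAt_zero c2 (fun η hη => (hder η hη).2) hξ
  have hph := (hp ξ hξ).1
  simp only [hα] at e1 e2
  have e3 := Real.log_injOn_pos (h.pos _ hph.2.2) (h.pos _ hU.1.2.2) e2
  refine GasState.ext ?_ (hvel ξ hξ) (h.mono.injOn hph.2.2 hU.1.2.2 e3)
  rw [rareProfile, ← Real.exp_log hph.1, eq_sub_of_add_eq e1, hUv]
  conv_rhs => rw [← Real.exp_log hU.1.1, ← Real.exp_add]
  congr 1
  ring

theorem rareProfile_isPhysical (h : IsGasLaw γ A) {U : GasState} (hU : U.IsPhysical) {ξ : ℝ}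
    (hξ : -1 < ξ ∧ ξ < 1) : (rareProfile γ U ξ).IsPhysical :=
  ⟨mul_pos hU.1 (Real.exp_pos _), rareVel_mem h hξ, hU.2.2⟩

theorem charSpeed_rareProfile (h : IsGasLaw γ A) (U : GasState) {ξ : ℝ}
    (hξ : -1 < ξ ∧ ξ < 1) : charSpeed γ 0 (rareProfile γ U ξ) = ξ :=
  charSpeed_of_v_eq_rareVel h hξ rfl

theorem rareProfile_charSpeed (h : IsGasLaw γ A) {U : GasState} (hU : U.IsPhysical) :
    rareProfile γ U (charSpeed γ 0 U) = U := by
  simp [rareProfile, rareVel_charSpeed h hU]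

/-- Any state of the curve generates the same curve; this is what lets adjacent rarefactions be
joined. -/
theorem rareProfile_rareProfile (U : GasState) (ξ η : ℝ) :
    rareProfile γ (rareProfile γ U ξ) η = rareProfile γ U η := by
  simp only [rareProfile, mul_assoc, ← Real.exp_add, GasState.mk.injEq, and_true]
  congr 2
  ring

theorem hasDerivAt_rareProfile_ρ (h : IsGasLaw γ A) (U : GasState) {ξ : ℝ}
    (hξ : -1 < ξ ∧ ξ < 1) :
    HasDerivAt (fun ξ => (rareProfile γ U ξ).ρ) ((rareProfile γ U ξ).ρ * (-(γ / soundSpeed γ) *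
      ((1 - rareVel γ ξ * soundSpeed γ) ^ 2 / (1 - soundSpeed γ ^ 2)) /
        (1 - rareVel γ ξ ^ 2))) ξ := by
  have hv := one_sub_sq_pos (rareVel_mem h hξ)
  have ha := one_sub_sq_pos h.soundSpeed_mem
  have ha0 := h.soundSpeed_pos
  have hL := (((((hasDerivAt_log_doppler (rareVel_mem h hξ)).comp ξ
    (hasDerivAt_rareVel h hξ)).sub_const (Real.log (doppler U.v))).const_mul
      (-(γ / (2 * soundSpeed γ)))).exp).const_mul U.ρ
  refine hL.congr_deriv ?_
  simp only [rareProfile, Function.comp]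
  field_simp

theorem hasDerivAt_conserved_zero_rareProfile (h : IsGasLaw γ A) {U : GasState}
    (hU : U.IsPhysical) {ξ : ℝ} (hξ : -1 < ξ ∧ ξ < 1) :
    HasDerivAt (fun ξ => conserved γ A (rareProfile γ U ξ) 0)
      (conserved γ A (rareProfile γ U ξ) 0 * (-(1 - rareVel γ ξ * soundSpeed γ) *
        ((1 - rareVel γ ξ * soundSpeed γ) ^ 2 / (1 - soundSpeed γ ^ 2)) /
          (soundSpeed γ * (1 - rareVel γ ξ ^ 2)))) ξ := by
  have hv := one_sub_sq_pos (rareVel_mem h hξ)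
  have ha := one_sub_sq_pos h.soundSpeed_mem
  have ha0 := h.soundSpeed_pos
  have hγ := h.gamma_pos
  have hP := rareProfile_isPhysical h hU hξ
  -- With `S` fixed, `log_conserved_zero` is solved for the particle density, which can then be
  -- differentiated through `ρ` and `v`.
  have hev : ∀ η, -1 < η ∧ η < 1 → conserved γ A (rareProfile γ U η) 0 =
      Real.exp (1 / γ * (Real.log (rareProfile γ U η).ρ - Real.log (A U.S)
        - γ / 2 * Real.log (1 - rareVel γ η ^ 2))) := by
    intro η hη
    have hP := rareProfile_isPhysical h hU hη
    have h1 : Real.log (A U.S) = Real.log (rareProfile γ U η).ρ -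
        γ * Real.log (conserved γ A (rareProfile γ U η) 0) -
        γ / 2 * Real.log (1 - rareVel γ η ^ 2) := log_conserved_zero h hP
    conv_lhs => rw [← Real.exp_log (conserved_zero_pos h hP)]
    rw [h1]
    congr 1
    field_simp
    ring
  have hL := (((((hasDerivAt_rareProfile_ρ h U hξ).log hP.1.ne').sub_const
    (Real.log (A U.S))).sub ((((hasDerivAt_rareVel h hξ).pow 2).const_sub 1).log
      (by simpa using hv.ne') |>.const_mul (γ / 2))).const_mul (1 / γ)).exp
  refine (hL.congr_of_eventuallyEq ?_).congr_deriv ?_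
  · filter_upwards [Ioo_mem_nhds hξ.1 hξ.2] with η hη
    exact hev η hη
  · rw [hev ξ hξ]
    have hne := hP.1.ne'
    simp only [Pi.sub_apply, Pi.pow_apply]
    congr 1
    generalize (1 - rareVel γ ξ * soundSpeed γ) ^ 2 / (1 - soundSpeed γ ^ 2) = V
    field_simp
    push_cast
    ring

/-- The profile of a 1-rarefaction solves the conservation laws. -/
theorem rareProfile_solves (h : IsGasLaw γ A) {U : GasState} (hU : U.IsPhysical) {ξ : ℝ}
    (hξ : -1 < ξ ∧ ξ < 1) (k : Fin 3) : ∃ d : ℝ,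
      HasDerivAt (fun η => conserved γ A (rareProfile γ U η) k) d ξ ∧
      HasDerivAt (fun η => flux γ A (rareProfile γ U η) k) (ξ * d) ξ := by
  have hv := one_sub_sq_pos (rareVel_mem h hξ)
  have ha := one_sub_sq_pos h.soundSpeed_mem
  have ha0 := h.soundSpeed_pos
  have hva := one_sub_mul_pos h.soundSpeed_mem (rareVel_mem h hξ)
  have hnhds : Ioo (-1 : ℝ) 1 ∈ nhds ξ := Ioo_mem_nhds hξ.1 hξ.2
  have hV := hasDerivAt_rareVel h hξ
  have hR := hasDerivAt_rareProfile_ρ h U hξ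
  have hg := h.gamma_eq
  -- Eliminating `ξ` turns each conservation law into a rational identity in `v` and `a`.
  have hξv : ξ = (rareVel γ ξ - soundSpeed γ) / (1 - rareVel γ ξ * soundSpeed γ) :=
    (charSpeed_rareProfile h U hξ).symm
  have hE := hR.mul ((hasDerivAt_energy_factor (soundSpeed γ) (rareVel_mem h hξ)).comp ξ hV)
  have hM := hR.mul ((hasDerivAt_momentum_factor γ (rareVel_mem h hξ)).comp ξ hV)
  have hPr := hR.mul ((hasDerivAt_pressure_factor (soundSpeed γ) (rareVel_mem h hξ)).comp ξ hV)
  have hN := hasDerivAt_conserved_zero_rareProfile h hU hξ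
  match k with
  | 0 =>
    refine ⟨_, hN, ?_⟩
    refine ((hN.mul hV).congr_of_eventuallyEq (.of_forall fun η => flux_zero _)).congr_deriv ?_
    generalize conserved γ A (rareProfile γ U ξ) 0 = N
    generalize (1 - rareVel γ ξ * soundSpeed γ) ^ 2 / (1 - soundSpeed γ ^ 2) = V
    generalize rareVel γ ξ = v at *
    generalize soundSpeed γ = a at *
    rw [hξv]
    field_simp
    ring
  | 1 =>
    refine ⟨_, hM.congr_of_eventuallyEq ?_, (hPr.congr_of_eventuallyEq ?_).congr_deriv ?_⟩
    · exact .of_forall fun η => conserved_one (A := A) _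
    · filter_upwards [hnhds] with η hη
      exact flux_one h (rareProfile_isPhysical h hU hη)
    · simp only [Function.comp]
      generalize (rareProfile γ U ξ).ρ = R
      generalize (1 - rareVel γ ξ * soundSpeed γ) ^ 2 / (1 - soundSpeed γ ^ 2) = V
      clear hE hM hPr hN hR hV
      generalize rareVel γ ξ = v at *
      generalize soundSpeed γ = a at *
      rw [hξv, hg, div_mul_eq_mul_div (v - a) (1 - v * a), eq_div_iff hva.ne']
      field_simp
      ring
  | 2 =>
    refine ⟨_, hE.congr_of_eventuallyEq ?_, (hM.congr_of_eventuallyEq ?_).congr_deriv ?_⟩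
    · filter_upwards [hnhds] with η hη
      exact conserved_two h (rareProfile_isPhysical h hU hη)
    · exact .of_forall fun η => conserved_one (A := A) _
    · simp only [Function.comp]
      generalize (rareProfile γ U ξ).ρ = R
      generalize (1 - rareVel γ ξ * soundSpeed γ) ^ 2 / (1 - soundSpeed γ ^ 2) = V
      clear hE hM hPr hN hR hV
      generalize rareVel γ ξ = v at *
      generalize soundSpeed γ = a at *
      rw [hξv, hg, div_mul_eq_mul_div (v - a) (1 - v * a), eq_div_iff hva.ne']
      field_simp
      ring

theorem isRarefactionWave_rareProfile (h : IsGasLaw γ A) {U : GasState} (hU : U.IsPhysical)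
    {β : ℝ} (hβ : charSpeed γ 0 U ≤ β) (hβ1 : β < 1) :
    IsRarefactionWave γ A 0 (rareProfile γ U) U (rareProfile γ U β) (charSpeed γ 0 U) β := by
  have hmem : ∀ ξ ∈ Icc (charSpeed γ 0 U) β, -1 < ξ ∧ ξ < 1 := fun ξ hξ =>
    ⟨(charSpeed_zero_mem h hU).1.trans_le hξ.1, hξ.2.trans_lt hβ1⟩
  refine ⟨hβ, rareProfile_charSpeed h hU, rfl, fun ξ hξ => ⟨rareProfile_isPhysical h hU (hmem ξ hξ),
    charSpeed_rareProfile h U (hmem ξ hξ)⟩, fun ξ hξ => ?_, fun ξ hξ => ?_, continuousOn_const,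
    fun ξ hξ k => rareProfile_solves h hU (hmem ξ ⟨hξ.1.le, hξ.2.le⟩) k⟩
  · exact (hasDerivAt_rareProfile_ρ h U (hmem ξ hξ)).continuousAt.continuousWithinAt
  · exact (hasDerivAt_rareVel h (hmem ξ hξ)).continuousAt.continuousWithinAt

/-- Two adjacent centered 1-rarefactions form one. -/
theorem IsRarefactionWave.trans (h : IsGasLaw γ A) {w : ℝ → GasState} {U V M : GasState}
    {α β α' β' : ℝ} (h₁ : IsRarefactionWave γ A 0 w U V α β)
    (h₂ : IsRarefactionWave γ A 0 w V M α' β') : IsRarefactionWave γ A 0 w U M α β' := by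
  -- Both edges equal `λ₁(V)`, so no constant sector separates the two waves.
  obtain rfl : β = α' := by rw [← h₁.right_eq.2, ← h₂.left_eq.2]
  have hU := h₁.left_eq
  have hV : V = rareProfile γ U β := by
    rw [← IsRarefactionWave.eq_rareProfile h h₁ (right_mem_Icc.2 h₁.1), h₁.2.2.1]
  have hM : M = rareProfile γ U β' := by
    rw [← rareProfile_rareProfile U β, ← hV,
      ← IsRarefactionWave.eq_rareProfile h h₂ (right_mem_Icc.2 h₂.1), h₂.2.2.1]
  have hβ' : β' < 1 := by
    rw [← h₂.right_eq.2]
    exact (charSpeed_zero_mem h h₂.right_eq.1).2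
  -- Differentiability at the junction is in neither hypothesis; it comes from the smooth curve
  -- through `U`, which both pieces follow.
  have := isRarefactionWave_rareProfile h hU.1 (β := β')
    (by rw [hU.2]; exact h₁.1.trans h₂.1) hβ'
  rw [← hM, hU.2] at this
  refine this.congr fun ξ hξ => ?_
  rcases le_total ξ β with hle | hle
  · exact IsRarefactionWave.eq_rareProfile h h₁ ⟨hξ.1, hle⟩
  · rw [IsRarefactionWave.eq_rareProfile h h₂ ⟨hle, hξ.2⟩, hV, rareProfile_rareProfile]

end RarefactionProfile

/-! ### 1-shocks in their rest frame, growth of entropy, existence for every compression ratio. -/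

section Shock

variable {γ : ℝ} {A : ℝ → ℝ}

/-! ### Shock waves of the first family -/

/-- The velocity of the gas relative to the velocity `s`. -/
def relVel (s v : ℝ) : ℝ := (v - s) / (1 - v * s)

theorem one_sub_relVel_sq {s v : ℝ} (hs : -1 < s ∧ s < 1) (hv : -1 < v ∧ v < 1) :
    1 - relVel s v ^ 2 = (1 - s ^ 2) * (1 - v ^ 2) / (1 - v * s) ^ 2 := by
  have := one_sub_mul_pos hs hv
  rw [relVel]
  field_simp
  ring

/-- The left side is `T¹¹ - 2 s T⁰¹ + s² T⁰⁰`, the Lorentz transform of the momentum flux to the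
frame of velocity `s`, up to the factor `1 - s²`. `boost_momentum` is the same for the energy flux.
-/
theorem boost_pressure (h : IsGasLaw γ A) {W : GasState} (hW : W.IsPhysical) {s : ℝ}
    (hs : -1 < s ∧ s < 1) :
    flux γ A W 1 - s * conserved γ A W 1 - s * (flux γ A W 2 - s * conserved γ A W 2) =
      (1 - s ^ 2) * (W.ρ / (1 - relVel s W.v ^ 2) * (relVel s W.v ^ 2 + soundSpeed γ ^ 2)) := by
  have h1 := one_sub_mul_pos hs hW.2.1
  have h2 := one_sub_sq_pos hs
  have h3 := one_sub_sq_pos hW.2.1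
  rw [one_sub_relVel_sq hs hW.2.1, flux_one h hW, conserved_two h hW, flux_two, conserved_one,
    relVel]
  have hg := h.gamma_eq
  generalize soundSpeed γ = a at hg ⊢
  subst hg
  field_simp
  ring

theorem boost_momentum (h : IsGasLaw γ A) {W : GasState} (hW : W.IsPhysical) {s : ℝ}
    (hs : -1 < s ∧ s < 1) :
    flux γ A W 2 - s * conserved γ A W 2 - s * (flux γ A W 1 - s * conserved γ A W 1) =
      (1 - s ^ 2) * (γ * (W.ρ / (1 - relVel s W.v ^ 2) * relVel s W.v)) := by
  have h1 := one_sub_mul_pos hs hW.2.1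
  have h2 := one_sub_sq_pos hs
  have h3 := one_sub_sq_pos hW.2.1
  rw [one_sub_relVel_sq hs hW.2.1, flux_one h hW, conserved_two h hW, flux_two, conserved_one,
    relVel]
  have hg := h.gamma_eq
  generalize soundSpeed γ = a at hg ⊢
  subst hg
  field_simp
  ring

/-- The Rankine–Hugoniot conditions in the rest frame of the shock. -/
theorem rankineHugoniot_iff (h : IsGasLaw γ A) {U M : GasState} (hU : U.IsPhysical)
    (hM : M.IsPhysical) {s : ℝ} (hs : -1 < s ∧ s < 1) :
    RankineHugoniot γ A U M s ↔
      conserved γ A M 0 * (M.v - s) = conserved γ A U 0 * (U.v - s) ∧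
      M.ρ / (1 - relVel s M.v ^ 2) * (relVel s M.v ^ 2 + soundSpeed γ ^ 2) =
        U.ρ / (1 - relVel s U.v ^ 2) * (relVel s U.v ^ 2 + soundSpeed γ ^ 2) ∧
      M.ρ / (1 - relVel s M.v ^ 2) * relVel s M.v =
        U.ρ / (1 - relVel s U.v ^ 2) * relVel s U.v := by
  have h2 := (one_sub_sq_pos hs).ne'
  have hγ := h.gamma_pos.ne'
  have p1 := boost_pressure h hU hs
  have p2 := boost_pressure h hM hs
  have m1 := boost_momentum h hU hs
  have m2 := boost_momentum h hM hs
  constructor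
  · intro hR
    refine ⟨?_, mul_left_cancel₀ h2 ?_, mul_left_cancel₀ hγ (mul_left_cancel₀ h2 ?_)⟩
    · have := hR 0
      rw [flux_zero, flux_zero] at this
      linear_combination -this
    · linear_combination p1 - p2 - hR 1 + s * hR 2
    · linear_combination m1 - m2 - hR 2 + s * hR 1
  · rintro ⟨hn, hp, hm⟩ k
    rw [hp] at p2
    rw [hm] at m2
    match k with
    | 0 =>
      rw [flux_zero, flux_zero]
      linear_combination -hn
    | 1 =>
      -- The boost is inverted: one transformed equation plus `s` times the other is `1 - s²` times
      -- an original one.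
      apply mul_left_cancel₀ h2
      linear_combination p1 - p2 + s * (m1 - m2)
    | 2 =>
      apply mul_left_cancel₀ h2
      linear_combination m1 - m2 + s * (p1 - p2)

/-- The velocity of the gas ahead of a 1-shock with density ratio `z`, relative to the shock. -/
def shockVel (γ z : ℝ) : ℝ :=
  √((soundSpeed γ ^ 4 + soundSpeed γ ^ 2 * z) / (1 + soundSpeed γ ^ 2 * z))

theorem shockVel_sq (h : IsGasLaw γ A) {z : ℝ} (hz : 0 < z) :
    shockVel γ z ^ 2 =
      (soundSpeed γ ^ 4 + soundSpeed γ ^ 2 * z) / (1 + soundSpeed γ ^ 2 * z) := by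
  have := h.soundSpeed_pos
  exact Real.sq_sqrt (by positivity)

theorem shockVel_pos (h : IsGasLaw γ A) {z : ℝ} (hz : 0 < z) : 0 < shockVel γ z := by
  have := h.soundSpeed_pos
  exact Real.sqrt_pos.2 (by positivity)

theorem shockVel_one (h : IsGasLaw γ A) : shockVel γ 1 = soundSpeed γ := by
  have h1 := h.soundSpeed_pos
  have : (soundSpeed γ ^ 4 + soundSpeed γ ^ 2 * 1) / (1 + soundSpeed γ ^ 2 * 1)
      = soundSpeed γ ^ 2 := by
    field_simp
    ring
  rw [shockVel, this, Real.sqrt_sq h1.le]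

theorem soundSpeed_pow_four_lt_one (h : IsGasLaw γ A) : soundSpeed γ ^ 4 < 1 :=
  pow_lt_one₀ h.soundSpeed_pos.le h.soundSpeed_lt_one (by norm_num)

theorem shockVel_lt_shockVel (h : IsGasLaw γ A) {z z' : ℝ} (hz : 0 < z) (hzz' : z < z') :
    shockVel γ z < shockVel γ z' := by
  have h1 := h.soundSpeed_pos
  have h2 := soundSpeed_pow_four_lt_one h
  have hz' := hz.trans hzz'
  refine Real.sqrt_lt_sqrt (by positivity) ?_
  rw [div_lt_div_iff₀ (by positivity) (by positivity)]
  have : 0 < soundSpeed γ ^ 2 * (1 - soundSpeed γ ^ 4) * (z' - z) :=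
    mul_pos (mul_pos (by positivity) (by linarith)) (by linarith)
  linear_combination this

theorem shockVel_lt_one (h : IsGasLaw γ A) {z : ℝ} (hz : 0 < z) : shockVel γ z < 1 := by
  have h1 := h.soundSpeed_pos
  have h2 := soundSpeed_pow_four_lt_one h
  rw [← sq_lt_one_iff₀ (shockVel_pos h hz).le, shockVel_sq h hz, div_lt_one (by positivity)]
  linarith

theorem soundSpeed_lt_shockVel (h : IsGasLaw γ A) {z : ℝ} (hz : 1 < z) :
    soundSpeed γ < shockVel γ z := by
  rw [← shockVel_one h]
  exact shockVel_lt_shockVel h one_pos hz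

/-- The relation between density ratio and velocity ahead that the jump conditions impose. It is
linear in `u²`, whence the formula for `shockVel` and the converse `eq_shockVel`. -/
theorem shockVel_spec (h : IsGasLaw γ A) {z : ℝ} (hz : 0 < z) :
    z * (soundSpeed γ ^ 2 * (1 - shockVel γ z ^ 2)) = shockVel γ z ^ 2 - soundSpeed γ ^ 4 := by
  have h1 := h.soundSpeed_pos
  rw [shockVel_sq h hz]
  field_simp
  ring

theorem eq_shockVel (h : IsGasLaw γ A) {z u : ℝ} (hz : 0 < z) (hu : 0 < u)
    (hzu : z * (soundSpeed γ ^ 2 * (1 - u ^ 2)) = u ^ 2 - soundSpeed γ ^ 4) :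
    u = shockVel γ z := by
  have h1 := h.soundSpeed_pos
  rw [← sq_eq_sq₀ hu.le (shockVel_pos h hz).le, shockVel_sq h hz, eq_div_iff (by positivity)]
  linear_combination -hzu

/-- In the rest frame of the shock the Lax condition says that the flow is subsonic behind;
`lt_charSpeed_zero_iff` says that it is supersonic ahead. -/
theorem charSpeed_zero_lt_iff (h : IsGasLaw γ A) {W : GasState} (hW : W.IsPhysical) {s : ℝ}
    (hs : -1 < s ∧ s < 1) : charSpeed γ 0 W < s ↔ relVel s W.v < soundSpeed γ := by
  have h1 := one_sub_mul_pos hs hW.2.1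
  have h2 := one_sub_mul_pos h.soundSpeed_mem hW.2.1
  rw [charSpeed_zero, relVel, div_lt_iff₀ h1, div_lt_iff₀ h2]
  constructor <;> intro <;> linarith

theorem lt_charSpeed_zero_iff (h : IsGasLaw γ A) {W : GasState} (hW : W.IsPhysical) {s : ℝ}
    (hs : -1 < s ∧ s < 1) : s < charSpeed γ 0 W ↔ soundSpeed γ < relVel s W.v := by
  have h1 := one_sub_mul_pos hs hW.2.1
  have h2 := one_sub_mul_pos h.soundSpeed_mem hW.2.1
  rw [charSpeed_zero, relVel, lt_div_iff₀ h1, lt_div_iff₀ h2]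
  constructor <;> intro <;> linarith

theorem IsShockWave.speed_mem (h : IsGasLaw γ A) {U M : GasState} {s : ℝ} (hU : U.IsPhysical)
    (hM : M.IsPhysical) (hS : IsShockWave γ A 0 U M s) : -1 < s ∧ s < 1 :=
  ⟨(charSpeed_zero_mem h hM).1.trans hS.2.1, hS.2.2.trans (charSpeed_zero_mem h hU).2⟩

/-- A 1-shock in its rest frame. -/
theorem IsShockWave.rest_frame (h : IsGasLaw γ A) {U M : GasState} {s : ℝ} (hU : U.IsPhysical)
    (hM : M.IsPhysical) (hS : IsShockWave γ A 0 U M s) :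
    1 < M.ρ / U.ρ ∧ relVel s U.v = shockVel γ (M.ρ / U.ρ) ∧
      relVel s M.v = soundSpeed γ ^ 2 / shockVel γ (M.ρ / U.ρ) ∧
      conserved γ A M 0 * (M.v - s) = conserved γ A U 0 * (U.v - s) := by
  have hs := IsShockWave.speed_mem h hU hM hS
  obtain ⟨hR, h2, h1⟩ := hS
  rw [charSpeed_zero_lt_iff h hM hs] at h2
  rw [lt_charSpeed_zero_iff h hU hs] at h1
  obtain ⟨hn, hp, hm⟩ := (rankineHugoniot_iff h hU hM hs).1 hR
  have ha := h.soundSpeed_pos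
  have hu1 := one_sub_sq_pos (velocity_sub_mem hs hU.2.1)
  have hu2 := one_sub_sq_pos (velocity_sub_mem hs hM.2.1)
  change 0 < 1 - relVel s U.v ^ 2 at hu1
  change 0 < 1 - relVel s M.v ^ 2 at hu2
  have hr1 : 0 < U.ρ / (1 - relVel s U.v ^ 2) := div_pos hU.1 hu1
  have hr2 : 0 < M.ρ / (1 - relVel s M.v ^ 2) := div_pos hM.1 hu2
  have hU1 := div_mul_cancel₀ U.ρ hu1.ne'
  have hM1 := div_mul_cancel₀ M.ρ hu2.ne'
  set r₁ := U.ρ / (1 - relVel s U.v ^ 2)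
  set r₂ := M.ρ / (1 - relVel s M.v ^ 2)
  set u₁ := relVel s U.v
  set u₂ := relVel s M.v
  set a := soundSpeed γ with ha'
  -- Prandtl's relation. Eliminating `r₂` from the two flux equations leaves `r₁ (u₁ - u₂)(u₁ u₂ -
  -- a²) = 0`, and the Lax condition excludes `u₁ = u₂`.
  have hu : u₁ * u₂ = a ^ 2 := by
    have : r₁ * (u₁ - u₂) * (u₁ * u₂ - a ^ 2) = 0 := by
      linear_combination (-u₂) * hp + (u₂ ^ 2 + a ^ 2) * hm
    have h3 : r₁ * (u₁ - u₂) ≠ 0 := (mul_pos hr1 (by linarith)).ne'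
    have := (mul_eq_zero.1 this).resolve_left h3
    linarith
  have hz : M.ρ * (a ^ 2 * (1 - u₁ ^ 2)) = U.ρ * (u₁ ^ 2 - a ^ 4) := by
    rw [← hU1, ← hM1]
    linear_combination (1 - u₁ ^ 2) * (1 - u₂ ^ 2) * (u₁ * hm - r₂ * hu)
      + (-(1 - u₁ ^ 2) * r₁ * (u₁ * u₂ + a ^ 2)) * hu
  have hz' : M.ρ / U.ρ * (a ^ 2 * (1 - u₁ ^ 2)) = u₁ ^ 2 - a ^ 4 := by
    rw [div_mul_eq_mul_div, hz, mul_div_cancel_left₀ _ hU.1.ne']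
  have hu1e := eq_shockVel h (div_pos hM.1 hU.1) (ha.trans h1) hz'
  refine ⟨?_, hu1e, ?_, hn⟩
  -- A ratio at most 1 would give `u₁² - a⁴ ≤ a² (1 - u₁²)`, that is `u₁ ≤ a`, against the Lax
  -- condition.
  · by_contra hle
    push Not at hle
    have h4 : a ^ 2 < u₁ ^ 2 := pow_lt_pow_left₀ h1 ha.le (by norm_num)
    have h5 : M.ρ / U.ρ * (a ^ 2 * (1 - u₁ ^ 2)) ≤ a ^ 2 * (1 - u₁ ^ 2) :=
      mul_le_of_le_one_left (by positivity) hle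
    rw [hz'] at h5
    nlinarith [sq_nonneg a]
  · rw [← hu1e, eq_div_iff (ha.trans h1).ne', mul_comm, hu]

/-- The entropy does not decrease across a 1-shock. -/
theorem shock_entropy_nonneg (h : IsGasLaw γ A) {x : ℝ} (hx : soundSpeed γ ^ 2 ≤ x)
    (hx1 : x < 1) :
    0 ≤ (1 - γ / 2) * (Real.log (x - soundSpeed γ ^ 4) - Real.log (1 - x))
      - γ / 2 * Real.log x + (γ - 1) * Real.log (soundSpeed γ ^ 2) := by
  have ha := h.soundSpeed_pos
  have ha1 := one_sub_sq_pos h.soundSpeed_mem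
  have hg := h.gamma_eq
  set a := soundSpeed γ
  -- With `x = u₁²` this is the logarithm of the ratio of `A(S)` behind to `A(S)` ahead, as
  -- `log_shockVel_le` makes explicit.
  set g : ℝ → ℝ := fun x => (1 - γ / 2) * (Real.log (x - a ^ 4) - Real.log (1 - x))
      - γ / 2 * Real.log x + (γ - 1) * Real.log (a ^ 2) with hgdef
  have hpos : ∀ y ∈ Ico (a ^ 2) 1, 0 < y - a ^ 4 ∧ 0 < 1 - y ∧ 0 < y := fun y hy => by
    have h1 : 0 < a ^ 2 * (1 - a ^ 2) := by positivity
    exact ⟨by nlinarith [hy.1], by linarith [hy.2], by nlinarith [hy.1]⟩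
  have hder : ∀ y ∈ Ico (a ^ 2) 1, HasDerivAt g
      ((1 - γ / 2) * (1 / (y - a ^ 4) - (-1) / (1 - y)) - γ / 2 * y⁻¹) y := fun y hy => by
    obtain ⟨h1, h2, h3⟩ := hpos y hy
    exact (((((hasDerivAt_id y).sub_const (a ^ 4)).log h1.ne').sub
      (((hasDerivAt_id y).const_sub 1).log h2.ne')).const_mul (1 - γ / 2)).sub
      ((Real.hasDerivAt_log h3.ne').const_mul (γ / 2)) |>.add_const _
  have hmono : MonotoneOn g (Ico (a ^ 2) 1) := by
    refine monotoneOn_of_deriv_nonneg (convex_Ico _ _)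
      (fun y hy => (hder y hy).continuousAt.continuousWithinAt)
      (fun y hy => (hder y (interior_subset hy)).differentiableAt.differentiableWithinAt)
      fun y hy => ?_
    have hy' := interior_subset hy
    obtain ⟨h1, h2, h3⟩ := hpos y hy'
    rw [(hder y hy').deriv, hg]
    -- The derivative is a square over a positive product. Its double zero at the sonic value `a²`
    -- reflects that the entropy jump is of third order in the shock strength.
    have : (1 - (1 + a ^ 2) / 2) * (1 / (y - a ^ 4) - (-1) / (1 - y)) - (1 + a ^ 2) / 2 * y⁻¹
        = (1 + a ^ 2) / 2 * (y - a ^ 2) ^ 2 / ((y - a ^ 4) * (1 - y) * y) := by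
      field_simp
      ring
    rw [this]
    positivity
  have h0 : g (a ^ 2) = 0 := by
    have : a ^ 2 - a ^ 4 = a ^ 2 * (1 - a ^ 2) := by ring
    simp only [hgdef]
    rw [this, Real.log_mul (by positivity) ha1.ne']
    ring
  rw [← h0]
  exact hmono ⟨le_rfl, by linarith⟩ ⟨hx, hx1⟩ hx

/-- In rest-frame quantities this is `log A(S)` ahead `≤` `log A(S)` behind; the difference of the
two sides is the function of `shock_entropy_nonneg` at `x = u₁²`. -/
theorem log_shockVel_le (h : IsGasLaw γ A) {z : ℝ} (hz : 1 < z) :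
    γ * (Real.log (shockVel γ z) - Real.log (1 - shockVel γ z ^ 2) / 2) -
      γ * (Real.log (soundSpeed γ ^ 2 / shockVel γ z) -
        Real.log (1 - (soundSpeed γ ^ 2 / shockVel γ z) ^ 2) / 2) ≤ Real.log z := by
  have hz0 : 0 < z := one_pos.trans hz
  have ha := h.soundSpeed_pos
  have ha1 := h.soundSpeed_lt_one
  have hau := soundSpeed_lt_shockVel h hz
  have hu1 := shockVel_lt_one h hz0
  have hspec := shockVel_spec h hz0
  have hu0 := shockVel_pos h hz0
  have hu1s := one_sub_sq_pos ⟨by linarith, hu1⟩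
  have hent := shock_entropy_nonneg h (x := shockVel γ z ^ 2) (pow_le_pow_left₀ ha.le hau.le 2)
    (by linarith)
  generalize soundSpeed γ = a at *
  generalize shockVel γ z = u at *
  have hx4 : 0 < u ^ 2 - a ^ 4 := by
    rw [← hspec]
    positivity
  have e1 : Real.log z = Real.log (u ^ 2 - a ^ 4) - Real.log (a ^ 2) - Real.log (1 - u ^ 2) := by
    rw [← hspec, Real.log_mul hz0.ne' (by positivity), Real.log_mul (by positivity) hu1s.ne']
    ring
  have e2 : Real.log (1 - (a ^ 2 / u) ^ 2) = Real.log (u ^ 2 - a ^ 4) - 2 * Real.log u := by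
    have : 1 - (a ^ 2 / u) ^ 2 = (u ^ 2 - a ^ 4) / u ^ 2 := by
      field_simp
    rw [this, Real.log_div hx4.ne' (by positivity), Real.log_pow]
    push_cast
    ring
  have e3 : Real.log (a ^ 2 / u) = Real.log (a ^ 2) - Real.log u := by
    rw [Real.log_div (by positivity) hu0.ne']
  have e4 : Real.log (u ^ 2) = 2 * Real.log u := by
    rw [Real.log_pow]
    push_cast
    ring
  rw [e4] at hent
  rw [e1, e2, e3]
  linear_combination hent

theorem relVel_velocity_add {s u : ℝ} (hs : -1 < s ∧ s < 1) (hu : -1 < u ∧ u < 1) :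
    relVel s ((u + s) / (1 + u * s)) = u := by
  have h1 := one_sub_mul_pos (a := -s) ⟨by linarith [hs.2], by linarith [hs.1]⟩ hu
  have h2 : 0 < 1 + u * s := by linarith
  have h3 := one_sub_sq_pos hs
  have h4 : (u + s) / (1 + u * s) - s = u * (1 - s ^ 2) / (1 + u * s) := by
    field_simp; ring
  have h5 : 1 - (u + s) / (1 + u * s) * s = (1 - s ^ 2) / (1 + u * s) := by
    field_simp; ring
  rw [relVel, h4, h5]
  field_simp

/-- Logarithm of `(v - s)/√(1 - v²) = √(1 - s²) u/√(1 - u²)`. The term in `s` is common to both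
sides of a shock and cancels in the particle balance. -/
theorem log_relVel {s v : ℝ} (hs : -1 < s ∧ s < 1) (hv : -1 < v ∧ v < 1) (hsv : s < v) :
    Real.log (v - s) - Real.log (1 - v ^ 2) / 2 =
      Real.log (relVel s v) - Real.log (1 - relVel s v ^ 2) / 2 + Real.log (1 - s ^ 2) / 2 := by
  have h1 := one_sub_mul_pos hs hv
  have h2 := one_sub_sq_pos hs
  have h3 := one_sub_sq_pos hv
  rw [one_sub_relVel_sq hs hv, relVel, Real.log_div (sub_pos.2 hsv).ne' h1.ne',
    Real.log_div (by positivity) (by positivity), Real.log_mul h2.ne' h3.ne', Real.log_pow]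
  push_cast
  ring

/-- `A` may have a positive infimum, so only values above an attained one are guaranteed; hence the
need for entropy growth across shocks. -/
theorem IsGasLaw.exists_entropy (h : IsGasLaw γ A) {S₀ B : ℝ} (hS : 0 < S₀) (hB : A S₀ ≤ B) :
    ∃ S, 0 < S ∧ A S = B := by
  obtain ⟨S₁, hS₁, hlt⟩ := h.unbounded B
  have hle : S₀ ≤ S₁ := by
    by_contra hlt'
    push Not at hlt'
    exact absurd (h.mono hS₁ hS hlt') (by linarith)
  obtain ⟨S, hS', rfl⟩ := intermediate_value_Icc hle
    (h.cont.mono fun x hx => hS.trans_le hx.1) ⟨hB, hlt.le⟩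
  exact ⟨S, hS.trans_le hS'.1, rfl⟩

/-- There is a 1-shock with any density ratio `z > 1`. -/
theorem exists_isShockWave (h : IsGasLaw γ A) {U : GasState} (hU : U.IsPhysical) {z : ℝ}
    (hz : 1 < z) : ∃ (M : GasState) (s : ℝ), M.IsPhysical ∧ M.ρ = U.ρ * z ∧
      IsShockWave γ A 0 U M s := by
  have hz0 : 0 < z := one_pos.trans hz
  have ha := h.soundSpeed_pos
  have ha1 := h.soundSpeed_lt_one
  have hau := soundSpeed_lt_shockVel h hz
  have hu1 := shockVel_lt_one h hz0
  have hspec := shockVel_spec h hz0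
  have hu0 := shockVel_pos h hz0
  set a := soundSpeed γ with ha_def
  set u₁ := shockVel γ z with hu₁
  have hu1m : -1 < u₁ ∧ u₁ < 1 := ⟨by linarith, hu1⟩
  obtain ⟨u₂, hu₂⟩ : ∃ u₂, u₂ = a ^ 2 / u₁ := ⟨_, rfl⟩
  have hu20 : 0 < u₂ := by rw [hu₂]; positivity
  have hu2a : u₂ < a := by
    rw [hu₂, div_lt_iff₀ hu0, sq]
    exact mul_lt_mul_of_pos_left hau ha
  have hu2m : -1 < u₂ ∧ u₂ < 1 := ⟨by linarith, by linarith⟩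
  have huu : u₁ * u₂ = a ^ 2 := by rw [hu₂]; field_simp
  -- The shock speed is the one for which the gas ahead has relative velocity `u₁`; the velocity `v`
  -- behind is then `u₂` composed with `s`.
  obtain ⟨s, hs⟩ : ∃ s, s = relVel u₁ U.v := ⟨_, rfl⟩
  have hsm : -1 < s ∧ s < 1 := by rw [hs]; exact velocity_sub_mem hu1m hU.2.1
  have hUv : relVel s U.v = u₁ := by
    have h1 := one_sub_mul_pos hu1m hU.2.1
    have h3 := one_sub_sq_pos hU.2.1
    have h4 : U.v - s = u₁ * (1 - U.v ^ 2) / (1 - U.v * u₁) := by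
      rw [hs, relVel]; field_simp; ring
    have h5 : 1 - U.v * s = (1 - U.v ^ 2) / (1 - U.v * u₁) := by
      rw [hs, relVel]; field_simp; ring
    rw [relVel, h4, h5, div_div_div_cancel_right₀ h1.ne', mul_div_assoc, div_self h3.ne', mul_one]
  obtain ⟨v, hv⟩ : ∃ v, v = (u₂ + s) / (1 + u₂ * s) := ⟨_, rfl⟩
  have hvm : -1 < v ∧ v < 1 := by rw [hv]; exact velocity_add_mem hsm hu2m
  have hMv : relVel s v = u₂ := by rw [hv]; exact relVel_velocity_add hsm hu2m
  have hsU : s < U.v := by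
    have := one_sub_mul_pos hsm hU.2.1
    rw [relVel, div_eq_iff this.ne'] at hUv
    nlinarith
  have hsv : s < v := by
    have := one_sub_mul_pos hsm hvm
    rw [relVel, div_eq_iff this.ne'] at hMv
    nlinarith
  -- The particle jump condition dictates `N`, and `log_conserved_zero` then dictates the value `B`
  -- of `A(S)` behind.
  obtain ⟨N, hN⟩ : ∃ N, N = conserved γ A U 0 * (U.v - s) / (v - s) := ⟨_, rfl⟩
  have hNU := conserved_zero_pos h hU
  have hsU' := sub_pos.2 hsU
  have hsv' := sub_pos.2 hsv
  have hN0 : 0 < N := by rw [hN]; positivity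
  have hvv := one_sub_sq_pos hvm
  obtain ⟨B, hB⟩ : ∃ B, B = Real.exp (Real.log (U.ρ * z) - γ * Real.log N
    - γ / 2 * Real.log (1 - v ^ 2)) := ⟨_, rfl⟩
  have hAB : A U.S ≤ B := by
    rw [← Real.log_le_log_iff (h.pos _ hU.2.2) (by rw [hB]; positivity), hB, Real.log_exp,
      log_conserved_zero h hU, hN, Real.log_div (by positivity) (by positivity),
      Real.log_mul hNU.ne' hsU'.ne', Real.log_mul hU.1.ne' hz0.ne']
    have l1 := log_relVel hsm hU.2.1 hsU
    have l2 := log_relVel hsm hvm hsv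
    rw [hUv] at l1
    rw [hMv] at l2
    have hent := log_shockVel_le h hz
    rw [← hu₁, ← ha_def, ← hu₂] at hent
    linear_combination hent + γ * l1 - γ * l2
  obtain ⟨S, hS, hAS⟩ := h.exists_entropy hU.2.2 hAB
  have hM : (⟨U.ρ * z, v, S⟩ : GasState).IsPhysical := ⟨mul_pos hU.1 hz0, hvm, hS⟩
  refine ⟨⟨U.ρ * z, v, S⟩, s, hM, rfl, (rankineHugoniot_iff h hU hM hsm).2 ⟨?_, ?_, ?_⟩, ?_, ?_⟩
  · have hl := log_conserved_zero h hM
    simp only [hAS, hB, Real.log_exp] at hl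
    have : N = conserved γ A ⟨U.ρ * z, v, S⟩ 0 := by
      apply Real.log_injOn_pos hN0 (conserved_zero_pos h hM)
      exact mul_left_cancel₀ h.gamma_pos.ne' (by linarith)
    rw [← this, hN]
    exact div_mul_cancel₀ _ hsv'.ne'
  all_goals
    have hu1s := (one_sub_sq_pos hu1m)
    have hu2s := (one_sub_sq_pos hu2m)
  · simp only [hUv, hMv]
    rw [div_mul_eq_mul_div, div_mul_eq_mul_div, div_eq_div_iff hu2s.ne' hu1s.ne']
    rw [hu₂]
    field_simp
    linear_combination U.ρ * (a ^ 2 + u₁ ^ 2) * hspec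
  · simp only [hUv, hMv]
    rw [div_mul_eq_mul_div, div_mul_eq_mul_div, div_eq_div_iff hu2s.ne' hu1s.ne']
    rw [hu₂]
    field_simp
    linear_combination U.ρ * hspec
  · rw [charSpeed_zero_lt_iff h hM hsm]
    simpa only [hMv] using hu2a
  · rw [lt_charSpeed_zero_iff h hU hsm, hUv]
    exact hau

end Shock

/-! ### The wave curve as a monotone function of the density ratio, and the equation for the middle
density. -/

section WaveFactor

variable {γ : ℝ} {A : ℝ → ℝ}

/-! ### The ratio of Doppler factors across a 1-wave -/

/-- The ratio of the Doppler factors behind and ahead of a 1-wave with density ratio `z`. -/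
def waveFactor (γ z : ℝ) : ℝ :=
  -- The clamps make the first factor trivial for `z ≥ 1` and the second trivial for `z ≤ 1`.
  Real.exp (-(2 * soundSpeed γ / γ) * Real.log (min z 1)) *
    (doppler (soundSpeed γ ^ 2 / shockVel γ (max z 1)) / doppler (shockVel γ (max z 1)))

theorem shockVel_mem (h : IsGasLaw γ A) {z : ℝ} (hz : 0 < z) :
    -1 < shockVel γ z ∧ shockVel γ z < 1 :=
  ⟨by linarith [shockVel_pos h hz], shockVel_lt_one h hz⟩

theorem soundSpeed_le_shockVel (h : IsGasLaw γ A) {z : ℝ} (hz : 1 ≤ z) :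
    soundSpeed γ ≤ shockVel γ z := by
  rcases hz.eq_or_lt with rfl | hz
  · rw [shockVel_one h]
  · exact (soundSpeed_lt_shockVel h hz).le

theorem sq_div_shockVel_le (h : IsGasLaw γ A) {z : ℝ} (hz : 1 ≤ z) :
    soundSpeed γ ^ 2 / shockVel γ z ≤ soundSpeed γ := by
  rw [div_le_iff₀ (shockVel_pos h (by linarith)), sq]
  exact mul_le_mul_of_nonneg_left (soundSpeed_le_shockVel h hz) h.soundSpeed_pos.le

theorem sq_div_shockVel_mem (h : IsGasLaw γ A) {z : ℝ} (hz : 1 ≤ z) :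
    -1 < soundSpeed γ ^ 2 / shockVel γ z ∧ soundSpeed γ ^ 2 / shockVel γ z < 1 := by
  have h1 := h.soundSpeed_pos
  have h2 := shockVel_pos h (z := z) (by linarith)
  have h3 : 0 < soundSpeed γ ^ 2 / shockVel γ z := by positivity
  exact ⟨by linarith, (sq_div_shockVel_le h hz).trans_lt h.soundSpeed_lt_one⟩

theorem waveFactor_of_le_one (h : IsGasLaw γ A) {z : ℝ} (hz : z ≤ 1) :
    waveFactor γ z = Real.exp (-(2 * soundSpeed γ / γ) * Real.log z) := by
  have h1 := h.soundSpeed_pos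
  rw [waveFactor, min_eq_left hz, max_eq_right hz, shockVel_one h, sq,
    mul_div_cancel_left₀ _ h1.ne', div_self (doppler_pos h.soundSpeed_mem).ne', mul_one]

theorem waveFactor_of_one_le {z : ℝ} (hz : 1 ≤ z) :
    waveFactor γ z = doppler (soundSpeed γ ^ 2 / shockVel γ z) / doppler (shockVel γ z) := by
  rw [waveFactor, min_eq_right hz, max_eq_left hz, Real.log_one, mul_zero, Real.exp_zero, one_mul]

theorem waveFactor_one (h : IsGasLaw γ A) : waveFactor γ 1 = 1 := by
  rw [waveFactor_of_le_one h le_rfl]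
  simp

theorem waveFactor_pos (h : IsGasLaw γ A) (z : ℝ) : 0 < waveFactor γ z :=
  mul_pos (Real.exp_pos _) (div_pos (doppler_pos (sq_div_shockVel_mem h (le_max_right _ _)))
    (doppler_pos (shockVel_mem h (by positivity))))

/-- For `z ≤ 1` it is a negative power. For `z ≥ 1` the velocity ahead `u₁` grows with `z` while `u₂
= a²/u₁` falls, and `doppler` is increasing. -/
theorem waveFactor_strictAntiOn (h : IsGasLaw γ A) : StrictAntiOn (waveFactor γ) (Ioi 0) := by
  have ha := h.soundSpeed_pos
  have hγ := h.gamma_pos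
  have h1 : StrictAntiOn (waveFactor γ) (Ioc 0 1) := by
    intro z hz z' hz' hlt
    rw [waveFactor_of_le_one h hz.2, waveFactor_of_le_one h hz'.2, Real.exp_lt_exp, neg_mul,
      neg_mul, neg_lt_neg_iff]
    exact mul_lt_mul_of_pos_left (Real.log_lt_log hz.1 hlt) (by positivity)
  have h2 : StrictAntiOn (waveFactor γ) (Ici 1) := by
    intro z hz z' hz' hlt
    have hz0 : 0 < z := one_pos.trans_le hz
    have hlt' := shockVel_lt_shockVel h hz0 hlt
    rw [waveFactor_of_one_le hz, waveFactor_of_one_le hz']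
    refine div_lt_div₀ (doppler_lt_doppler (sq_div_shockVel_mem h hz).2 ?_)
      (doppler_le_doppler (shockVel_lt_one h (hz0.trans hlt)) hlt'.le)
      (doppler_pos (sq_div_shockVel_mem h hz)).le (doppler_pos (shockVel_mem h hz0))
    exact div_lt_div_of_pos_left (by positivity) (shockVel_pos h hz0) hlt'
  have := h1.union h2 (c := 1) ⟨⟨one_pos, le_rfl⟩, fun x hx => hx.2⟩ ⟨mem_Ici.2 le_rfl, fun x hx => hx⟩
  exact this.mono fun x hx => by
    rcases le_total x 1 with h' | h'
    · exact Or.inl ⟨hx, h'⟩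
    · exact Or.inr h'

theorem continuousAt_doppler {v : ℝ} (hv : v < 1) : ContinuousAt doppler v := by
  unfold doppler
  exact ContinuousAt.div (by fun_prop) (by fun_prop) (by linarith)

theorem waveFactor_continuousOn (h : IsGasLaw γ A) : ContinuousOn (waveFactor γ) (Ioi 0) := by
  have ha := h.soundSpeed_pos
  intro z hz
  have hz' : (0 : ℝ) < z := hz
  have hmin : 0 < min z 1 := lt_min hz one_pos
  have hmax : (1 : ℝ) ≤ max z 1 := le_max_right _ _
  have hs : ContinuousAt (shockVel γ) (max z 1) := by
    unfold shockVel
    exact (ContinuousAt.div (by fun_prop) (by fun_prop) (by positivity)).sqrt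
  have hs' : ContinuousAt (fun z => shockVel γ (max z 1)) z :=
    ContinuousAt.comp (g := shockVel γ) (f := fun z => max z 1) hs (by fun_prop)
  have hd : ContinuousAt (fun z => doppler (shockVel γ (max z 1))) z :=
    ContinuousAt.comp (g := doppler) (f := fun z => shockVel γ (max z 1))
      (continuousAt_doppler (shockVel_lt_one h (by positivity))) hs'
  have hd' : ContinuousAt (fun z => doppler (soundSpeed γ ^ 2 / shockVel γ (max z 1))) z :=
    ContinuousAt.comp (g := doppler) (f := fun z => soundSpeed γ ^ 2 / shockVel γ (max z 1))
      (continuousAt_doppler (sq_div_shockVel_mem h hmax).2)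
      (continuousAt_const.div hs' (shockVel_pos h (by positivity)).ne')
  have hl : ContinuousAt (fun z : ℝ => Real.log (min z 1)) z :=
    ContinuousAt.log (by fun_prop) hmin.ne'
  exact (((hl.const_mul _).rexp).mul (hd'.div hd
    (doppler_pos (shockVel_mem h (by positivity))).ne')).continuousWithinAt

theorem exists_le_waveFactor (h : IsGasLaw γ A) (K : ℝ) :
    ∃ z, 0 < z ∧ z ≤ 1 ∧ K ≤ waveFactor γ z := by
  have ha := h.soundSpeed_pos
  have hγ := h.gamma_pos
  -- At this point the factor is `exp |K|`.
  refine ⟨Real.exp (-(γ / (2 * soundSpeed γ) * |K|)), Real.exp_pos _, ?_, ?_⟩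
  · rw [Real.exp_le_one_iff, neg_nonpos]
    positivity
  · rw [waveFactor_of_le_one h, Real.log_exp]
    · have : -(2 * soundSpeed γ / γ) * -(γ / (2 * soundSpeed γ) * |K|) = |K| := by
        field_simp
      rw [this]
      linarith [Real.add_one_le_exp |K|, le_abs_self K]
    · rw [Real.exp_le_one_iff, neg_nonpos]
      positivity

theorem exists_waveFactor_le (h : IsGasLaw γ A) {K : ℝ} (hK : 0 < K) :
    ∃ z, 1 ≤ z ∧ waveFactor γ z ≤ K := by
  have ha := h.soundSpeed_pos
  have ha1 := h.soundSpeed_lt_one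
  have hd := doppler_pos h.soundSpeed_mem
  -- `D` is the Doppler factor wanted ahead of the shock: the first summand brings `doppler a / D`
  -- below `K`, the second forces `u > a`, hence compression. The ratio `z` then follows from
  -- `shockVel_spec`.
  obtain ⟨D, hD⟩ : ∃ D, D = doppler (soundSpeed γ) / K + doppler (soundSpeed γ) := ⟨_, rfl⟩
  have hDa : doppler (soundSpeed γ) < D := by
    rw [hD]
    linarith [div_pos hd hK]
  have hD0 : 0 < D := hd.trans hDa
  obtain ⟨u, hu⟩ : ∃ u, u = (D - 1) / (D + 1) := ⟨_, rfl⟩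
  have hu1 : u < 1 := by
    rw [hu, div_lt_one (by linarith)]
    linarith
  have hdu : doppler u = D := by
    rw [doppler, hu]
    field_simp
    ring
  have hau : soundSpeed γ < u := by
    by_contra hle
    push Not at hle
    have := doppler_le_doppler ha1 hle
    linarith
  have hu0 : 0 < u := ha.trans hau
  have hus := one_sub_sq_pos ⟨by linarith, hu1⟩
  have hz : 1 ≤ (u ^ 2 - soundSpeed γ ^ 4) / (soundSpeed γ ^ 2 * (1 - u ^ 2)) := by
    rw [one_le_div (by positivity)]
    have : soundSpeed γ ^ 2 ≤ u ^ 2 := pow_le_pow_left₀ ha.le hau.le 2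
    nlinarith [sq_nonneg (soundSpeed γ)]
  refine ⟨_, hz, ?_⟩
  have hsv := eq_shockVel h (one_pos.trans_le hz) hu0 (by field_simp)
  rw [waveFactor_of_one_le hz, ← hsv, hdu, div_le_iff₀ hD0]
  have h2 : doppler (soundSpeed γ ^ 2 / u) ≤ doppler (soundSpeed γ) := by
    refine doppler_le_doppler ha1 ?_
    rw [div_le_iff₀ hu0, sq]
    exact mul_le_mul_of_nonneg_left hau.le ha.le
  have h3 : K * D = doppler (soundSpeed γ) + K * doppler (soundSpeed γ) := by
    rw [hD]
    field_simp
  nlinarith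

/-- The density between the two nonlinear waves of the Riemann problem. -/
theorem exists_middle_density (h : IsGasLaw γ A) {ρ₁ ρ₂ K : ℝ} (h₁ : 0 < ρ₁) (h₂ : 0 < ρ₂)
    (hK : 0 < K) : ∃ ρ, 0 < ρ ∧ waveFactor γ (ρ / ρ₁) * waveFactor γ (ρ / ρ₂) = K := by
  obtain ⟨z, hz, hz1, hzK⟩ := exists_le_waveFactor h K
  obtain ⟨y, hy1, hyK⟩ := exists_waveFactor_le h hK
  have hanti := waveFactor_strictAntiOn h
  have hy0 : 0 < y := one_pos.trans_le hy1
  -- At `ρl` the first factor is at least `K` and the second at least 1; at `ρr` both inequalities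
  -- are reversed.
  set ρl := min (z * ρ₁) ρ₂ with hρl
  set ρr := max (y * ρ₁) ρ₂ with hρr
  have hl0 : 0 < ρl := lt_min (by positivity) h₂
  have hlr : ρl ≤ ρr := (min_le_right _ _).trans (le_max_right _ _)
  have hone := waveFactor_one h
  have hcont : ContinuousOn (fun ρ => waveFactor γ (ρ / ρ₁) * waveFactor γ (ρ / ρ₂))
      (Icc ρl ρr) := by
    refine ContinuousOn.mul ?_ ?_
    · exact (waveFactor_continuousOn h).comp (by fun_prop) fun x hx =>
        div_pos (hl0.trans_le hx.1) h₁
    · exact (waveFactor_continuousOn h).comp (by fun_prop) fun x hx =>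
        div_pos (hl0.trans_le hx.1) h₂
  have hL1 : K ≤ waveFactor γ (ρl / ρ₁) := hzK.trans <| hanti.antitoneOn (div_pos hl0 h₁) hz <| by
    rw [div_le_iff₀ h₁]
    exact min_le_left _ _
  have hL2 : 1 ≤ waveFactor γ (ρl / ρ₂) := by
    rw [← hone]
    refine hanti.antitoneOn (div_pos hl0 h₂) (mem_Ioi.2 one_pos) ?_
    rw [div_le_one h₂]
    exact min_le_right _ _
  have hr0 : 0 < ρr := hl0.trans_le hlr
  have hR1 : waveFactor γ (ρr / ρ₁) ≤ K := le_trans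
    (hanti.antitoneOn hy0 (div_pos hr0 h₁) <| by
      rw [le_div_iff₀ h₁]
      exact le_max_left _ _) hyK
  have hR2 : waveFactor γ (ρr / ρ₂) ≤ 1 := by
    rw [← hone]
    refine hanti.antitoneOn (mem_Ioi.2 one_pos) (div_pos hr0 h₂) ?_
    rw [one_le_div h₂]
    exact le_max_right _ _
  obtain ⟨ρ, hρ, hρK⟩ := intermediate_value_Icc' hlr hcont (show K ∈ Icc _ _ from
    ⟨(mul_le_of_le_one_right (waveFactor_pos h _).le hR2).trans hR1,
      hL1.trans (le_mul_of_one_le_right (waveFactor_pos h _).le hL2)⟩)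
  exact ⟨ρ, hl0.trans_le hρ.1, hρK⟩

theorem middle_density_unique (h : IsGasLaw γ A) {ρ₁ ρ₂ ρ ρ' : ℝ} (h₁ : 0 < ρ₁) (h₂ : 0 < ρ₂)
    (hρ : 0 < ρ) (hρ' : 0 < ρ')
    (he : waveFactor γ (ρ / ρ₁) * waveFactor γ (ρ / ρ₂) =
      waveFactor γ (ρ' / ρ₁) * waveFactor γ (ρ' / ρ₂)) : ρ = ρ' := by
  have hanti := waveFactor_strictAntiOn h
  have key : ∀ x y : ℝ, 0 < x → 0 < y → x < y →
      waveFactor γ (y / ρ₁) * waveFactor γ (y / ρ₂) <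
        waveFactor γ (x / ρ₁) * waveFactor γ (x / ρ₂) := fun x y hx hy hxy =>
    mul_lt_mul'' (hanti (div_pos hx h₁) (div_pos hy h₁) (by gcongr))
      (hanti (div_pos hx h₂) (div_pos hy h₂) (by gcongr))
      (waveFactor_pos h _).le (waveFactor_pos h _).le
  rcases lt_trichotomy ρ ρ' with hlt | heq | hlt
  · exact absurd he (key _ _ hρ hρ' hlt).ne'
  · exact heq
  · exact absurd he (key _ _ hρ' hρ hlt).ne

end WaveFactor

/-! ### Self-similar profiles, and single 1- and 3-waves with prescribed density. -/

section SimpleWave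

variable {γ : ℝ} {A : ℝ → ℝ}

/-! ### Self-similar solutions -/

/-- The profile `w` (a function of `ξ = x/t`) solves the conservation laws `F(w)' = ξ U(w)'`, in the
form that `h = F(w) - ξ U(w)` is continuous and `h' = -U(w)` up to finitely many points. -/
structure IsSelfSimilarSolution (γ : ℝ) (A : ℝ → ℝ) (w : ℝ → GasState) : Prop where
  physical : ∀ ξ, (w ξ).IsPhysical
  measurable : ∀ k, Measurable fun ξ => conserved γ A (w ξ) k
  bounded : ∀ k, ∃ C, ∀ ξ, |conserved γ A (w ξ) k| ≤ C ∧ |flux γ A (w ξ) k| ≤ C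
  continuous : ∀ k, Continuous fun ξ => flux γ A (w ξ) k - ξ * conserved γ A (w ξ) k
  hasDerivAt : ∀ k, ∃ E : Set ℝ, E.Finite ∧ ∀ ξ ∉ E,
    HasDerivAt (fun ξ => flux γ A (w ξ) k - ξ * conserved γ A (w ξ) k)
      (-(conserved γ A (w ξ) k)) ξ

theorem IsSelfSimilarSolution.const {U : GasState} (hU : U.IsPhysical) :
    IsSelfSimilarSolution γ A fun _ => U where
  physical _ := hU
  measurable _ := measurable_const
  bounded k := ⟨max |conserved γ A U k| |flux γ A U k|, fun _ =>
    ⟨le_max_left _ _, le_max_right _ _⟩⟩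
  continuous k := by fun_prop
  hasDerivAt k := ⟨∅, finite_empty, fun ξ _ =>
    (((hasDerivAt_id ξ).mul_const (conserved γ A U k)).const_sub (flux γ A U k)).congr_deriv
      (by simp)⟩

/-- The Rankine–Hugoniot condition at speed `c` is exactly continuity of `F - ξ U` at `ξ = c`; the
point `c` joins the exceptional set. -/
theorem IsSelfSimilarSolution.glue {w₁ w₂ : ℝ → GasState} (h₁ : IsSelfSimilarSolution γ A w₁)
    (h₂ : IsSelfSimilarSolution γ A w₂) {c : ℝ} (hc : RankineHugoniot γ A (w₁ c) (w₂ c) c) :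
    IsSelfSimilarSolution γ A fun ξ => if ξ < c then w₁ ξ else w₂ ξ where
  physical ξ := by
    split_ifs
    exacts [h₁.physical ξ, h₂.physical ξ]
  measurable k := by
    simp only [apply_ite (conserved γ A · k)]
    exact Measurable.ite measurableSet_Iio (h₁.measurable k) (h₂.measurable k)
  bounded k := by
    obtain ⟨C₁, hC₁⟩ := h₁.bounded k
    obtain ⟨C₂, hC₂⟩ := h₂.bounded k
    refine ⟨max C₁ C₂, fun ξ => ?_⟩
    split_ifs
    · exact ⟨(hC₁ ξ).1.trans (le_max_left _ _), (hC₁ ξ).2.trans (le_max_left _ _)⟩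
    · exact ⟨(hC₂ ξ).1.trans (le_max_right _ _), (hC₂ ξ).2.trans (le_max_right _ _)⟩
  continuous k := by
    have : (fun ξ => flux γ A (if ξ < c then w₁ ξ else w₂ ξ) k -
        ξ * conserved γ A (if ξ < c then w₁ ξ else w₂ ξ) k) = fun ξ => if c ≤ ξ then
          flux γ A (w₂ ξ) k - ξ * conserved γ A (w₂ ξ) k else
          flux γ A (w₁ ξ) k - ξ * conserved γ A (w₁ ξ) k := by
      funext ξ
      by_cases hξ : ξ < c
      · simp [hξ, not_le.2 hξ]
      · simp [hξ, not_lt.1 hξ]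
    rw [this]
    refine Continuous.if_le (h₂.continuous k) (h₁.continuous k) continuous_const continuous_id ?_
    rintro ξ rfl
    linear_combination -hc k
  hasDerivAt k := by
    obtain ⟨E₁, hE₁, hd₁⟩ := h₁.hasDerivAt k
    obtain ⟨E₂, hE₂, hd₂⟩ := h₂.hasDerivAt k
    refine ⟨insert c (E₁ ∪ E₂), (hE₁.union hE₂).insert c, fun ξ hξ => ?_⟩
    simp only [mem_insert_iff, mem_union, not_or] at hξ
    rcases lt_or_gt_of_ne hξ.1 with hlt | hlt
    · rw [if_pos hlt]
      refine (hd₁ ξ hξ.2.1).congr_of_eventuallyEq ?_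
      filter_upwards [Iio_mem_nhds hlt] with η hη
      rw [if_pos (mem_Iio.1 hη)]
    · rw [if_neg hlt.not_gt]
      refine (hd₂ ξ hξ.2.2).congr_of_eventuallyEq ?_
      filter_upwards [Ioi_mem_nhds hlt] with η hη
      rw [if_neg (mem_Ioi.1 hη).not_gt]

theorem IsSelfSimilarSolution.refl {w : ℝ → GasState} (h : IsSelfSimilarSolution γ A w) :
    IsSelfSimilarSolution γ A fun ξ => (w (-ξ)).refl where
  physical ξ := (h.physical _).refl
  measurable k := by
    simp only [conserved_refl]
    exact ((h.measurable k).comp measurable_neg).const_mul _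
  bounded k := by
    obtain ⟨C, hC⟩ := h.bounded k
    have hk : |reflSign k| = 1 := by fin_cases k <;> simp [reflSign]
    refine ⟨C, fun ξ => ?_⟩
    rw [conserved_refl, flux_refl, abs_mul, abs_mul, abs_neg, hk, one_mul, one_mul]
    exact hC _
  continuous k := by
    simp only [conserved_refl, flux_refl]
    convert ((h.continuous k).comp continuous_neg).const_mul (-reflSign k) using 2 with ξ
    simp only [Function.comp]
    ring
  hasDerivAt k := by
    obtain ⟨E, hE, hd⟩ := h.hasDerivAt k
    refine ⟨-E, hE.neg, fun ξ hξ => ?_⟩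
    have := (HasDerivAt.comp ξ (hd (-ξ) hξ) (hasDerivAt_neg ξ)).const_mul (-reflSign k)
    simp only [conserved_refl, flux_refl]
    refine (this.congr_of_eventuallyEq (.of_forall fun η => ?_)).congr_deriv (by ring)
    simp only [Function.comp]
    ring

theorem continuousOn_numberDensity (h : IsGasLaw γ A) {w : ℝ → GasState} {s : Set ℝ}
    (hp : ∀ ξ ∈ s, (w ξ).IsPhysical) (hρ : ContinuousOn (fun ξ => (w ξ).ρ) s)
    (hS : ContinuousOn (fun ξ => (w ξ).S) s) :
    ContinuousOn (fun ξ => numberDensity γ A (w ξ)) s := by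
  have hA : ContinuousOn (fun ξ => A (w ξ).S) s := h.cont.comp hS fun ξ hξ => (hp ξ hξ).2.2
  exact (hρ.div hA fun ξ hξ => (h.pos _ (hp ξ hξ).2.2).ne').rpow_const fun ξ hξ =>
    Or.inl (div_pos (hp ξ hξ).1 (h.pos _ (hp ξ hξ).2.2)).ne'

theorem continuousOn_conserved_flux (h : IsGasLaw γ A) {w : ℝ → GasState} {s : Set ℝ}
    (hp : ∀ ξ ∈ s, (w ξ).IsPhysical) (hρ : ContinuousOn (fun ξ => (w ξ).ρ) s)
    (hv : ContinuousOn (fun ξ => (w ξ).v) s) (hS : ContinuousOn (fun ξ => (w ξ).S) s) (k : Fin 3) :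
    ContinuousOn (fun ξ => conserved γ A (w ξ) k) s ∧
      ContinuousOn (fun ξ => flux γ A (w ξ) k) s := by
  have hn := continuousOn_numberDensity h hp hρ hS
  have hv2 : ContinuousOn (fun ξ => 1 - (w ξ).v ^ 2) s := continuousOn_const.sub (hv.pow 2)
  have hv2' : ∀ ξ ∈ s, 1 - (w ξ).v ^ 2 ≠ 0 := fun ξ hξ => (one_sub_sq_pos (hp ξ hξ).2.1).ne'
  have hsq : ∀ ξ ∈ s, √(1 - (w ξ).v ^ 2) ≠ 0 := fun ξ hξ =>
    (Real.sqrt_pos.2 (one_sub_sq_pos (hp ξ hξ).2.1)).ne'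
  have hpr : ContinuousOn (fun ξ => pressure γ (w ξ)) s := hρ.const_mul (γ - 1)
  have h1 : ContinuousOn (fun ξ => (w ξ).v / (1 - (w ξ).v ^ 2)) s := hv.div hv2 hv2'
  have h2 : ContinuousOn (fun ξ => (w ξ).v ^ 2 / (1 - (w ξ).v ^ 2)) s := (hv.pow 2).div hv2 hv2'
  match k with
  | 0 => exact ⟨hn.div hv2.sqrt hsq, (hn.mul hv).div hv2.sqrt hsq⟩
  | 1 => exact ⟨(hρ.add hpr).mul h1, ((hρ.add hpr).mul h2).add hpr⟩
  | 2 => exact ⟨((hρ.add hpr).mul h2).add hρ, (hρ.add hpr).mul h1⟩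

/-- A rarefaction wave, continued by constant states. -/
theorem IsRarefactionWave.isSelfSimilarSolution (h : IsGasLaw γ A) {i : Fin 3} {w : ℝ → GasState}
    {U M : GasState} {α β : ℝ} (hw : IsRarefactionWave γ A i w U M α β) :
    IsSelfSimilarSolution γ A fun ξ => w (max α (min β ξ)) := by
  obtain ⟨hle, -, -, hp, hρ, hv, hS, hd⟩ := hw
  have hmem : ∀ ξ : ℝ, max α (min β ξ) ∈ Icc α β := fun ξ =>
    ⟨le_max_left _ _, max_le hle (min_le_left _ _)⟩
  have hc := continuousOn_conserved_flux h (fun ξ hξ => (hp ξ hξ).1) hρ hv hS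
  have hcl : Continuous fun ξ : ℝ => max α (min β ξ) := by fun_prop
  have hcU : ∀ k, Continuous fun ξ => conserved γ A (w (max α (min β ξ))) k := fun k =>
    (hc k).1.comp_continuous hcl hmem
  have hcF : ∀ k, Continuous fun ξ => flux γ A (w (max α (min β ξ))) k := fun k =>
    (hc k).2.comp_continuous hcl hmem
  refine ⟨fun ξ => (hp _ (hmem ξ)).1, fun k => (hcU k).measurable, fun k => ?_, fun k =>
    (hcF k).sub (continuous_id.mul (hcU k)), fun k => ⟨{α, β}, by simp, fun ξ hξ => ?_⟩⟩
  · obtain ⟨C₁, hC₁⟩ := isCompact_Icc.exists_bound_of_continuousOn (hc k).1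
    obtain ⟨C₂, hC₂⟩ := isCompact_Icc.exists_bound_of_continuousOn (hc k).2
    exact ⟨max C₁ C₂, fun ξ => ⟨(hC₁ _ (hmem ξ)).trans (le_max_left _ _),
      (hC₂ _ (hmem ξ)).trans (le_max_right _ _)⟩⟩
  · simp only [mem_insert_iff, mem_singleton_iff, not_or] at hξ
    have hconst : ∀ W : GasState, HasDerivAt (fun ξ => flux γ A W k - ξ * conserved γ A W k)
        (-(conserved γ A W k)) ξ := fun W =>
      (((hasDerivAt_id ξ).mul_const (conserved γ A W k)).const_sub (flux γ A W k)).congr_deriv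
        (by simp)
    rcases lt_or_gt_of_ne hξ.1 with hlt | hgt
    · have e : ∀ η < α, max α (min β η) = α := fun η hη =>
        max_eq_left ((min_le_right _ _).trans hη.le)
      rw [e ξ hlt]
      refine (hconst (w α)).congr_of_eventuallyEq ?_
      filter_upwards [Iio_mem_nhds hlt] with η hη
      rw [e η hη]
    rcases lt_or_gt_of_ne hξ.2 with hlt' | hgt'
    · have e : ∀ η, α < η → η < β → max α (min β η) = η := fun η h1 h2 => by
        rw [min_eq_right h2.le, max_eq_right h1.le]
      rw [e ξ hgt hlt']
      obtain ⟨d, hd1, hd2⟩ := hd ξ ⟨hgt, hlt'⟩ k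
      -- Inside the fan `(F - ξ U)' = F' - U - ξ U' = -U`.
      refine ((hd2.sub ((hasDerivAt_id ξ).mul hd1)).congr_of_eventuallyEq ?_).congr_deriv ?_
      · filter_upwards [Ioo_mem_nhds hgt hlt'] with η hη
        rw [e η hη.1 hη.2]
        rfl
      · simp only [id]
        ring
    · have e : ∀ η, β < η → max α (min β η) = β := fun η h1 => by
        rw [min_eq_left h1.le, max_eq_right hle]
      rw [e ξ hgt']
      refine (hconst (w β)).congr_of_eventuallyEq ?_
      filter_upwards [Ioi_mem_nhds hgt'] with η hη
      rw [e η hη]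

/-! ### Waves of the first and the third family -/

/-- `P` is the profile on the whole line of a rarefaction or shock wave of family `i` from `U` to
`M`. -/
structure IsSimpleWave (γ : ℝ) (A : ℝ → ℝ) (i : Fin 3) (P : ℝ → GasState) (U M : GasState)
    (α β : ℝ) : Prop where
  left_physical : U.IsPhysical
  right_physical : M.IsPhysical
  wave : IsRarefactionWave γ A i P U M α β ∨ (α = β ∧ IsShockWave γ A i U M α)
  eq_left : ∀ ξ < α, P ξ = U
  eq_right : ∀ ξ, β < ξ → P ξ = M

variable {P P' : ℝ → GasState} {U M M' : GasState} {α β α' β' : ℝ}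

theorem IsSimpleWave.refl {i j : Fin 3}
    (hij : ∀ W : GasState, charSpeed γ j W.refl = -charSpeed γ i W)
    (hP : IsSimpleWave γ A i P U M α β) :
    IsSimpleWave γ A j (fun ξ => (P (-ξ)).refl) M.refl U.refl (-β) (-α) where
  left_physical := hP.right_physical.refl
  right_physical := hP.left_physical.refl
  wave := by
    rcases hP.wave with hR | ⟨rfl, hS⟩
    · exact Or.inl (hR.refl hij)
    · refine Or.inr ⟨rfl, hS.1.refl, ?_, ?_⟩ <;> rw [hij]
      · linarith [hS.2.2]
      · linarith [hS.2.1]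
  eq_left ξ hξ := by rw [hP.eq_right _ (by linarith)]
  eq_right ξ hξ := by rw [hP.eq_left _ (by linarith)]

theorem IsSimpleWave.le {i : Fin 3} (hP : IsSimpleWave γ A i P U M α β) : α ≤ β := by
  rcases hP.wave with hR | ⟨rfl, -⟩
  exacts [hR.1, le_rfl]

theorem IsSimpleWave.isElementaryWave {i : Fin 3} (hi : i ≠ 1)
    (hP : IsSimpleWave γ A i P U M α β) : IsElementaryWave γ A i P U M α β := by
  rcases hP.wave with hR | ⟨rfl, hS⟩
  · exact Or.inl ⟨hi, hR⟩
  · exact Or.inr (Or.inl ⟨hi, rfl, hS⟩)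

/-- A 1-wave stays strictly left of the contact that follows: `λ₁ < v` at the edge of a rarefaction,
and behind a shock the relative velocity `a²/u₁` is positive. -/
theorem IsSimpleWave.lt_right_v (h : IsGasLaw γ A) (hP : IsSimpleWave γ A 0 P U M α β) :
    β < M.v := by
  rcases hP.wave with hR | ⟨rfl, hS⟩
  · rw [← hR.right_eq.2]
    exact charSpeed_zero_lt h hP.right_physical
  · have hs := IsShockWave.speed_mem h hP.left_physical hP.right_physical hS
    obtain ⟨h1, -, h3, -⟩ := IsShockWave.rest_frame h hP.left_physical hP.right_physical hS
    have h4 : 0 < relVel α M.v := by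
      rw [h3]
      have := h.soundSpeed_pos
      have := shockVel_pos h (one_pos.trans h1)
      positivity
    have h5 := one_sub_mul_pos hs hP.right_physical.2.1
    rw [relVel, div_pos_iff_of_pos_right h5] at h4
    linarith

theorem log_density_rareProfile {ξ : ℝ} (hU : U.IsPhysical) :
    Real.log ((rareProfile γ U ξ).ρ / U.ρ) = -(γ / (2 * soundSpeed γ)) *
      (Real.log (doppler (rareVel γ ξ)) - Real.log (doppler U.v)) := by
  rw [rareProfile, mul_div_cancel_left₀ _ hU.1.ne', Real.log_exp]

theorem IsRarefactionWave.eq_rareProfile_right (h : IsGasLaw γ A)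
    (hR : IsRarefactionWave γ A 0 P U M α β) : M = rareProfile γ U β := by
  rw [← IsRarefactionWave.eq_rareProfile h hR (right_mem_Icc.2 hR.1), hR.2.2.1]

/-- `λ₁` grows through the wave and is increasing in `v`, so `v` grows and, by the Riemann
invariant, the density falls. -/
theorem IsRarefactionWave.density (h : IsGasLaw γ A) (hR : IsRarefactionWave γ A 0 P U M α β) :
    M.ρ / U.ρ ≤ 1 ∧ doppler M.v = doppler U.v * waveFactor γ (M.ρ / U.ρ) := by
  have ha := h.soundSpeed_pos
  have hγ := h.gamma_pos
  have hU := hR.left_eq.1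
  have hM := hR.right_eq.1
  have hl : Real.log (M.ρ / U.ρ) = -(γ / (2 * soundSpeed γ)) *
      (Real.log (doppler M.v) - Real.log (doppler U.v)) := by
    have := log_density_rareProfile (γ := γ) (ξ := β) hU
    rwa [← IsRarefactionWave.eq_rareProfile_right h hR, ← hR.right_eq.2,
      rareVel_charSpeed h hM] at this
  have hle : U.v ≤ M.v := by
    have h1 := hR.1
    rw [← hR.left_eq.2, ← hR.right_eq.2] at h1
    by_contra hlt
    push Not at hlt
    have h2 := one_sub_mul_pos h.soundSpeed_mem hU.2.1
    have h3 := one_sub_mul_pos h.soundSpeed_mem hM.2.1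
    rw [charSpeed_zero, charSpeed_zero, div_le_div_iff₀ h2 h3] at h1
    nlinarith [mul_pos (sub_pos.2 hlt) (one_sub_sq_pos h.soundSpeed_mem)]
  have hdle := Real.log_le_log (doppler_pos hU.2.1) (doppler_le_doppler hM.2.1.2 hle)
  have hz : M.ρ / U.ρ ≤ 1 := by
    rw [← Real.log_nonpos_iff (div_pos hM.1 hU.1).le, hl, neg_mul, neg_nonpos]
    exact mul_nonneg (by positivity) (sub_nonneg.2 hdle)
  refine ⟨hz, ?_⟩
  rw [waveFactor_of_le_one h hz, hl, ← Real.exp_log (doppler_pos hM.2.1)]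
  conv_rhs => rw [← Real.exp_log (doppler_pos hU.2.1), ← Real.exp_add]
  rw [Real.log_exp, Real.log_exp]
  congr 1
  field_simp
  ring

/-- Passing to relative velocities divides both Doppler factors by `doppler s`, which drops out of
the ratio. -/
theorem IsShockWave.doppler_eq (h : IsGasLaw γ A) (hU : U.IsPhysical) (hM : M.IsPhysical) {s : ℝ}
    (hS : IsShockWave γ A 0 U M s) : doppler M.v = doppler U.v * waveFactor γ (M.ρ / U.ρ) := by
  have hs := IsShockWave.speed_mem h hU hM hS
  obtain ⟨h1, h2, h3, -⟩ := IsShockWave.rest_frame h hU hM hS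
  rw [waveFactor_of_one_le h1.le, ← h3, ← h2, relVel, relVel, doppler_velocity_sub hs hM.2.1,
    doppler_velocity_sub hs hU.2.1]
  have := doppler_pos hs
  have := doppler_pos hU.2.1
  field_simp

theorem IsSimpleWave.doppler_eq (h : IsGasLaw γ A) (hP : IsSimpleWave γ A 0 P U M α β) :
    doppler M.v = doppler U.v * waveFactor γ (M.ρ / U.ρ) := by
  rcases hP.wave with hR | ⟨rfl, hS⟩
  · exact (IsRarefactionWave.density h hR).2
  · exact IsShockWave.doppler_eq h hP.left_physical hP.right_physical hS

/-- A 1-wave is determined by its left state and the density behind it. -/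
theorem IsSimpleWave.unique (h : IsGasLaw γ A) (hP : IsSimpleWave γ A 0 P U M α β)
    (hP' : IsSimpleWave γ A 0 P' U M' α' β') (hρ : M.ρ = M'.ρ) :
    M = M' ∧ ∀ ξ, ξ ≠ α → P ξ = P' ξ := by
  have hU := hP.left_physical
  have hM := hP.right_physical
  have hM' := hP'.right_physical
  have hv : M.v = M'.v := doppler_injOn hM.2.1.2 hM'.2.1.2 <| by
    rw [IsSimpleWave.doppler_eq h hP, IsSimpleWave.doppler_eq h hP', hρ]
  -- The density ratio is at most 1 for a rarefaction and greater than 1 for a shock, which rules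
  -- out the mixed cases.
  rcases hP.wave with hR | ⟨rfl, hS⟩ <;> rcases hP'.wave with hR' | ⟨rfl, hS'⟩
  · obtain rfl : α = α' := by rw [← hR.left_eq.2, ← hR'.left_eq.2]
    have hch : charSpeed γ 0 M = charSpeed γ 0 M' := by rw [charSpeed_zero, charSpeed_zero, hv]
    obtain rfl : β = β' := by rw [← hR.right_eq.2, ← hR'.right_eq.2, hch]
    have hMM : M = M' := by
      rw [IsRarefactionWave.eq_rareProfile_right h hR, IsRarefactionWave.eq_rareProfile_right h hR']
    refine ⟨hMM, fun ξ _ => ?_⟩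
    rcases lt_or_ge ξ α with h1 | h1
    · rw [hP.eq_left ξ h1, hP'.eq_left ξ h1]
    rcases lt_or_ge β ξ with h2 | h2
    · rw [hP.eq_right ξ h2, hP'.eq_right ξ h2, hMM]
    · rw [IsRarefactionWave.eq_rareProfile h hR ⟨h1, h2⟩,
        IsRarefactionWave.eq_rareProfile h hR' ⟨h1, h2⟩]
  · have h1 := (IsRarefactionWave.density h hR).1
    have h2 := (IsShockWave.rest_frame h hU hM' hS').1
    rw [hρ] at h1
    exact absurd h2 h1.not_gt
  · have h1 := (IsRarefactionWave.density h hR').1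
    have h2 := (IsShockWave.rest_frame h hU hM hS).1
    rw [hρ] at h2
    exact absurd h2 h1.not_gt
  · have hs := IsShockWave.speed_mem h hU hM hS
    have hs' := IsShockWave.speed_mem h hU hM' hS'
    obtain ⟨-, h2, h3, h4⟩ := IsShockWave.rest_frame h hU hM hS
    obtain ⟨-, h2', -, h4'⟩ := IsShockWave.rest_frame h hU hM' hS'
    -- The density ratio fixes the velocity ahead relative to the shock, and with it the shock
    -- speed.
    obtain rfl : α = α' := by
      rw [hρ, ← h2'] at h2
      have k1 := one_sub_mul_pos hs hU.2.1
      have k2 := one_sub_mul_pos hs' hU.2.1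
      rw [relVel, relVel, div_eq_div_iff k1.ne' k2.ne'] at h2
      have : (α' - α) * (1 - U.v ^ 2) = 0 := by linear_combination h2
      rcases mul_eq_zero.1 this with h5 | h5
      · linarith
      · exact absurd h5 (one_sub_sq_pos hU.2.1).ne'
    have hlt := IsSimpleWave.lt_right_v h hP
    have hMM : M = M' := by
      refine GasState.ext_of_conserved_zero h hM hM' hρ hv ?_
      rw [← h4', ← hv] at h4
      exact mul_right_cancel₀ (sub_pos.2 hlt).ne' h4
    refine ⟨hMM, fun ξ hξ => ?_⟩
    rcases lt_or_gt_of_ne hξ with h1 | h1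
    · rw [hP.eq_left ξ h1, hP'.eq_left ξ h1]
    · rw [hP.eq_right ξ h1, hP'.eq_right ξ h1, hMM]

/-- There is a 1-wave to any prescribed density. -/
theorem exists_isSimpleWave (h : IsGasLaw γ A) (hU : U.IsPhysical) {ρ : ℝ} (hρ : 0 < ρ) :
    ∃ (P : ℝ → GasState) (M : GasState) (α β : ℝ), M.ρ = ρ ∧ IsSimpleWave γ A 0 P U M α β ∧
      IsSelfSimilarSolution γ A P := by
  have ha := h.soundSpeed_pos
  have hγ := h.gamma_pos
  rcases lt_or_ge 1 (ρ / U.ρ) with hz | hz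
  · obtain ⟨M, s, hM, hMρ, hS⟩ := exists_isShockWave h hU hz
    refine ⟨fun ξ => if ξ < s then U else M, M, s, s, ?_,
      ⟨hU, hM, Or.inr ⟨rfl, hS⟩, fun ξ hξ => if_pos hξ, fun ξ hξ => if_neg hξ.not_gt⟩,
      (IsSelfSimilarSolution.const hU).glue (IsSelfSimilarSolution.const hM) hS.1⟩
    rw [hMρ, mul_div_cancel₀ _ hU.1.ne']
  -- `q` is the Doppler factor that the wave must reach, `v` the velocity with that factor.
  · obtain ⟨q, hq⟩ : ∃ q, q = doppler U.v * waveFactor γ (ρ / U.ρ) := ⟨_, rfl⟩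
    have hqU : doppler U.v ≤ q := by
      rw [hq]
      refine le_mul_of_one_le_right (doppler_pos hU.2.1).le ?_
      rw [← waveFactor_one h]
      exact (waveFactor_strictAntiOn h).antitoneOn (div_pos hρ hU.1) (mem_Ioi.2 one_pos) hz
    have hq0 : 0 < q := (doppler_pos hU.2.1).trans_le hqU
    obtain ⟨v, hv⟩ : ∃ v, v = (q - 1) / (q + 1) := ⟨_, rfl⟩
    have hvm : -1 < v ∧ v < 1 := by
      rw [hv, lt_div_iff₀ (by linarith), div_lt_one (by linarith)]
      constructor <;> linarith
    have hdv : doppler v = q := by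
      rw [doppler, hv]
      field_simp
      ring
    have hUv : U.v ≤ v := by
      by_contra hlt
      push Not at hlt
      have := doppler_lt_doppler hU.2.1.2 hlt
      linarith
    -- An auxiliary state that only supplies the edge `β = λ₁(W)`. The wave ends at `rareProfile γ U
    -- β`, whose density is shown to be `ρ` from the invariant.
    set W : GasState := ⟨ρ, v, U.S⟩
    have hW : W.IsPhysical := ⟨hρ, hvm, hU.2.2⟩
    have hle : charSpeed γ 0 U ≤ charSpeed γ 0 W := by
      have h2 := one_sub_mul_pos h.soundSpeed_mem hU.2.1
      have h3 := one_sub_mul_pos h.soundSpeed_mem hW.2.1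
      rw [charSpeed_zero, charSpeed_zero, div_le_div_iff₀ h2 h3]
      have h4 : U.v ≤ W.v := hUv
      nlinarith [mul_nonneg (sub_nonneg.2 h4) (one_sub_sq_pos h.soundSpeed_mem).le]
    have hR := isRarefactionWave_rareProfile h hU hle (charSpeed_zero_mem h hW).2
    set β := charSpeed γ 0 W
    have hcl : ∀ ξ ∈ Icc (charSpeed γ 0 U) β, max (charSpeed γ 0 U) (min β ξ) = ξ := fun ξ hξ => by
      rw [min_eq_right hξ.2, max_eq_right hξ.1]
    refine ⟨fun ξ => rareProfile γ U (max (charSpeed γ 0 U) (min β ξ)), rareProfile γ U β,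
      charSpeed γ 0 U, β, ?_, ⟨hU, hR.right_eq.1, Or.inl (hR.congr fun ξ hξ => ?_),
      fun ξ hξ => ?_, fun ξ hξ => ?_⟩, IsRarefactionWave.isSelfSimilarSolution h hR⟩
    · have hd := log_density_rareProfile (γ := γ) (ξ := β) hU
      rw [rareVel_charSpeed h hW] at hd
      change Real.log ((rareProfile γ U β).ρ / U.ρ) = -(γ / (2 * soundSpeed γ)) *
        (Real.log (doppler v) - _) at hd
      rw [hdv, hq, waveFactor_of_le_one h hz, Real.log_mul (doppler_pos hU.2.1).ne'
        (Real.exp_pos _).ne', Real.log_exp] at hd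
      have e : Real.log ((rareProfile γ U β).ρ / U.ρ) = Real.log (ρ / U.ρ) := by
        rw [hd]
        field_simp
        ring
      have := Real.log_injOn_pos (div_pos hR.right_eq.1.1 hU.1) (div_pos hρ hU.1) e
      exact (div_left_inj' hU.1.ne').1 this
    · simp only [hcl ξ hξ]
    · have : max (charSpeed γ 0 U) (min β ξ) = charSpeed γ 0 U :=
        max_eq_left ((min_le_right _ _).trans hξ.le)
      simp only [this, rareProfile_charSpeed h hU]
    · have : max (charSpeed γ 0 U) (min β ξ) = β := by
        rw [min_eq_left hξ.le, max_eq_right hle]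
      simp only [this]

/-! The mirror images for the third family. -/

theorem IsSimpleWave.left_v_lt (h : IsGasLaw γ A) (hP : IsSimpleWave γ A 2 P U M α β) :
    U.v < α := by
  have := IsSimpleWave.lt_right_v h (hP.refl charSpeed_zero_refl)
  simpa using this

/-- Reflection inverts Doppler factors and exchanges sides; the state ahead of a 3-wave is the right
one, so the density ratio is `U.ρ / M.ρ`. -/
theorem IsSimpleWave.doppler_eq_two (h : IsGasLaw γ A) (hP : IsSimpleWave γ A 2 P U M α β) :
    doppler M.v = doppler U.v * waveFactor γ (U.ρ / M.ρ) := by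
  have := IsSimpleWave.doppler_eq h (hP.refl charSpeed_zero_refl)
  simp only [GasState.refl_v, GasState.refl_ρ, doppler_neg] at this
  have h1 := doppler_pos hP.left_physical.2.1
  have h2 := doppler_pos hP.right_physical.2.1
  field_simp at this
  linarith

theorem IsSimpleWave.unique_two (h : IsGasLaw γ A) {U' : GasState}
    (hP : IsSimpleWave γ A 2 P U M α β) (hP' : IsSimpleWave γ A 2 P' U' M α' β')
    (hρ : U.ρ = U'.ρ) : U = U' ∧ ∀ ξ, ξ ≠ β → P ξ = P' ξ := by
  obtain ⟨h1, h2⟩ := IsSimpleWave.unique h (hP.refl charSpeed_zero_refl)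
    (hP'.refl charSpeed_zero_refl) (by simpa using hρ)
  refine ⟨by simpa using congrArg GasState.refl h1, fun ξ hξ => ?_⟩
  have := congrArg GasState.refl (h2 (-ξ) (by simpa using hξ))
  simpa using this

theorem exists_isSimpleWave_two (h : IsGasLaw γ A) (hM : M.IsPhysical) {ρ : ℝ} (hρ : 0 < ρ) :
    ∃ (P : ℝ → GasState) (U : GasState) (α β : ℝ), U.ρ = ρ ∧ IsSimpleWave γ A 2 P U M α β ∧
      IsSelfSimilarSolution γ A P := by
  obtain ⟨P, U, α, β, h1, h2, h3⟩ := exists_isSimpleWave h hM.refl hρ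
  have h4 := h2.refl charSpeed_two_refl
  rw [GasState.refl_refl] at h4
  exact ⟨_, U.refl, _, _, h1, h4, h3.refl⟩

end SimpleWave

/-! ### Reduction of arbitrary wave fans to three waves; solution of the Riemann problem. -/

section Uniqueness

variable {γ : ℝ} {A : ℝ → ℝ}

/-! ### Contact waves and waves of strength zero -/

theorem relVel_self (s : ℝ) : relVel s s = 0 := by simp [relVel]

/-- At relative velocity zero the particle and energy fluxes vanish and only equality of pressure
remains; `S` may jump freely. `IsContactWave.eq` is the converse. -/
theorem rankineHugoniot_contact (h : IsGasLaw γ A) {U M : GasState} (hU : U.IsPhysical)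
    (hM : M.IsPhysical) (hv : U.v = M.v) (hρ : U.ρ = M.ρ) : RankineHugoniot γ A U M U.v := by
  rw [rankineHugoniot_iff h hU hM hU.2.1, ← hv, ← hρ]
  simp

theorem IsContactWave.eq (h : IsGasLaw γ A) {U M : GasState} (hU : U.IsPhysical)
    (hM : M.IsPhysical) {s : ℝ} (hc : IsContactWave γ A U M s) :
    s = U.v ∧ U.v = M.v ∧ U.ρ = M.ρ := by
  obtain ⟨hR, h1, h2⟩ := hc
  rw [charSpeed_one] at h1 h2
  refine ⟨h1, h1 ▸ h2, ?_⟩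
  rw [rankineHugoniot_iff h hU hM (by rw [h1]; exact hU.2.1), ← h1, ← h2, relVel_self] at hR
  have := hR.2.1
  have ha := h.soundSpeed_pos
  simp only [ne_eq, OfNat.ofNat_ne_zero, not_false_eq_true, zero_pow, sub_zero, div_one,
    zero_add] at this
  exact (mul_right_cancel₀ (by positivity) this).symm

/-- An absent wave is represented as a rarefaction of zero width at `λᵢ(U)`. -/
theorem isSimpleWave_const {i : Fin 3} {U : GasState} (hU : U.IsPhysical) :
    IsSimpleWave γ A i (fun _ => U) U U (charSpeed γ i U) (charSpeed γ i U) := by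
  refine ⟨hU, hU, Or.inl ⟨le_rfl, rfl, rfl, fun ξ hξ => ⟨hU, ?_⟩, continuousOn_const,
    continuousOn_const, continuousOn_const, fun ξ hξ => ?_⟩, fun _ _ => rfl, fun _ _ => rfl⟩
  · exact le_antisymm hξ.1 hξ.2
  · exact absurd (hξ.1.trans hξ.2) (lt_irrefl _)

theorem IsShockWave.isSimpleWave {i : Fin 3} {U M : GasState} {s : ℝ} (hU : U.IsPhysical)
    (hM : M.IsPhysical) (hS : IsShockWave γ A i U M s) :
    IsSimpleWave γ A i (fun ξ => if ξ < s then U else M) U M s s :=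
  ⟨hU, hM, Or.inr ⟨rfl, hS⟩, fun _ hξ => if_pos hξ, fun _ hξ => if_neg hξ.not_gt⟩

theorem IsShockWave.irrefl {i : Fin 3} {U : GasState} {s : ℝ} (hS : IsShockWave γ A i U U s) :
    False :=
  absurd (hS.2.1.trans hS.2.2) (lt_irrefl _)

theorem IsElementaryWave.le {i : Fin 3} {w : ℝ → GasState} {U M : GasState} {α β : ℝ}
    (hw : IsElementaryWave γ A i w U M α β) : α ≤ β := by
  rcases hw with ⟨-, hR⟩ | ⟨-, rfl, -⟩ | ⟨-, rfl, -⟩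
  exacts [hR.1, le_rfl, le_rfl]

/-- The bound on the position excludes 1-waves to the right of `λ₁(U)`; `IsElementaryWave.two`
similarly excludes 3-waves at or left of `U.v`. -/
theorem IsElementaryWave.zero {w : ℝ → GasState} {U M : GasState} {α β : ℝ}
    (hw : IsElementaryWave γ A 0 w U M α β) :
    α ≤ charSpeed γ 0 U ∧ (IsRarefactionWave γ A 0 w U M α β ∨
      (α = β ∧ IsShockWave γ A 0 U M α)) := by
  rcases hw with ⟨-, hR⟩ | ⟨-, rfl, hS⟩ | ⟨h1, -⟩
  · exact ⟨hR.left_eq.2.ge, Or.inl hR⟩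
  · exact ⟨hS.2.2.le, Or.inr ⟨rfl, hS⟩⟩
  · exact absurd h1 (by decide)

theorem IsElementaryWave.one {w : ℝ → GasState} {U M : GasState} {α β : ℝ}
    (hw : IsElementaryWave γ A 1 w U M α β) : α = β ∧ IsContactWave γ A U M α := by
  rcases hw with ⟨h1, -⟩ | ⟨h1, -⟩ | ⟨-, h1⟩
  exacts [absurd rfl h1, absurd rfl h1, h1]

theorem IsElementaryWave.two (h : IsGasLaw γ A) {w : ℝ → GasState} {U M : GasState} {α β : ℝ}
    (hU : U.IsPhysical) (hM : M.IsPhysical) (hw : IsElementaryWave γ A 2 w U M α β) :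
    U.v < α ∧ (IsRarefactionWave γ A 2 w U M α β ∨ (α = β ∧ IsShockWave γ A 2 U M α)) := by
  rcases hw with ⟨-, hR⟩ | ⟨-, rfl, hS⟩ | ⟨h1, -⟩
  · refine ⟨?_, Or.inl hR⟩
    rw [← hR.left_eq.2]
    exact lt_charSpeed_two h hU
  · exact ⟨IsSimpleWave.left_v_lt h (IsShockWave.isSimpleWave hU hM hS), Or.inr ⟨rfl, hS⟩⟩
  · exact absurd h1 (by decide)

theorem IsRarefactionWave.trans_two (h : IsGasLaw γ A) {w : ℝ → GasState} {U V M : GasState}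
    {α β α' β' : ℝ} (h₁ : IsRarefactionWave γ A 2 w U V α β)
    (h₂ : IsRarefactionWave γ A 2 w V M α' β') : IsRarefactionWave γ A 2 w U M α β' := by
  simpa using (IsRarefactionWave.trans h h₂.refl_two h₁.refl_two).refl_zero

/-- A rarefaction wave followed by the profile of a rarefaction wave of the same family. -/
theorem IsRarefactionWave.append {i : Fin 3} {w P : ℝ → GasState} {U V M : GasState}
    {α β α' β' : ℝ}
    (htrans : ∀ Q : ℝ → GasState, IsRarefactionWave γ A i Q U V α β →
      IsRarefactionWave γ A i Q V M α' β' → IsRarefactionWave γ A i Q U M α β')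
    (h₁ : IsRarefactionWave γ A i w U V α β) (hP : IsSimpleWave γ A i P V M α' β')
    (h₂ : IsRarefactionWave γ A i P V M α' β') :
    IsSimpleWave γ A i (fun ξ => if ξ < α then U else if ξ ≤ β then w ξ else P ξ) U M α β' := by
  obtain rfl : β = α' := by rw [← h₁.right_eq.2, ← h₂.left_eq.2]
  refine ⟨h₁.left_eq.1, h₂.right_eq.1, Or.inl (htrans _ (h₁.congr fun ξ hξ => ?_)
    (h₂.congr fun ξ hξ => ?_)), fun ξ hξ => if_pos hξ, fun ξ hξ => ?_⟩
  · rw [if_neg hξ.1.not_gt, if_pos hξ.2]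
  · rw [if_neg (h₁.1.trans hξ.1).not_gt]
    rcases hξ.1.eq_or_lt with rfl | hlt
    · rw [if_pos le_rfl, h₁.2.2.1, h₂.2.1]
    · rw [if_neg hlt.not_ge]
  · have h3 : β < ξ := h₂.1.trans_lt hξ
    rw [if_neg (h₁.1.trans_lt h3).not_gt, if_neg h3.not_ge, hP.eq_right ξ hξ]

/-! ### Sequences of waves -/

/-- To the right of `b` the profile `w` starts with the state `U`, ends with the state `UR`, and
consists of finitely many constant states that are separated by elementary waves. -/
inductive WaveChain (γ : ℝ) (A : ℝ → ℝ) (w : ℝ → GasState) : GasState → ℝ → GasState → Prop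
  | nil {U : GasState} {b : ℝ} (hU : U.IsPhysical) (hw : ∀ ξ, b < ξ → w ξ = U) :
      WaveChain γ A w U b U
  | cons {U V UR : GasState} {b α β : ℝ} (i : Fin 3) (hU : U.IsPhysical) (hb : b ≤ α)
      (hw : ∀ ξ, b < ξ → ξ < α → w ξ = U) (hwave : IsElementaryWave γ A i w U V α β)
      (hc : WaveChain γ A w V β UR) : WaveChain γ A w U b UR

variable {w : ℝ → GasState} {U UL UR : GasState} {b : ℝ}

theorem WaveChain.physical (hc : WaveChain γ A w U b UR) : U.IsPhysical := by
  cases hc with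
  | nil hU => exact hU
  | cons i hU => exact hU

/-- Induction from the last state backwards; `b` is any position between the sectors before and
after the state `j`. -/
theorem IsWaveFan.waveChain {N : ℕ} {fam : Fin N → Fin 3} {V : Fin (N + 1) → GasState}
    {α β : Fin N → ℝ} (hw : IsWaveFan γ A UL UR w N fam V α β) (j : Fin (N + 1)) :
    ∀ b, (∀ k : Fin N, k.castSucc < j → β k ≤ b) → (∀ k : Fin N, j ≤ k.castSucc → b ≤ α k) →
      WaveChain γ A w (V j) b UR := by
  obtain ⟨-, hlast, hphys, hwave, hord, hconst⟩ := hw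
  have hle : ∀ k, α k ≤ β k := fun k => (hwave k).le
  induction j using Fin.reverseInduction with
  | last =>
    intro b h1 _
    rw [hlast]
    refine .nil (hlast ▸ hphys _) fun ξ hξ => ?_
    rw [← hlast]
    exact hconst _ ξ (fun k hk => (h1 k hk).trans_lt hξ) fun k hk =>
      absurd hk (Fin.castSucc_lt_last k).not_ge
  | cast j ih =>
    intro b h1 h2
    refine .cons (fam j) (hphys _) (h2 j le_rfl) (fun ξ hξ hξ' => ?_) (hwave j)
      (ih (β j) (fun k hk => ?_) fun k hk => ?_)
    · refine hconst _ ξ (fun k hk => (h1 k hk).trans_lt hξ) fun k hk => ?_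
      rcases (Fin.castSucc_le_castSucc_iff.1 hk).eq_or_lt with rfl | hlt
      · exact hξ'
      · exact hξ'.trans_le ((hle j).trans (hord j k hlt))
    · rcases (Fin.castSucc_lt_succ_iff.1 hk).eq_or_lt with rfl | hlt
      · exact le_rfl
      · exact (hord k j hlt).trans (hle j)
    · exact hord j k (Fin.succ_le_castSucc_iff.1 hk)

/-- Behind the contact wave there is at most one wave of the third family. -/
theorem WaveChain.three_wave (h : IsGasLaw γ A) (hc : WaveChain γ A w U b UR) (hb : U.v < b) :
    ∃ (Q : ℝ → GasState) (α β : ℝ), IsSimpleWave γ A 2 Q U UR α β ∧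
      -- An absent wave is recorded at `λ₃(U)`, which may lie left of `b`; the position bound is
      -- claimed only otherwise.
      ((U = UR ∧ ∀ ξ, Q ξ = U) ∨ b ≤ α) ∧ {ξ | b < ξ ∧ w ξ ≠ Q ξ}.Finite := by
  induction hc with
  | @nil U b hU hw =>
    refine ⟨_, _, _, isSimpleWave_const hU, Or.inl ⟨rfl, fun _ => rfl⟩, ?_⟩
    exact finite_empty.subset fun ξ hξ => hξ.2 (hw ξ hξ.1)
  | @cons U V UR b α β i hU hbα hw hwave hc ih =>
    have hV := hc.physical
    match i with
    | 0 => exact absurd (hwave.zero.1.trans_lt (charSpeed_zero_lt h hU)) (by linarith)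
    | 1 =>
      have := (IsContactWave.eq h hU hV hwave.one.2).1
      exact absurd hb (by linarith)
    | 2 =>
      rcases (IsElementaryWave.two h hU hV hwave).2 with hR | ⟨rfl, hS⟩
      · have hVβ := hR.right_eq.2
        obtain ⟨Q, α', β', hQ, hor, hfin⟩ := ih (by rw [← hVβ]; exact lt_charSpeed_two h hV)
        -- A following rarefaction is merged. A following shock would need speed below `λ₃(V) = β`,
        -- but it starts no earlier than `β`.
        rcases hQ.wave with hR' | ⟨rfl, hS'⟩
        · refine ⟨_, _, _, hR.append (fun _ => IsRarefactionWave.trans_two h) hQ hR', Or.inr hbα,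
            (hfin.insert α).subset fun ξ hξ => ?_⟩
          rw [mem_insert_iff, or_iff_not_imp_left]
          intro hne
          rcases lt_or_gt_of_ne hne with h1 | h1
          · exact absurd (by rw [if_pos h1, hw ξ hξ.1 h1]) hξ.2
          · have h2 := hξ.2
            rw [if_neg h1.not_gt] at h2
            split_ifs at h2 with h3
            · exact absurd rfl h2
            · exact ⟨not_le.1 h3, h2⟩
        · rcases hor with ⟨rfl, -⟩ | hle
          · exact hS'.irrefl.elim
          · have := hS'.2.2
            linarith
      · have hlt := hS.2.1
        obtain ⟨Q, α', β', hQ, hor, hfin⟩ := ih ((lt_charSpeed_two h hV).trans hlt)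
        -- After a 3-shock `λ₃(V) < α`, whereas a further wave would have to start at or below
        -- `λ₃(V)` and not before `α`.
        have hVR : V = UR := by
          rcases hor with ⟨rfl, -⟩ | hle
          · rfl
          rcases hQ.wave with hR' | ⟨rfl, hS'⟩
          · have := hR'.left_eq.2
            linarith
          · have := hS'.2.2
            linarith
        subst hVR
        refine ⟨_, _, _, IsShockWave.isSimpleWave hU hV hS, Or.inr hbα,
          ((hfin.insert α).subset fun ξ hξ => ?_)⟩
        rw [mem_insert_iff, or_iff_not_imp_left]
        intro hne
        rcases lt_or_gt_of_ne hne with h1 | h1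
        · exact absurd (by rw [if_pos h1, hw ξ hξ.1 h1]) hξ.2
        · have h2 := hξ.2
          rw [if_neg h1.not_gt] at h2
          refine ⟨h1, ?_⟩
          have hβ' : β' < ξ := by
            rcases hQ.wave with hR' | ⟨rfl, hS'⟩
            · have := hR'.right_eq.2
              linarith
            · exact hS'.irrefl.elim
          rwa [hQ.eq_right ξ hβ']

/-- Behind the wave of the first family there are a contact wave and at most one wave of the third
family. -/
theorem WaveChain.contact (h : IsGasLaw γ A) (hc : WaveChain γ A w U b UR)
    (hb : charSpeed γ 0 U < b) :
    ∃ (M : GasState) (Q : ℝ → GasState) (α β : ℝ), IsSimpleWave γ A 2 Q M UR α β ∧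
      U.ρ = M.ρ ∧ U.v = M.v ∧
      {ξ | b < ξ ∧ w ξ ≠ if ξ < U.v then U else Q ξ}.Finite := by
  induction hc with
  | @nil U b hU hw =>
    refine ⟨_, _, _, _, isSimpleWave_const hU, rfl, rfl, ?_⟩
    exact finite_empty.subset fun ξ hξ => hξ.2 (by rw [ite_self]; exact hw ξ hξ.1)
  | @cons U V UR b α β i hU hbα hw hwave hc ih =>
    have hV := hc.physical
    match i with
    | 0 => exact absurd hwave.zero.1 (by linarith)
    | 1 =>
      obtain ⟨rfl, hcw⟩ := hwave.one
      obtain ⟨h1, h2, h3⟩ := IsContactWave.eq h hU hV hcw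
      -- Further contacts are absorbed by the induction: they have the same speed and preserve `ρ`
      -- and `v`.
      obtain ⟨M, Q, α', β', hQ, hρ, hv, hfin⟩ := ih (by
        rw [h1, h2]
        exact charSpeed_zero_lt h hV)
      refine ⟨M, Q, α', β', hQ, h3.trans hρ, h2.trans hv, (hfin.insert α).subset fun ξ hξ => ?_⟩
      rw [mem_insert_iff, or_iff_not_imp_left]
      intro hne
      rcases lt_or_gt_of_ne hne with h4 | h4
      · exact absurd (by rw [if_pos (by linarith), hw ξ hξ.1 h4]) hξ.2
      · have h5 := hξ.2
        rw [if_neg (by linarith)] at h5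
        refine ⟨h4, ?_⟩
        rwa [if_neg (by linarith)]
    | 2 =>
      have hUα := (IsElementaryWave.two h hU hV hwave).1
      -- No contact precedes this 3-wave. The chain is restarted strictly between `U.v` and `α`, or
      -- at `b` if that is later, so that `three_wave` applies.
      obtain ⟨b', hb'⟩ : ∃ b', b' = max b ((U.v + α) / 2) := ⟨_, rfl⟩
      have h1 : b ≤ b' := hb' ▸ le_max_left _ _
      have h2 : U.v < b' := lt_of_lt_of_le (by linarith) (hb' ▸ le_max_right _ _)
      have h3 : b' ≤ α := hb' ▸ max_le hbα (by linarith)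
      have hc' : WaveChain γ A w U b' UR :=
        .cons 2 hU h3 (fun ξ hξ hξ' => hw ξ (h1.trans_lt hξ) hξ') hwave hc
      obtain ⟨Q, α', β', hQ, hor, hfin⟩ := WaveChain.three_wave h hc' h2
      have hQU : ∀ ξ < b', Q ξ = U := fun ξ hξ => by
        rcases hor with ⟨-, h4⟩ | h4
        · exact h4 ξ
        · exact hQ.eq_left ξ (hξ.trans_le h4)
      refine ⟨U, Q, α', β', hQ, rfl, rfl, (hfin.insert b').subset fun ξ hξ => ?_⟩
      rw [mem_insert_iff, or_iff_not_imp_left]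
      intro hne
      rcases lt_or_gt_of_ne hne with h4 | h4
      · exact absurd (by rw [hQU ξ h4, ite_self, hw ξ hξ.1 (h4.trans_le h3)]) hξ.2
      · have h5 := hξ.2
        rw [if_neg (by linarith)] at h5
        exact ⟨h4, h5⟩

/-- A sequence of waves consists of a wave of the first family, a contact wave, and a wave of the
third family. -/
theorem WaveChain.structure (h : IsGasLaw γ A) (hc : WaveChain γ A w U b UR) :
    ∃ (M M' : GasState) (P Q : ℝ → GasState) (α β α' β' : ℝ), IsSimpleWave γ A 0 P U M α β ∧
      IsSimpleWave γ A 2 Q M' UR α' β' ∧ M.ρ = M'.ρ ∧ M.v = M'.v ∧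
      ((U = M ∧ ∀ ξ, P ξ = U) ∨ b ≤ α) ∧
      {ξ | b < ξ ∧ w ξ ≠ if ξ < M.v then P ξ else Q ξ}.Finite := by
  induction hc with
  | @nil U b hU hw =>
    refine ⟨_, _, _, _, _, _, _, _, isSimpleWave_const hU, isSimpleWave_const hU, rfl, rfl,
      Or.inl ⟨rfl, fun _ => rfl⟩, ?_⟩
    exact finite_empty.subset fun ξ hξ => hξ.2 (by rw [ite_self]; exact hw ξ hξ.1)
  | @cons U V UR b α β i hU hbα hw hwave hc ih =>
    have hV := hc.physical
    have hlt := charSpeed_zero_lt h hU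
    -- A first wave at or beyond `U.v` means that the 1-wave is absent; the chain restarts beyond
    -- `λ₁(U)`. A first wave before `U.v` can only be of the first family.
    by_cases hUα : U.v ≤ α
    · obtain ⟨b', hb'⟩ : ∃ b', b' = max b ((charSpeed γ 0 U + U.v) / 2) := ⟨_, rfl⟩
      have h1 : b ≤ b' := hb' ▸ le_max_left _ _
      have h2 : charSpeed γ 0 U < b' := lt_of_lt_of_le (by linarith) (hb' ▸ le_max_right _ _)
      have h3 : b' ≤ α := hb' ▸ max_le hbα (by linarith)
      have hc' : WaveChain γ A w U b' UR :=
        .cons i hU h3 (fun ξ hξ hξ' => hw ξ (h1.trans_lt hξ) hξ') hwave hc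
      obtain ⟨M, Q, α', β', hQ, hρ, hv, hfin⟩ := WaveChain.contact h hc' h2
      refine ⟨U, M, _, Q, _, _, α', β', isSimpleWave_const hU, hQ, hρ, hv,
        Or.inl ⟨rfl, fun _ => rfl⟩, (hfin.insert b').subset fun ξ hξ => ?_⟩
      rw [mem_insert_iff, or_iff_not_imp_left]
      intro hne
      rcases lt_or_gt_of_ne hne with h4 | h4
      · have h5 : ξ < U.v := by
          rcases le_total b ((charSpeed γ 0 U + U.v) / 2) with h6 | h6
          · rw [max_eq_right h6] at hb'
            linarith
          · rw [max_eq_left h6] at hb'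
            exact absurd hξ.1 (by linarith)
        exact absurd (by rw [if_pos h5, hw ξ hξ.1 (h4.trans_le h3)]) hξ.2
      · exact ⟨h4, hξ.2⟩
    · push Not at hUα
      match i with
      | 1 =>
        have := (IsContactWave.eq h hU hV hwave.one.2).1
        exact absurd hUα (by linarith)
      | 2 => exact absurd (IsElementaryWave.two h hU hV hwave).1 (by linarith)
      | 0 =>
        rcases hwave.zero.2 with hR | ⟨rfl, hS⟩
        · have hVβ := hR.right_eq.2
          -- As for the third family, the tail begins with a 1-rarefaction, which is merged, or a
          -- 1-shock, which the Lax condition excludes.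
          obtain ⟨M, M', P, Q, α₁, β₁, α₂, β₂, hP, hQ, hρ, hv, hor, hfin⟩ := ih
          rcases hP.wave with hR' | ⟨rfl, hS'⟩
          · have hβM := IsSimpleWave.lt_right_v h hP
            have hβα : β = α₁ := by rw [← hVβ, hR'.left_eq.2]
            have h1 := hR'.1
            have h2 := hR.1
            refine ⟨M, M', _, Q, _, _, _, _,
              hR.append (fun _ => IsRarefactionWave.trans h) hP hR', hQ, hρ, hv, Or.inr hbα,
              (hfin.insert α).subset fun ξ hξ => ?_⟩
            rw [mem_insert_iff, or_iff_not_imp_left]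
            intro hne
            rcases lt_or_gt_of_ne hne with h3 | h3
            · exact absurd (by rw [if_pos (by linarith), if_pos h3, hw ξ hξ.1 h3]) hξ.2
            · have h4 := hξ.2
              rw [if_neg h3.not_gt] at h4
              by_cases h5 : ξ ≤ β
              · rw [if_pos (by linarith), if_pos h5] at h4
                exact absurd rfl h4
              · rw [if_neg h5] at h4
                exact ⟨not_le.1 h5, h4⟩
          · rcases hor with ⟨rfl, -⟩ | hle
            · exact hS'.irrefl.elim
            · have := hS'.2.2
              linarith
        · obtain ⟨M', Q, α', β', hQ, hρ, hv, hfin⟩ := WaveChain.contact h hc hS.2.1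
          have hP := IsShockWave.isSimpleWave hU hV hS
          have hαV := IsSimpleWave.lt_right_v h hP
          refine ⟨V, M', _, Q, _, _, _, _, hP, hQ, hρ, hv, Or.inr hbα,
            (hfin.insert α).subset fun ξ hξ => ?_⟩
          rw [mem_insert_iff, or_iff_not_imp_left]
          intro hne
          rcases lt_or_gt_of_ne hne with h3 | h3
          · exact absurd (by rw [if_pos (by linarith), if_pos h3, hw ξ hξ.1 h3]) hξ.2
          · have h4 := hξ.2
            rw [if_neg h3.not_gt] at h4
            exact ⟨h3, h4⟩

/-- A centered solution consists of a wave of the first family, a contact wave, and a wave of the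
third family. -/
theorem IsCenteredSolution.structure (h : IsGasLaw γ A) (hw : IsCenteredSolution γ A UL UR w) :
    ∃ (M M' : GasState) (P Q : ℝ → GasState) (α β α' β' : ℝ), IsSimpleWave γ A 0 P UL M α β ∧
      IsSimpleWave γ A 2 Q M' UR α' β' ∧ M.ρ = M'.ρ ∧ M.v = M'.v ∧
      {ξ | w ξ ≠ if ξ < M.v then P ξ else Q ξ}.Finite := by
  obtain ⟨N, fam, V, α, β, hfan⟩ := hw
  obtain ⟨b₀, hb₀⟩ := (finite_range α).bddBelow
  -- The starting point lies left of all sectors; taking it at most `-1` also puts it left of the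
  -- contact speed `M.v`.
  have hc := hfan.waveChain 0 (min b₀ (-1)) (fun k hk => absurd hk (Fin.not_lt_zero _))
    fun k _ => (min_le_left _ _).trans (hb₀ (mem_range_self k))
  rw [hfan.1] at hc
  obtain ⟨M, M', P, Q, α₁, β₁, α₂, β₂, hP, hQ, hρ, hv, hor, hfin⟩ := WaveChain.structure h hc
  refine ⟨M, M', P, Q, α₁, β₁, α₂, β₂, hP, hQ, hρ, hv,
    (hfin.insert (min b₀ (-1))).subset fun ξ hξ => ?_⟩
  rw [mem_insert_iff, or_iff_not_imp_left]
  intro hne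
  rcases lt_or_gt_of_ne hne with h1 | h1
  · have h2 : w ξ = UL := by
      rw [← hfan.1]
      exact hfan.2.2.2.2.2 0 ξ (fun k hk => absurd hk (Fin.not_lt_zero _)) fun k _ =>
        h1.trans_le ((min_le_left _ _).trans (hb₀ (mem_range_self k)))
    have h3 : P ξ = UL := by
      rcases hor with ⟨-, h4⟩ | h4
      · exact h4 ξ
      · exact hP.eq_left ξ (h1.trans_le h4)
    have h4 : ξ < M.v := (h1.trans_le (min_le_right _ _)).trans hP.right_physical.2.1.1
    exact absurd (by rw [if_pos h4, h2, h3]) hξ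
  · exact ⟨h1, hξ⟩

/-- The Doppler ratios of the two outer waves multiply, as the contact changes neither velocity nor
density. -/
theorem middle_density_eq (h : IsGasLaw γ A) {M M' : GasState} {P Q : ℝ → GasState}
    {α β α' β' : ℝ} (hP : IsSimpleWave γ A 0 P UL M α β) (hQ : IsSimpleWave γ A 2 Q M' UR α' β')
    (hρ : M.ρ = M'.ρ) (hv : M.v = M'.v) :
    waveFactor γ (M.ρ / UL.ρ) * waveFactor γ (M.ρ / UR.ρ) = doppler UR.v / doppler UL.v := by
  have h1 := IsSimpleWave.doppler_eq h hP
  have h2 := IsSimpleWave.doppler_eq_two h hQ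
  rw [eq_div_iff (doppler_pos hP.left_physical.2.1).ne', h2, ← hv, h1, hρ]
  ring

/-- Uniqueness of the solution of the Riemann problem. -/
theorem IsCenteredSolution.unique (h : IsGasLaw γ A) (hw : IsCenteredSolution γ A UL UR w)
    {M M' : GasState} {P Q : ℝ → GasState} {α β α' β' : ℝ}
    (hP : IsSimpleWave γ A 0 P UL M α β) (hQ : IsSimpleWave γ A 2 Q M' UR α' β')
    (hρ : M.ρ = M'.ρ) (hv : M.v = M'.v) :
    {ξ | w ξ ≠ if ξ < M.v then P ξ else Q ξ}.Finite := by
  obtain ⟨M₁, M₁', P₁, Q₁, α₁, β₁, α₁', β₁', hP₁, hQ₁, hρ₁, hv₁, hfin⟩ :=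
    IsCenteredSolution.structure h hw
  have hM : M₁.ρ = M.ρ := middle_density_unique h hP.left_physical.1 hQ.right_physical.1
    hP₁.right_physical.1 hP.right_physical.1
    ((middle_density_eq h hP₁ hQ₁ hρ₁ hv₁).trans (middle_density_eq h hP hQ hρ hv).symm)
  obtain ⟨rfl, hPP⟩ := IsSimpleWave.unique h hP₁ hP hM
  obtain ⟨rfl, hQQ⟩ := IsSimpleWave.unique_two h hQ₁ hQ (by rw [← hρ₁, hρ])
  -- The values on the lines of the outer jumps are arbitrary, so these two points are also
  -- exempted.
  refine ((hfin.insert β₁').insert α₁).subset fun ξ hξ => ?_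
  simp only [mem_insert_iff]
  by_contra hcon
  push Not at hcon
  refine hcon.2.2 fun heq => hξ ?_
  rw [heq, hPP ξ hcon.1, hQQ ξ hcon.2.1]

/-- The waves of the solution of the Riemann problem. -/
theorem exists_waves (h : IsGasLaw γ A) (hL : UL.IsPhysical) (hR : UR.IsPhysical) :
    ∃ (M M' : GasState) (P Q : ℝ → GasState) (α β α' β' : ℝ), IsSimpleWave γ A 0 P UL M α β ∧
      IsSimpleWave γ A 2 Q M' UR α' β' ∧ M.ρ = M'.ρ ∧ M.v = M'.v ∧
      IsSelfSimilarSolution γ A fun ξ => if ξ < M.v then P ξ else Q ξ := by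
  have hqL := doppler_pos hL.2.1
  obtain ⟨ρ, hρ, hρe⟩ := exists_middle_density h hL.1 hR.1 (div_pos (doppler_pos hR.2.1) hqL)
  obtain ⟨P, M, α, β, hMρ, hP, hPs⟩ := exists_isSimpleWave h hL hρ
  obtain ⟨Q, M', α', β', hMρ', hQ, hQs⟩ := exists_isSimpleWave_two h hR hρ
  have hρρ : M.ρ = M'.ρ := hMρ.trans hMρ'.symm
  have hv : M.v = M'.v := by
    -- The equation solved by `ρ` says that the two outer waves reach the same velocity.
    refine doppler_injOn hP.right_physical.2.1.2 hQ.left_physical.2.1.2 ?_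
    have h1 := IsSimpleWave.doppler_eq h hP
    have h2 := IsSimpleWave.doppler_eq_two h hQ
    rw [hMρ] at h1
    rw [hMρ'] at h2
    rw [eq_div_iff hqL.ne', h2] at hρe
    refine mul_right_cancel₀ (waveFactor_pos h (ρ / UR.ρ)).ne' ?_
    rw [h1, ← hρe]
    ring
  refine ⟨M, M', P, Q, α, β, α', β', hP, hQ, hρρ, hv, hPs.glue hQs ?_⟩
  rw [hP.eq_right _ (IsSimpleWave.lt_right_v h hP),
    hQ.eq_left _ (hv ▸ IsSimpleWave.left_v_lt h hQ)]
  exact rankineHugoniot_contact h hP.right_physical hQ.left_physical hv hρρ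

theorem IsElementaryWave.congr {i : Fin 3} {w w' : ℝ → GasState} {U M : GasState} {α β : ℝ}
    (hw : IsElementaryWave γ A i w U M α β) (he : ∀ ξ ∈ Icc α β, w' ξ = w ξ) :
    IsElementaryWave γ A i w' U M α β := by
  rcases hw with ⟨hi, hR⟩ | hS
  · exact Or.inl ⟨hi, hR.congr he⟩
  · exact Or.inr hS

/-- Three waves make a wave fan. -/
theorem isWaveFan_three (h : IsGasLaw γ A) {M M' : GasState} {P Q : ℝ → GasState}
    {α β α' β' : ℝ} (hP : IsSimpleWave γ A 0 P UL M α β) (hQ : IsSimpleWave γ A 2 Q M' UR α' β')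
    (hρ : M.ρ = M'.ρ) (hv : M.v = M'.v) :
    IsWaveFan γ A UL UR (fun ξ => if ξ < M.v then P ξ else Q ξ) 3 id ![UL, M, M', UR]
      ![α, M.v, α'] ![β, M.v, β'] := by
  have hβ := IsSimpleWave.lt_right_v h hP
  have hα' : M.v < α' := hv ▸ IsSimpleWave.left_v_lt h hQ
  have h1 := hP.le
  have h2 := hQ.le
  refine ⟨rfl, rfl, ?_, ?_, ?_, ?_⟩
  · intro j
    fin_cases j
    exacts [hP.left_physical, hP.right_physical, hQ.left_physical, hQ.right_physical]
  · intro j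
    match j with
    | 0 =>
      exact (hP.isElementaryWave (by decide)).congr fun ξ hξ => if_pos (hξ.2.trans_lt hβ)
    | 1 =>
      exact Or.inr (Or.inr ⟨rfl, rfl, rankineHugoniot_contact h hP.right_physical
        hQ.left_physical hv hρ, rfl, hv⟩)
    | 2 =>
      exact (hQ.isElementaryWave (by decide)).congr fun ξ hξ =>
        if_neg (hα'.trans_le hξ.1).not_gt
  · intro j k hjk
    fin_cases j <;> fin_cases k <;> simp at hjk ⊢ <;> linarith
  · intro j ξ hl hr
    match j with
    | 0 =>
      have h3 : ξ < α := hr 0 (by decide)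
      change (if ξ < M.v then P ξ else Q ξ) = UL
      rw [if_pos (by linarith), hP.eq_left ξ h3]
    | 1 =>
      have h3 : β < ξ := hl 0 (by decide)
      have h4 : ξ < M.v := hr 1 (by decide)
      change (if ξ < M.v then P ξ else Q ξ) = M
      rw [if_pos h4, hP.eq_right ξ h3]
    | 2 =>
      have h3 : M.v < ξ := hl 1 (by decide)
      have h4 : ξ < α' := hr 2 (by decide)
      change (if ξ < M.v then P ξ else Q ξ) = M'
      rw [if_neg h3.not_gt, hQ.eq_left ξ h4]
    | 3 =>
      have h3 : β' < ξ := hl 2 (by decide)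
      change (if ξ < M.v then P ξ else Q ξ) = UR
      rw [if_neg (by linarith), hQ.eq_right ξ h3]

end Uniqueness

/-! ### From self-similar profiles to the integral form of the conservation laws. -/

section WeakSolution

/-! ### Self-similar solutions are weak solutions -/

/-- A `C¹` function `φ` of compact support on the plane, with its partial derivatives. -/
structure IsTestFunction (φ φx φt : ℝ × ℝ → ℝ) (K R : ℝ) : Prop where
  continuous : Continuous φ
  continuous_x : Continuous φx
  continuous_t : Continuous φt
  hasFDerivAt : ∀ q, ∃ L : ℝ × ℝ →L[ℝ] ℝ, HasFDerivAt φ L q ∧ L (1, 0) = φx q ∧ L (0, 1) = φt q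
  radius_pos : 0 < R
  bound : ∀ q, |φ q| ≤ K ∧ |φx q| ≤ K ∧ |φt q| ≤ K
  support : ∀ q, R < ‖q‖ → φ q = 0 ∧ φx q = 0 ∧ φt q = 0

theorem exists_isTestFunction {φ : ℝ × ℝ → ℝ} (hφ : ContDiff ℝ 1 φ) (hs : HasCompactSupport φ) :
    ∃ K R, IsTestFunction φ (fun q => fderiv ℝ φ q (1, 0)) (fun q => fderiv ℝ φ q (0, 1)) K R := by
  have hf : Continuous (fderiv ℝ φ) := hφ.continuous_fderiv (by norm_num)
  have hx : Continuous fun q => fderiv ℝ φ q (1, 0) := hf.clm_apply continuous_const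
  have ht : Continuous fun q => fderiv ℝ φ q (0, 1) := hf.clm_apply continuous_const
  have hs' : HasCompactSupport (fderiv ℝ φ) := hs.fderiv (𝕜 := ℝ)
  have hsx : HasCompactSupport fun q => fderiv ℝ φ q (1, 0) :=
    hs'.comp_left (g := fun L : ℝ × ℝ →L[ℝ] ℝ => L (1, 0)) rfl
  have hst : HasCompactSupport fun q => fderiv ℝ φ q (0, 1) :=
    hs'.comp_left (g := fun L : ℝ × ℝ →L[ℝ] ℝ => L (0, 1)) rfl
  obtain ⟨K₁, hK₁⟩ := hφ.continuous.bounded_above_of_compact_support hs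
  obtain ⟨K₂, hK₂⟩ := hx.bounded_above_of_compact_support hsx
  obtain ⟨K₃, hK₃⟩ := ht.bounded_above_of_compact_support hst
  obtain ⟨R, hR⟩ := hs.isBounded.subset_closedBall 0
  have hsub : ∀ q, R < ‖q‖ → q ∉ tsupport φ := fun q hq hmem =>
    absurd (mem_closedBall_zero_iff.1 (hR hmem)) hq.not_ge
  have hd : ∀ q, R < ‖q‖ → fderiv ℝ φ q = 0 := fun q hq => by
    by_contra hne
    exact hsub q hq (support_fderiv_subset ℝ hne)
  refine ⟨max K₁ (max K₂ K₃), max R 1, hφ.continuous, hx, ht, fun q =>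
    ⟨_, ((hφ.differentiable (by norm_num)) q).hasFDerivAt, rfl, rfl⟩, by positivity, fun q =>
    ⟨(hK₁ q).trans (le_max_left _ _), (hK₂ q).trans ((le_max_left _ _).trans (le_max_right _ _)),
      (hK₃ q).trans ((le_max_right _ _).trans (le_max_right _ _))⟩, fun q hq => ?_⟩
  have hq' := (le_max_left R 1).trans_lt hq
  simp [image_eq_zero_of_notMem_tsupport (hsub q hq'), hd q hq']

variable {φ φx φt : ℝ × ℝ → ℝ} {K R : ℝ} {u f : ℝ → ℝ} {C : ℝ}

theorem IsTestFunction.hasDerivAt_ξ (hφ : IsTestFunction φ φx φt K R) (t ξ : ℝ) :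
    HasDerivAt (fun ξ => φ (t * ξ, t)) (t * φx (t * ξ, t)) ξ := by
  obtain ⟨L, hL, h1, h2⟩ := hφ.hasFDerivAt (t * ξ, t)
  have hc : HasDerivAt (fun ξ : ℝ => (t * ξ, t)) (t, 0) ξ := by
    have := ((hasDerivAt_id ξ).const_mul t).prodMk (hasDerivAt_const ξ t)
    simpa using this
  refine (HasFDerivAt.comp_hasDerivAt (f := fun ξ : ℝ => (t * ξ, t)) ξ hL hc).congr_deriv ?_
  rw [← h1, show ((t, 0) : ℝ × ℝ) = t • (1, 0) by simp, map_smul, smul_eq_mul]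

theorem IsTestFunction.hasDerivAt_t (hφ : IsTestFunction φ φx φt K R) (t ξ : ℝ) :
    HasDerivAt (fun t => φ (t * ξ, t)) (ξ * φx (t * ξ, t) + φt (t * ξ, t)) t := by
  obtain ⟨L, hL, h1, h2⟩ := hφ.hasFDerivAt (t * ξ, t)
  have hc : HasDerivAt (fun t : ℝ => (t * ξ, t)) (ξ, 1) t := by
    have := ((hasDerivAt_id t).mul_const ξ).prodMk (hasDerivAt_id t)
    simpa using this
  refine (HasFDerivAt.comp_hasDerivAt (f := fun t : ℝ => (t * ξ, t)) t hL hc).congr_deriv ?_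
  rw [← h1, ← h2, show ((ξ, 1) : ℝ × ℝ) = ξ • (1, 0) + (0, 1) by simp, map_add, map_smul,
    smul_eq_mul]

theorem lt_norm_of_lt_abs_fst {x t R : ℝ} (h : R < |x|) : R < ‖((x, t) : ℝ × ℝ)‖ :=
  h.trans_le (norm_fst_le (x, t))

theorem lt_norm_of_lt_abs_snd {x t R : ℝ} (h : R < |t|) : R < ‖((x, t) : ℝ × ℝ)‖ :=
  h.trans_le (norm_snd_le (x, t))

theorem integrable_of_bound_of_support {g : ℝ → ℝ} (hg : Measurable g) {B r : ℝ}
    (hb : ∀ x, |g x| ≤ B) (hs : ∀ x, r < |x| → g x = 0) : Integrable g := by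
  have : IntegrableOn g (Icc (-r) r) :=
    Measure.integrableOn_of_bounded (M := B) (by simp) hg.aestronglyMeasurable
      (ae_of_all _ hb)
  refine (integrableOn_iff_integrable_of_support_subset fun x hx => ?_).1 this
  by_contra hcon
  refine hx (hs x ?_)
  by_contra hle
  exact hcon (abs_le.1 (not_lt.1 hle))

/-- Integration by parts on a line `t = const`. -/
theorem integral_by_parts (hφ : IsTestFunction φ φx φt K R) (hu : Measurable u)
    (hub : ∀ ξ, |u ξ| ≤ C) (hc : Continuous fun ξ => f ξ - ξ * u ξ) {E : Set ℝ} (hE : E.Finite)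
    (hd : ∀ ξ ∉ E, HasDerivAt (fun ξ => f ξ - ξ * u ξ) (-(u ξ)) ξ) {t : ℝ} (ht : 0 < t) :
    Integrable (fun ξ => u ξ * φ (t * ξ, t)) ∧
    Integrable (fun ξ => (f ξ - ξ * u ξ) * (t * φx (t * ξ, t))) ∧
    ∫ ξ, u ξ * φ (t * ξ, t) = ∫ ξ, (f ξ - ξ * u ξ) * (t * φx (t * ξ, t)) := by
  have hm1 : Measurable fun ξ => u ξ * φ (t * ξ, t) :=
    hu.mul (hφ.continuous.comp (by fun_prop)).measurable
  have hc2 : Continuous fun ξ => (f ξ - ξ * u ξ) * (t * φx (t * ξ, t)) :=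
    hc.mul (continuous_const.mul (hφ.continuous_x.comp (by fun_prop)))
  have hC : 0 ≤ C := (abs_nonneg _).trans (hub 0)
  have hlarge : ∀ ξ, R / t < |ξ| → R < ‖((t * ξ, t) : ℝ × ℝ)‖ := fun ξ hξ => by
    apply lt_norm_of_lt_abs_fst
    rw [abs_mul, abs_of_pos ht]
    rwa [div_lt_iff₀' ht] at hξ
  have hi1 : Integrable fun ξ => u ξ * φ (t * ξ, t) :=
    integrable_of_bound_of_support hm1 (B := C * K) (r := R / t) (fun ξ => by
      rw [abs_mul]
      exact mul_le_mul (hub ξ) (hφ.bound _).1 (abs_nonneg _) hC) fun ξ hξ => by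
      rw [(hφ.support _ (hlarge ξ hξ)).1, mul_zero]
  have hi2 : Integrable fun ξ => (f ξ - ξ * u ξ) * (t * φx (t * ξ, t)) := by
    refine hc2.integrable_of_hasCompactSupport (HasCompactSupport.intro
      (isCompact_Icc (a := -(R / t)) (b := R / t)) fun ξ hξ => ?_)
    have : R / t < |ξ| := by
      by_contra hle
      exact hξ (abs_le.1 (not_lt.1 hle))
    rw [(hφ.support _ (hlarge ξ this)).2.1, mul_zero, mul_zero]
  refine ⟨hi1, hi2, ?_⟩
  have hr : 0 < R / t := div_pos hφ.radius_pos ht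
  -- Strictly larger than `R / t`, so the boundary terms at `±r` vanish.
  set r := R / t + 1 with hr'
  have hF : Continuous fun ξ => (f ξ - ξ * u ξ) * φ (t * ξ, t) :=
    hc.mul (hφ.continuous.comp (by fun_prop))
  have key := integral_eq_of_hasDerivAt_off_countable (a := -r) (b := r)
    (fun ξ => (f ξ - ξ * u ξ) * φ (t * ξ, t))
    (fun ξ => -(u ξ) * φ (t * ξ, t) + (f ξ - ξ * u ξ) * (t * φx (t * ξ, t))) hE.countable
    hF.continuousOn (fun ξ hξ => (hd ξ hξ.2).mul (hφ.hasDerivAt_ξ t ξ))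
    ((hi1.neg.congr (ae_of_all _ fun ξ => by simp)).add hi2).intervalIntegrable
  rw [intervalIntegral.integral_eq_integral_of_support_subset] at key
  · have h1 : φ (t * r, t) = 0 := (hφ.support _ (hlarge r (by
      rw [abs_of_pos (by linarith)]; linarith))).1
    have h2 : φ (t * -r, t) = 0 := (hφ.support _ (hlarge (-r) (by
      rw [abs_neg, abs_of_pos (by linarith)]; linarith))).1
    simp only [h1, h2, mul_zero, sub_zero, neg_mul] at key
    have hneg : Integrable fun ξ => -(u ξ * φ (t * ξ, t)) := hi1.neg
    rw [integral_add hneg hi2, integral_neg] at key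
    linarith
  · intro ξ hξ
    by_contra hcon
    have hlt : R / t < |ξ| := by
      by_contra hle
      have := abs_le.1 (not_lt.1 hle)
      exact hcon ⟨by linarith, by linarith⟩
    have := hφ.support _ (hlarge ξ hlt)
    refine hξ ?_
    simp [this.1, this.2.1]

/-- The time derivative of the integral of a conserved quantity against a test function. -/
theorem hasDerivAt_integral_self_similar (hφ : IsTestFunction φ φx φt K R) (hu : Measurable u)
    (hub : ∀ ξ, |u ξ| ≤ C) (hc : Continuous fun ξ => f ξ - ξ * u ξ) {E : Set ℝ} (hE : E.Finite)
    (hd : ∀ ξ ∉ E, HasDerivAt (fun ξ => f ξ - ξ * u ξ) (-(u ξ)) ξ) {t : ℝ} (ht : 0 < t) :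
    HasDerivAt (fun t => ∫ x, u (x / t) * φ (x, t))
      (∫ x, (u (x / t) * φt (x, t) + f (x / t) * φx (x, t))) t := by
  have hC : 0 ≤ C := (abs_nonneg _).trans (hub 0)
  have hK : 0 ≤ K := (abs_nonneg _).trans (hφ.bound 0).1
  have hR := hφ.radius_pos
  have hsub : ∀ (g : ℝ → ℝ) (s : ℝ), 0 < s → ∫ x, g x = s * ∫ ξ, g (s * ξ) := fun g s hs => by
    rw [Measure.integral_comp_mul_left, abs_of_pos (inv_pos.2 hs), smul_eq_mul, ← mul_assoc,
      mul_inv_cancel₀ hs.ne', one_mul]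
  -- Substituting `x = s ξ` moves the time dependence from `u`, which may jump, to the smooth `φ`.
  have hGeq : ∀ s, 0 < s → ∫ x, u (x / s) * φ (x, s) = ∫ ξ, u ξ * (s * φ (s * ξ, s)) :=
    fun s hs => by
    rw [hsub _ s hs, ← integral_const_mul]
    congr 1
    funext ξ
    rw [mul_div_cancel_left₀ _ hs.ne']
    ring
  obtain ⟨r, hr⟩ : ∃ r, r = 2 * R / t := ⟨_, rfl⟩
  have hr0 : 0 < r := by rw [hr]; positivity
  have hlarge : ∀ s ∈ Ioi (t / 2), ∀ ξ, r < |ξ| → R < ‖((s * ξ, s) : ℝ × ℝ)‖ := by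
    intro s hs ξ hξ
    have hs' : t / 2 < s := hs
    apply lt_norm_of_lt_abs_fst
    have hs0 : 0 < s := by linarith
    rw [abs_mul, abs_of_pos hs0]
    rw [hr, div_lt_iff₀' ht] at hξ
    nlinarith [abs_nonneg ξ]
  have hder := hasDerivAt_integral_of_dominated_loc_of_deriv_le (μ := volume)
    (F := fun s ξ => u ξ * (s * φ (s * ξ, s)))
    (F' := fun s ξ => u ξ * (1 * φ (s * ξ, s) + s * (ξ * φx (s * ξ, s) + φt (s * ξ, s))))
    -- For `s > t/2` the support of `φ` forces `|ξ| ≤ r = 2R/t`; it also forces `s ≤ R`, which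
    -- bounds the factor `s`.
    (bound := (Icc (-r) r).indicator fun _ => C * (K + R * (r * K + K)))
    (x₀ := t) (s := Ioi (t / 2)) (Ioi_mem_nhds (by linarith))
    (.of_forall fun s => (hu.mul (continuous_const.mul
      (hφ.continuous.comp (by fun_prop))).measurable).aestronglyMeasurable)
    (((integral_by_parts hφ hu hub hc hE hd ht).1.const_mul t).congr
      (ae_of_all _ fun ξ => by dsimp only; ring))
    (hu.mul (Continuous.measurable (by
      have := hφ.continuous
      have := hφ.continuous_x
      have := hφ.continuous_t
      fun_prop))).aestronglyMeasurable
    (ae_of_all _ fun ξ s hs => ?_)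
    ((integrable_indicator_iff measurableSet_Icc).2 continuous_const.integrableOn_Icc)
    (ae_of_all _ fun ξ s _ => ((hasDerivAt_id s).mul (hφ.hasDerivAt_t s ξ)).const_mul (u ξ))
  · refine (hder.2.congr_of_eventuallyEq ?_).congr_deriv ?_
    · filter_upwards [Ioi_mem_nhds ht] with s hs
      exact hGeq s hs
    · obtain ⟨hi1, hi2, heq⟩ := integral_by_parts hφ hu hub hc hE hd ht
      rw [hsub (fun x => u (x / t) * φt (x, t) + f (x / t) * φx (x, t)) t ht,
        ← integral_const_mul]
      -- The two integrands differ by that of the identity `integral_by_parts`, whose integral is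
      -- zero.
      have hsum : ∀ ξ, t * (u (t * ξ / t) * φt (t * ξ, t) + f (t * ξ / t) * φx (t * ξ, t)) =
          u ξ * (1 * φ (t * ξ, t) + t * (ξ * φx (t * ξ, t) + φt (t * ξ, t))) -
          (u ξ * φ (t * ξ, t) - (f ξ - ξ * u ξ) * (t * φx (t * ξ, t))) := fun ξ => by
        rw [mul_div_cancel_left₀ _ ht.ne']
        ring
      simp only [hsum]
      have h3 : ∫ ξ, (u ξ * φ (t * ξ, t) - (f ξ - ξ * u ξ) * (t * φx (t * ξ, t))) = 0 := by
        rw [integral_sub hi1 hi2, heq, sub_self]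
      have hi3 : Integrable fun ξ =>
          u ξ * φ (t * ξ, t) - (f ξ - ξ * u ξ) * (t * φx (t * ξ, t)) := hi1.sub hi2
      rw [integral_sub hder.1 hi3, h3, sub_zero]
  · have hs' : t / 2 < s := hs
    have hs0 : 0 < s := by linarith
    by_cases hξ : r < |ξ|
    · have := hφ.support _ (hlarge s hs ξ hξ)
      simp only [this.1, this.2.1, this.2.2, mul_zero, add_zero, norm_zero]
      exact indicator_nonneg (fun _ _ => by positivity) _
    · rw [indicator_of_mem (show ξ ∈ Icc (-r) r from abs_le.1 (not_lt.1 hξ)), norm_mul]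
      refine mul_le_mul (hub ξ) ?_ (norm_nonneg _) hC
      by_cases hsR : R < s
      · have := hφ.support (s * ξ, s) (lt_norm_of_lt_abs_snd (hsR.trans_le (le_abs_self s)))
        simp only [this.1, this.2.1, this.2.2, mul_zero, add_zero, norm_zero]
        positivity
      · have hb := hφ.bound (s * ξ, s)
        rw [one_mul, Real.norm_eq_abs]
        refine (abs_add_le _ _).trans (add_le_add hb.1 ?_)
        rw [abs_mul, abs_of_pos hs0]
        refine mul_le_mul (not_lt.1 hsR) ?_ (abs_nonneg _) hR.le
        refine (abs_add_le _ _).trans (add_le_add ?_ hb.2.2)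
        rw [abs_mul]
        exact mul_le_mul (not_lt.1 hξ) hb.2.1 (abs_nonneg _) hr0.le

/-- The weak form of a scalar conservation law for a self-similar function. -/
theorem weak_form_self_similar (hφ : IsTestFunction φ φx φt K R) (hu : Measurable u)
    (hub : ∀ ξ, |u ξ| ≤ C) (hfb : ∀ ξ, |f ξ| ≤ C) (hc : Continuous fun ξ => f ξ - ξ * u ξ)
    {E : Set ℝ} (hE : E.Finite)
    (hd : ∀ ξ ∉ E, HasDerivAt (fun ξ => f ξ - ξ * u ξ) (-(u ξ)) ξ) {a b uL uR : ℝ}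
    (hL : ∀ ξ < a, u ξ = uL) (hR : ∀ ξ, b < ξ → u ξ = uR) :
    (∫ q in {q : ℝ × ℝ | 0 < q.2}, (u (q.1 / q.2) * φt q + f (q.1 / q.2) * φx q))
      + ∫ x : ℝ, (if x < 0 then uL else uR) * φ (x, 0) = 0 := by
  have hC : 0 ≤ C := (abs_nonneg _).trans (hub 0)
  have hK : 0 ≤ K := (abs_nonneg _).trans (hφ.bound 0).1
  have hf : Measurable f := by
    have : f = fun ξ => (f ξ - ξ * u ξ) + ξ * u ξ := by funext ξ; ring
    rw [this]
    exact hc.measurable.add (measurable_id.mul hu)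
  have hdiv : Measurable fun q : ℝ × ℝ => q.1 / q.2 := by fun_prop
  have hmeas : Measurable fun q : ℝ × ℝ => u (q.1 / q.2) * φt q + f (q.1 / q.2) * φx q :=
    ((hu.comp hdiv).mul hφ.continuous_t.measurable).add
      ((hf.comp hdiv).mul hφ.continuous_x.measurable)
  have hint : Integrable fun q : ℝ × ℝ => u (q.1 / q.2) * φt q + f (q.1 / q.2) * φx q := by
    have : IntegrableOn (fun q : ℝ × ℝ => u (q.1 / q.2) * φt q + f (q.1 / q.2) * φx q)
        (Metric.closedBall 0 R) :=
      Measure.integrableOn_of_bounded (M := C * K + C * K)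
        (isCompact_closedBall (0 : ℝ × ℝ) R).measure_lt_top.ne hmeas.aestronglyMeasurable
        (ae_of_all _ fun q => (abs_add_le _ _).trans (add_le_add
          (by rw [abs_mul]; exact mul_le_mul (hub _) (hφ.bound q).2.2 (abs_nonneg _) hC)
          (by rw [abs_mul]; exact mul_le_mul (hfb _) (hφ.bound q).2.1 (abs_nonneg _) hC)))
    refine (integrableOn_iff_integrable_of_support_subset fun q hq => ?_).1 this
    by_contra hcon
    rw [mem_closedBall_zero_iff, not_le] at hcon
    refine hq ?_
    simp [(hφ.support q hcon).2.1, (hφ.support q hcon).2.2]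
  have hset : {q : ℝ × ℝ | 0 < q.2} = univ ×ˢ Ioi 0 := by ext q; simp
  have hrestr : (volume : Measure (ℝ × ℝ)).restrict {q : ℝ × ℝ | 0 < q.2} =
      (volume : Measure ℝ).prod (volume.restrict (Ioi 0)) := by
    rw [hset, Measure.volume_eq_prod, ← Measure.prod_restrict, Measure.restrict_univ]
  have hint' := hint.restrict (s := {q : ℝ × ℝ | 0 < q.2})
  rw [hrestr] at hint' ⊢
  rw [integral_prod_symm _ hint']
  set u₀ : ℝ → ℝ := fun x => if x < 0 then uL else uR with hu₀
  -- For `t ≤ 0` the initial data replace `u (x / t)`, which makes `G` continuous from the right at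
  -- 0. The weak form is then the fundamental theorem of calculus for `G` on `(0, ∞)`.
  set G : ℝ → ℝ := fun t => ∫ x, (if t ≤ 0 then u₀ x else u (x / t)) * φ (x, t) with hG
  have hGpos : ∀ t, 0 < t → G t = ∫ x, u (x / t) * φ (x, t) := fun t ht => by
    simp only [hG, if_neg ht.not_ge]
  have hlimL : ∀ x : ℝ, x < 0 → ∀ᶠ t in nhdsWithin (0 : ℝ) (Ioi 0), u (x / t) = uL := by
    intro x hx
    have : Filter.Tendsto (fun t : ℝ => x / t) (nhdsWithin 0 (Ioi 0)) Filter.atBot := by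
      simp only [div_eq_mul_inv]
      exact tendsto_inv_nhdsGT_zero.const_mul_atTop_of_neg hx
    filter_upwards [this.eventually (Filter.eventually_lt_atBot a)] with t ht
    exact hL _ ht
  have hlimR : ∀ x : ℝ, 0 < x → ∀ᶠ t in nhdsWithin (0 : ℝ) (Ioi 0), u (x / t) = uR := by
    intro x hx
    have : Filter.Tendsto (fun t : ℝ => x / t) (nhdsWithin 0 (Ioi 0)) Filter.atTop := by
      simp only [div_eq_mul_inv]
      exact tendsto_inv_nhdsGT_zero.const_mul_atTop hx
    filter_upwards [this.eventually (Filter.eventually_gt_atTop b)] with t ht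
    exact hR _ ht
  have hG0 : G 0 = ∫ x, u₀ x * φ (x, 0) := by simp [hG]
  have hlim : Filter.Tendsto G (nhdsWithin 0 (Ioi 0)) (nhds (G 0)) := by
    rw [hG0]
    have : Filter.Tendsto (fun t => ∫ x, u (x / t) * φ (x, t)) (nhdsWithin 0 (Ioi 0))
        (nhds (∫ x, u₀ x * φ (x, 0))) := by
      -- For fixed `x ≠ 0`, `x / t` tends to `±∞` as `t` decreases to 0, so `u (x / t)` is
      -- eventually an end value.
      refine tendsto_integral_filter_of_dominated_convergence
        ((Icc (-R) R).indicator fun _ => C * K) ?_ ?_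
        ((integrable_indicator_iff measurableSet_Icc).2 continuous_const.integrableOn_Icc) ?_
      · exact .of_forall fun t => ((hu.comp (by fun_prop)).mul
          (hφ.continuous.comp (by fun_prop)).measurable).aestronglyMeasurable
      · refine .of_forall fun t => ae_of_all _ fun x => ?_
        by_cases hx : R < |x|
        · rw [(hφ.support (x, t) (lt_norm_of_lt_abs_fst hx)).1, mul_zero, norm_zero]
          exact indicator_nonneg (fun _ _ => by positivity) _
        · rw [indicator_of_mem (show x ∈ Icc (-R) R from abs_le.1 (not_lt.1 hx)), norm_mul]
          exact mul_le_mul (hub _) (hφ.bound _).1 (norm_nonneg _) hC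
      · have hne : ∀ᵐ x : ℝ, x ≠ 0 := by
          simp [ae_iff]
        filter_upwards [hne] with x hx
        have hφlim : Filter.Tendsto (fun t => φ (x, t)) (nhdsWithin 0 (Ioi 0))
            (nhds (φ (x, 0))) := by
          have : Continuous fun t => φ (x, t) := hφ.continuous.comp (by fun_prop)
          exact (this.tendsto 0).mono_left nhdsWithin_le_nhds
        refine Filter.Tendsto.mul ?_ hφlim
        refine tendsto_const_nhds.congr' ?_
        rcases lt_or_gt_of_ne hx with h1 | h1
        · filter_upwards [hlimL x h1] with t ht
          rw [ht]
          simp only [hu₀]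
          rw [if_pos h1]
        · filter_upwards [hlimR x h1] with t ht
          rw [ht]
          simp only [hu₀]
          rw [if_neg h1.not_gt]
    refine this.congr' ?_
    filter_upwards [self_mem_nhdsWithin] with t ht
    exact (hGpos t ht).symm
  have hcont : ContinuousWithinAt G (Ici 0) 0 := by
    rw [← continuousWithinAt_Ioi_iff_Ici]
    exact hlim
  have htop : Filter.Tendsto G Filter.atTop (nhds 0) := by
    refine tendsto_const_nhds.congr' ?_
    filter_upwards [Filter.eventually_gt_atTop R] with t ht
    have : ∀ x, φ (x, t) = 0 := fun x =>
      (hφ.support (x, t) (lt_norm_of_lt_abs_snd (ht.trans_le (le_abs_self t)))).1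
    simp [hG, this]
  have hderiv : ∀ t ∈ Ioi (0 : ℝ), HasDerivAt G
      (∫ x, (u (x / t) * φt (x, t) + f (x / t) * φx (x, t))) t := fun t ht => by
    refine (hasDerivAt_integral_self_similar hφ hu hub hc hE hd ht).congr_of_eventuallyEq ?_
    filter_upwards [Ioi_mem_nhds ht] with s hs
    exact hGpos s hs
  rw [integral_Ioi_of_hasDerivAt_of_tendsto hcont hderiv hint'.integral_prod_right htop, hG0]
  ring

variable {γ : ℝ} {A : ℝ → ℝ}

theorem locallyIntegrable_of_bounded {X : Type*} [TopologicalSpace X] [MeasurableSpace X]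
    {μ : Measure X} [IsLocallyFiniteMeasure μ] {g : X → ℝ} (hg : Measurable g) {B : ℝ}
    (hb : ∀ x, |g x| ≤ B) : LocallyIntegrable g μ := by
  intro x
  obtain ⟨s, hs, hμ⟩ := μ.finiteAt_nhds x
  exact ⟨s, hs, Measure.integrableOn_of_bounded (M := B) hμ.ne hg.aestronglyMeasurable
    (ae_of_all _ hb)⟩

theorem IsSelfSimilarSolution.isWeakSolution {w : ℝ → GasState} {UL UR : GasState}
    (hw : IsSelfSimilarSolution γ A w) {a b : ℝ} (hL : ∀ ξ < a, w ξ = UL)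
    (hR : ∀ ξ, b < ξ → w ξ = UR) :
    IsWeakSolution γ A (riemannData UL UR) fun q => w (q.1 / q.2) := by
  refine ⟨fun x t _ => hw.physical _, fun k => ?_⟩
  obtain ⟨C, hC⟩ := hw.bounded k
  obtain ⟨E, hE, hd⟩ := hw.hasDerivAt k
  have hdata : ∀ x, conserved γ A (riemannData UL UR x) k =
      if x < 0 then conserved γ A UL k else conserved γ A UR k := fun x => by
    rw [riemannData]
    split_ifs <;> rfl
  have hdiv : Measurable fun q : ℝ × ℝ => q.1 / q.2 := by fun_prop
  have hf : Measurable fun ξ => flux γ A (w ξ) k := by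
    have : (fun ξ => flux γ A (w ξ) k) = fun ξ =>
        (flux γ A (w ξ) k - ξ * conserved γ A (w ξ) k) + ξ * conserved γ A (w ξ) k := by
      funext ξ
      ring
    rw [this]
    exact (hw.continuous k).measurable.add (measurable_id.mul (hw.measurable k))
  refine ⟨(locallyIntegrable_of_bounded ((hw.measurable k).comp hdiv)
      fun q => (hC _).1).locallyIntegrableOn _,
    (locallyIntegrable_of_bounded (hf.comp hdiv) fun q => (hC _).2).locallyIntegrableOn _,
    ?_, fun φ hφ hs => ?_⟩
  · simp only [hdata]
    refine locallyIntegrable_of_bounded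
      (Measurable.ite measurableSet_Iio measurable_const measurable_const)
      (B := max |conserved γ A UL k| |conserved γ A UR k|) fun x => ?_
    split_ifs
    exacts [le_max_left _ _, le_max_right _ _]
  · obtain ⟨K, R, hφ'⟩ := exists_isTestFunction hφ hs
    simp only [hdata]
    exact weak_form_self_similar hφ' (hw.measurable k) (fun ξ => (hC ξ).1) (fun ξ => (hC ξ).2)
      (hw.continuous k) hE hd (fun ξ hξ => by rw [hL ξ hξ]) fun ξ hξ => by rw [hR ξ hξ]

end WeakSolution

end

/-! ### The Riemann problem: existence, structure and uniqueness. -/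

theorem mainTheorem2 (γ : ℝ) (hγ₁ : 1 < γ) (hγ₂ : γ < 2)
    (A : ℝ → ℝ) (hA₁ : ∀ S, 0 < S → 0 < A S) (hA₂ : ContDiffOn ℝ 1 A (Set.Ioi 0))
    (hA₃ : ∀ S, 0 < S → 0 < deriv A S)
    (hA₄ : ∀ M : ℝ, ∃ S, 0 < S ∧ M < A S)
    (UL UR : GasState) (hL : UL.IsPhysical) (hR : UR.IsPhysical) :
    ∃ w : ℝ → GasState,
      IsWeakSolution γ A (riemannData UL UR) (fun q => w (q.1 / q.2)) ∧
      (∃ (V : Fin 4 → GasState) (α β : Fin 3 → ℝ),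
        IsWaveFan γ A UL UR w 3 id V α β ∧ β 0 < α 1 ∧ β 1 < α 2 ∧
        (V 1).ρ = (V 2).ρ ∧ (V 1).v = (V 2).v) ∧
      ∀ w' : ℝ → GasState, IsCenteredSolution γ A UL UR w' → {ξ : ℝ | w' ξ ≠ w ξ}.Finite := by
  have h : IsGasLaw γ A := ⟨hγ₁, hγ₂, hA₁, hA₂.continuousOn,
    strictMonoOn_of_deriv_pos (convex_Ioi 0) hA₂.continuousOn fun S hS =>
      hA₃ S (by rwa [interior_Ioi] at hS), hA₄⟩
  obtain ⟨M, M', P, Q, α, β, α', β', hP, hQ, hρ, hv, hs⟩ := exists_waves h hL hR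
  have hβ := IsSimpleWave.lt_right_v h hP
  have hα' : M.v < α' := hv ▸ IsSimpleWave.left_v_lt h hQ
  have h1 := hP.le
  have h2 := hQ.le
  refine ⟨fun ξ => if ξ < M.v then P ξ else Q ξ,
    hs.isWeakSolution (a := α) (b := β') (fun ξ hξ => ?_) fun ξ hξ => ?_,
    ⟨_, _, _, isWaveFan_three h hP hQ hρ hv, hβ, hα', hρ, hv⟩,
    fun w' hw' => IsCenteredSolution.unique h hw' hP hQ hρ hv⟩
  · rw [if_pos (by linarith), hP.eq_left ξ hξ]
  · rw [if_neg (by linarith), hQ.eq_right ξ hξ]
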